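/- **Setting.** Let $M$ be a smooth 4-manifold with a para-Kähler–Einstein (pKE) structure $(g,K)$: $g$ is a pseudo-Riemannian metric, $K$ an endomorphism field of $TM$ with $K^2=\mathrm{id}$ and $g(KX,KY)=-g(X,Y)$ (so $g$ has signature $(2,2)$), both $\pm1$-eigendistributions of $K$ are integrable, the 2-form $\rho(X,Y)=g(KX,Y)$ is closed, and $g$ is Einstein. An adapted coframe on an open set is a smooth coframe $(\theta^1,\theta^2,\theta^3,\theta^4)=(\alpha^1,\alpha^2,\bar\alpha^1,\bar\alpha^2)$ with $g=2\theta^1\theta^3+2\theta^2\theta^4$, where $\theta^a\theta^b=\frac12(\theta^a\otimes\theta^b+\theta^b\otimes\theta^a)$, and $K=\theta^1\otimes\frac{\partial}{\partial\theta^1}+\theta^2\otimes\frac{\partial}{\partial\theta^2}-\theta^3\otimes\frac{\partial}{\partial\theta^3}-\theta^4\otimes\frac{\partial}{\partial\theta^4}$. Its Levi-Civita connection forms $\Gamma^a{}_b$ are given by $d\theta^a+\Gamma^a{}_b\wedge\theta^b=0$ and $g_{ac}\Gamma^c{}_b+g_{bc}\Gamma^c{}_a=0$, and its curvature by $d\Gamma^a{}_b+\Gamma^a{}_c\wedge\Gamma^c{}_b=\frac12R^a{}_{bcd}\theta^c\wedge\theta^d$.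 With $R_{abcd}=g_{ae}R^e{}_{bcd}$, $R_{ab}=R^c{}_{acb}$, $R=g^{ab}R_{ab}$, $\mathsf P_{ab}=\frac12R_{ab}-\frac1{12}Rg_{ab}$ and $$C_{abcd}=R_{abcd}+g_{ad}\mathsf P_{cb}-g_{ac}\mathsf P_{db}+g_{bc}\mathsf P_{da}-g_{bd}\mathsf P_{ca}$$ (the Weyl tensor), put $\Psi_0=C_{1414}$, $\Psi_1=C_{2414}$, $\Psi_2=-C_{1423}$, $\Psi_3=C_{1323}$, $\Psi_4=C_{2323}$ and $\Psi_2'=C_{1234}$ $(=-R/12)$. The anti-self-dual Weyl curvature has Petrov type $N$ if the binary quartic $\Psi_4t^4+4\Psi_3t^3s+6\Psi_2t^2s^2+4\Psi_1ts^3+\Psi_0s^4$ is nonzero with a real root of multiplicity four at each point. Let $J_2$ denote the coefficient of $\theta^3$ in $\Gamma^2{}_1$, and $J_4$ the coefficient of $\theta^3$ in $\Gamma^1{}_1$. **Theorem.** (A) Suppose that the anti-self-dual Weyl curvature of $(g,K)$ has Petrov type $N$ everywhere and that $J_2\neq0$ everywhere in the adapted coframes with $\Psi_0=\Psi_1=\Psi_2=\Psi_3=0$.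 For constants $c,d\ne0$, call an adapted coframe on an open set *$(c,d)$-normalized* if $$\Psi_0=\Psi_1=\Psi_2=\Psi_3=0,\qquad \Psi_4=c,\qquad J_2=d,\qquad J_4=0.$$ 1. Every point has an open neighbourhood $U$ and a sign $\sigma\in\{1,-1\}$ such that, for all $c,d\neq0$, a $(c,d)$-normalized coframe exists on $U$ if and only if $\sigma c>0$. 2. On every open set $U$ a $(c,d)$-normalized coframe is unique up to the reflection $(\theta^1,\theta^2,\theta^3,\theta^4)\mapsto(-\theta^1,\theta^2,-\theta^3,\theta^4)$: if $\theta$ is one, so is its reflection, and for any other one there is a continuous function $s:U\to\{1,-1\}$ such that it equals $\theta$ where $s=1$ and the reflection of $\theta$ where $s=-1$. 3. With respect to any $(c,d)$-normalized coframe on $U$ there are smooth functions $J_1,J_3,J_5,J_6,J_7,J_8$ on $U$ such that $\Gamma^1{}_4=\Gamma^4{}_1=0$ and, with $J_2=d$ and $J_4=0$, $$\begin{aligned} \Gamma^2{}_1&=J_1\theta^2+J_2\theta^3,\\ \Gamma^1{}_1&=-\tfrac32J_1\theta^1+J_3\theta^2+J_4\theta^3+\tfrac32J_2\theta^4,\\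 \Gamma^2{}_2&=-J_1\theta^1+J_5\theta^2+J_6\theta^3+J_2\theta^4,\\ \Gamma^1{}_2&=-\tfrac15\Big(2J_3+3J_5+7\tfrac{\Psi_2'}{J_2}\Big)\theta^1+J_7\theta^2+J_8\theta^3+\tfrac35J_6\theta^4 . \end{aligned}$$ (B) Let $k\in\mathbb R$ and let $F_1,F_2:\mathbb R\to\mathbb R$ be arbitrary smooth functions. On $\mathbb R^4$ with coordinates $(y^1,y^2,y^3,y^4)$ the forms $$\begin{aligned} \theta^1&=2e^{-3y^4}\Big(dy^1+\big(-16(y^3)^2+F_1(y^2)+y^3F_2(y^2)\big)dy^2\Big),\\ \theta^2&=8e^{-2y^4}\big(dy^3-y^1dy^2\big),\\ \theta^3&=e^{y^4}dy^2,\\ \theta^4&=-\tfrac12dy^4-\tfrac12ke^{-2y^4}\big(dy^3-y^1dy^2\big) \end{aligned}$$ are a coframe, and $g=2\theta^1\theta^3+2\theta^2\theta^4$, with the $K$ for which this coframe is adapted, is a pKE structure satisfying the hypotheses of (A). The coframe is $(1,-4)$-normalized, i.e. $\Psi_0=\dots=\Psi_3=0$, $\Psi_4=1$, $J_2=-4$,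 $J_4=0$; moreover $\Psi_2'=k$, and the relations of (A.3) hold with $J_1=J_6=J_7=0$, $J_3=-k/8$, $J_5=k/4$ (that is, $\Psi_2'=-8J_3=4J_5$) and some smooth function $J_8$. -/

import Mathlib

open scoped Manifold ContDiff

noncomputable section

namespace PKE

/-- The model space `ℝ⁴`. -/
abbrev E4 : Type := EuclideanSpace ℝ (Fin 4)

section Fields

variable (M : Type*) [TopologicalSpace M] [ChartedSpace E4 M]

/-- Vector fields on `M` (no regularity). -/
abbrev VField : Type _ := (x : M) → TangentSpace (𝓡 4) x

/-- One-forms on `M` (no regularity). -/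
abbrev OneForm : Type _ := (x : M) → Module.Dual ℝ (TangentSpace (𝓡 4) x)

/-- Fields of bilinear forms on `M` (no regularity). -/
abbrev BilinField : Type _ := (x : M) → LinearMap.BilinForm ℝ (TangentSpace (𝓡 4) x)

/-- Fields of endomorphisms of the tangent spaces of `M` (no regularity). -/
abbrev EndField : Type _ := (x : M) → Module.End ℝ (TangentSpace (𝓡 4) x)

/-- A coframe `θ¹, …, θ⁴`, its dual frame `∂/∂θ¹, …, ∂/∂θ⁴` and a matrix of
one-forms `Γᵃ_b`. These are bare data: what they have to satisfy is said in `IsNullFrameOn`.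
The indices `1, 2, 3, 4` are `0, 1, 2, 3` here, and
`(θ¹, θ², θ³, θ⁴) = (α¹, α², ᾱ¹, ᾱ²)`. -/
structure MovingFrame where
  /-- the coframe `θᵃ` -/
  coframe : Fin 4 → OneForm M
  /-- the dual frame `∂/∂θᵃ` -/
  frame : Fin 4 → VField M
  /-- the one-forms `Γᵃ_b` -/
  conn : Fin 4 → Fin 4 → OneForm M

end Fields

variable {M : Type*} [TopologicalSpace M] [ChartedSpace E4 M]

/-- The function `f` is smooth on the set `V`. -/
def SmoothFun (V : Set M) (f : M → ℝ) : Prop :=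
  ContMDiffOn (𝓡 4) 𝓘(ℝ, ℝ) ∞ f V

/-- The derivative of the function `f` at `x` in the direction `v`. -/
def dirDeriv (f : M → ℝ) (x : M) (v : TangentSpace (𝓡 4) x) : ℝ :=
  mfderiv (𝓡 4) 𝓘(ℝ, ℝ) f x v

/-- The Lie bracket of vector fields. -/
def bracket (X Y : VField M) : VField M :=
  VectorField.mlieBracket (𝓡 4) X Y

/-- `dθ(X, Y) = X(θ(Y)) - Y(θ(X)) - θ([X, Y])` for a one-form `θ`. -/
def dOne (θ : OneForm M) (X Y : VField M) (x : M) : ℝ :=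
  dirDeriv (fun y => θ y (Y y)) x (X x) - dirDeriv (fun y => θ y (X y)) x (Y x)
    - θ x (bracket X Y x)

/-- `dρ(X, Y, Z)` for a two-form `ρ`. -/
def dTwo (ρ : BilinField M) (X Y Z : VField M) (x : M) : ℝ :=
  dirDeriv (fun y => ρ y (Y y) (Z y)) x (X x)
    + dirDeriv (fun y => ρ y (Z y) (X y)) x (Y x)
    + dirDeriv (fun y => ρ y (X y) (Y y)) x (Z x)
    - ρ x (bracket X Y x) (Z x) - ρ x (bracket Y Z x) (X x) - ρ x (bracket Z X x) (Y x)

/-- `(α ∧ β)(X, Y) = α(X) β(Y) - α(Y) β(X)`. -/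
def wedge (α β : OneForm M) (X Y : VField M) (x : M) : ℝ :=
  α x (X x) * β x (Y x) - α x (Y x) * β x (X x)

/-- The constants `g_{ab}` (which equal `g^{ab}`): `g₁₃ = g₃₁ = g₂₄ = g₄₂ = 1`, the others `0`. -/
def η : Matrix (Fin 4) (Fin 4) ℝ :=
  !![0, 0, 1, 0; 0, 0, 0, 1; 1, 0, 0, 0; 0, 1, 0, 0]

namespace MovingFrame

variable (F : MovingFrame M)

/-- `2 θ¹ θ³ + 2 θ² θ⁴`, with `θᵃ θᵇ = ½ (θᵃ ⊗ θᵇ + θᵇ ⊗ θᵃ)`. -/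
def metric : BilinField M := fun x =>
  ∑ a, ∑ b, η a b • LinearMap.BilinForm.linMulLin (F.coframe a x) (F.coframe b x)

/-- The endomorphism `α¹ ⊗ ∂/∂α¹ + α² ⊗ ∂/∂α² - ᾱ¹ ⊗ ∂/∂ᾱ¹ - ᾱ² ⊗ ∂/∂ᾱ²`. -/
def paracomplex : EndField M := fun x =>
  (F.coframe 0 x).smulRight (F.frame 0 x) + (F.coframe 1 x).smulRight (F.frame 1 x)
    - (F.coframe 2 x).smulRight (F.frame 2 x) - (F.coframe 3 x).smulRight (F.frame 3 x)

/-- The components `Rᵃ_{bcd}` of the curvature: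
`dΓᵃ_b + Γᵃ_c ∧ Γᶜ_b = ½ Rᵃ_{bcd} θᶜ ∧ θᵈ`, evaluated on the frame. -/
def riemann (a b c d : Fin 4) (x : M) : ℝ :=
  dOne (F.conn a b) (F.frame c) (F.frame d) x
    + ∑ k, wedge (F.conn a k) (F.conn k b) (F.frame c) (F.frame d) x

/-- `R_{abcd} = g_{ae} Rᵉ_{bcd}`. -/
def riemannLow (a b c d : Fin 4) (x : M) : ℝ := ∑ e, η a e * F.riemann e b c d x

/-- The Ricci tensor `R_{ab} = Rᶜ_{acb}`. -/
def ricci (a b : Fin 4) (x : M) : ℝ := ∑ c, F.riemann c a c b x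

/-- The scalar curvature `R = g^{ab} R_{ab}`. -/
def scalar (x : M) : ℝ := ∑ a, ∑ b, η a b * F.ricci a b x

/-- The Schouten tensor `P_{ab} = ½ R_{ab} - (1/12) R g_{ab}`. -/
def schouten (a b : Fin 4) (x : M) : ℝ := F.ricci a b x / 2 - F.scalar x / 12 * η a b

/-- The Weyl tensor `C_{abcd}`. -/
def weyl (a b c d : Fin 4) (x : M) : ℝ :=
  F.riemannLow a b c d x + η a d * F.schouten c b x - η a c * F.schouten d b x
    + η b c * F.schouten d a x - η b d * F.schouten c a x

/-- `Ψ₀ = C₁₄₁₄`. -/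
def Ψ₀ (x : M) : ℝ := F.weyl 0 3 0 3 x

/-- `Ψ₁ = C₂₄₁₄`. -/
def Ψ₁ (x : M) : ℝ := F.weyl 1 3 0 3 x

/-- `Ψ₂ = -C₁₄₂₃`. -/
def Ψ₂ (x : M) : ℝ := -F.weyl 0 3 1 2 x

/-- `Ψ₃ = C₁₃₂₃`. -/
def Ψ₃ (x : M) : ℝ := F.weyl 0 2 1 2 x

/-- `Ψ₄ = C₂₃₂₃`. -/
def Ψ₄ (x : M) : ℝ := F.weyl 1 2 1 2 x

/-- `Ψ₂' = C₁₂₃₄`, from the self-dual Weyl curvature. -/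
def Ψ₂' (x : M) : ℝ := F.weyl 0 1 2 3 x

/-- The binary quartic of the anti-self-dual Weyl curvature at `x`, in homogeneous
coordinates `(s, t)`; the affine coordinate is `λ = t / s`. -/
def quartic (x : M) (s t : ℝ) : ℝ :=
  F.Ψ₄ x * t ^ 4 + 4 * F.Ψ₃ x * t ^ 3 * s + 6 * F.Ψ₂ x * t ^ 2 * s ^ 2
    + 4 * F.Ψ₁ x * t * s ^ 3 + F.Ψ₀ x * s ^ 4

/-- Petrov type `N` at `x`: the quartic is nonzero and has one real root `(a : b)`
of multiplicity four on the projective line. -/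
def PetrovTypeN (x : M) : Prop :=
  ∃ c a b : ℝ, c ≠ 0 ∧ (a, b) ≠ (0, 0) ∧ ∀ s t : ℝ, F.quartic x s t = c * (a * t - b * s) ^ 4

/-- The coefficient of `ᾱ¹` in `Γ²₁`. -/
def J₂ (x : M) : ℝ := F.conn 1 0 x (F.frame 2 x)

/-- The coefficient of `θ³` in `Γ¹₁`. -/
def J₄ (x : M) : ℝ := F.conn 0 0 x (F.frame 2 x)

/-- The reflection `(θ¹, θ², θ³, θ⁴) ↦ (-θ¹, θ², -θ³, θ⁴)` of a moving frame. -/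
def reflect : MovingFrame M where
  coframe a x := (![-1, 1, -1, 1] a : ℝ) • F.coframe a x
  frame a x := (![-1, 1, -1, 1] a : ℝ) • F.frame a x
  conn a b x := (![-1, 1, -1, 1] a * ![-1, 1, -1, 1] b : ℝ) • F.conn a b x

/-- The reduced form of the Levi-Civita connection on `V`, with coefficients `J₁, …, J₈`. -/
def ReducedConnection (V : Set M) (J₁ J₂ J₃ J₄ J₅ J₆ J₇ J₈ : M → ℝ) : Prop :=
  ∀ x ∈ V,
    F.conn 1 0 x = J₁ x • F.coframe 1 x + J₂ x • F.coframe 2 x ∧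
    F.conn 0 0 x = -(3 / 2 * J₁ x) • F.coframe 0 x + J₃ x • F.coframe 1 x
      + J₄ x • F.coframe 2 x + (3 / 2 * J₂ x) • F.coframe 3 x ∧
    F.conn 1 1 x = -(J₁ x) • F.coframe 0 x + J₅ x • F.coframe 1 x
      + J₆ x • F.coframe 2 x + J₂ x • F.coframe 3 x ∧
    F.conn 0 1 x = -(1 / 5 * (2 * J₃ x + 3 * J₅ x + 7 * (F.Ψ₂' x / J₂ x))) • F.coframe 0 x
      + J₇ x • F.coframe 1 x + J₈ x • F.coframe 2 x + (3 / 5 * J₆ x) • F.coframe 3 x ∧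
    F.conn 0 3 x = 0 ∧ F.conn 3 0 x = 0

end MovingFrame

variable [IsManifold (𝓡 4) ∞ M]

/-- The vector field `X` is smooth on the set `V`. -/
def SmoothVField (V : Set M) (X : VField M) : Prop :=
  ContMDiffOn (𝓡 4) (𝓡 4).tangent ∞ (fun x => (⟨x, X x⟩ : TangentBundle (𝓡 4) M)) V

/-- On the open set `V`, `F` consists of a smooth coframe with `g = 2 θ¹ θ³ + 2 θ² θ⁴`, its dual
frame, and the Levi-Civita connection forms of `g` in this coframe, which are determined by
`dθᵃ + Γᵃ_b ∧ θᵇ = 0` and `g_{ac} Γᶜ_b + g_{bc} Γᶜ_a = 0`.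
Smoothness of the coframe is expressed by smoothness of the dual frame. -/
structure IsNullFrameOn (g : BilinField M) (V : Set M) (F : MovingFrame M) : Prop where
  isOpen : IsOpen V
  smooth : ∀ a, SmoothVField V (F.frame a)
  dual : ∀ x ∈ V, ∀ a b, F.coframe a x (F.frame b x) = if a = b then 1 else 0
  metric_eq : ∀ x ∈ V, g x = F.metric x
  torsion_free : ∀ x ∈ V, ∀ a c d,
    dOne (F.coframe a) (F.frame c) (F.frame d) x
      + ∑ b, wedge (F.conn a b) (F.coframe b) (F.frame c) (F.frame d) x = 0
  metricity : ∀ x ∈ V, ∀ a b, ∑ c, (η a c • F.conn c b x + η b c • F.conn c a x) = 0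

/-- On the open set `V`, `F` is a coframe adapted to `(g, K)`, with its dual frame and
Levi-Civita connection forms. -/
structure IsAdaptedOn (g : BilinField M) (K : EndField M) (V : Set M) (F : MovingFrame M) : Prop
    extends IsNullFrameOn g V F where
  paracomplex_eq : ∀ x ∈ V, K x = F.paracomplex x

/-- `g` is Einstein: its trace-free Ricci tensor vanishes, in null coframes. -/
def IsEinstein (g : BilinField M) : Prop :=
  ∀ (V : Set M) (F : MovingFrame M), IsNullFrameOn g V F →
    ∀ x ∈ V, ∀ a b, F.ricci a b x = F.scalar x / 4 * η a b

/-- `(g, K)` is a para-Kähler-Einstein structure on the 4-manifold `M`.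
The signature `(2, 2)` of `g` and the rank `2` of the `±1`-eigenspaces of `K` follow from
nondegeneracy, `K² = 1` and `g(KX, KY) = -g(X, Y)`. -/
structure IsParaKaehlerEinstein (g : BilinField M) (K : EndField M) : Prop where
  symm : ∀ x v w, g x v w = g x w v
  nondegenerate : ∀ x, (g x).Nondegenerate
  smooth_metric : ∀ (V : Set M) (X Y : VField M), IsOpen V → SmoothVField V X →
    SmoothVField V Y → SmoothFun V (fun x => g x (X x) (Y x))
  smooth_endo : ∀ (V : Set M) (X : VField M), IsOpen V → SmoothVField V X →
    SmoothVField V (fun x => K x (X x))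
  sq_eq_one : ∀ x, K x * K x = 1
  compatible : ∀ x v w, g x (K x v) (K x w) = -g x v w
  /-- the `+1`-eigendistribution is integrable -/
  integrable_pos : ∀ (V : Set M) (X Y : VField M), IsOpen V → SmoothVField V X →
    SmoothVField V Y → (∀ x ∈ V, K x (X x) = X x) → (∀ x ∈ V, K x (Y x) = Y x) →
    ∀ x ∈ V, K x (bracket X Y x) = bracket X Y x
  /-- the `-1`-eigendistribution is integrable -/
  integrable_neg : ∀ (V : Set M) (X Y : VField M), IsOpen V → SmoothVField V X →
    SmoothVField V Y → (∀ x ∈ V, K x (X x) = -X x) → (∀ x ∈ V, K x (Y x) = -Y x) →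
    ∀ x ∈ V, K x (bracket X Y x) = -bracket X Y x
  /-- the para-Kähler form `ρ(X, Y) = g(KX, Y)` is closed -/
  closed : ∀ (V : Set M) (X Y Z : VField M), IsOpen V → SmoothVField V X →
    SmoothVField V Y → SmoothVField V Z →
    ∀ x ∈ V, dTwo (fun y => (g y).comp (K y) LinearMap.id) X Y Z x = 0
  einstein : IsEinstein g

/-- The anti-self-dual Weyl curvature of `(g, K)` has Petrov type `N` everywhere. -/
def HasPetrovTypeN (g : BilinField M) (K : EndField M) : Prop :=
  ∀ (V : Set M) (F : MovingFrame M), IsAdaptedOn g K V F → ∀ x ∈ V, F.PetrovTypeN x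

/-- `J₂` vanishes nowhere, in the adapted coframes with `Ψ₀ = Ψ₁ = Ψ₂ = Ψ₃ = 0`. -/
def J₂NonVanishing (g : BilinField M) (K : EndField M) : Prop :=
  ∀ (V : Set M) (F : MovingFrame M), IsAdaptedOn g K V F →
    (∀ x ∈ V, F.Ψ₀ x = 0 ∧ F.Ψ₁ x = 0 ∧ F.Ψ₂ x = 0 ∧ F.Ψ₃ x = 0) → ∀ x ∈ V, F.J₂ x ≠ 0

/-- On the open set `V`, `F` is an adapted coframe (with its dual frame and Levi-Civita
connection forms) in which `Ψ₀ = Ψ₁ = Ψ₂ = Ψ₃ = 0`, `Ψ₄ = c`, `J₂ = d` and `J₄ = 0`. -/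
structure IsNormalizedOn (g : BilinField M) (K : EndField M) (V : Set M) (F : MovingFrame M)
    (c d : ℝ) : Prop extends IsAdaptedOn g K V F where
  Ψ₀_eq : ∀ x ∈ V, F.Ψ₀ x = 0
  Ψ₁_eq : ∀ x ∈ V, F.Ψ₁ x = 0
  Ψ₂_eq : ∀ x ∈ V, F.Ψ₂ x = 0
  Ψ₃_eq : ∀ x ∈ V, F.Ψ₃ x = 0
  Ψ₄_eq : ∀ x ∈ V, F.Ψ₄ x = c
  J₂_eq : ∀ x ∈ V, F.J₂ x = d
  J₄_eq : ∀ x ∈ V, F.J₄ x = 0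

/-- The coordinate differentials `dy¹, …, dy⁴` on `ℝ⁴` (at the point `y`). -/
def dy (i : Fin 4) (y : E4) : Module.Dual ℝ (TangentSpace (𝓡 4) y) :=
  (EuclideanSpace.proj i : E4 →L[ℝ] ℝ).toLinearMap

/-- The explicit coframe on `ℝ⁴` with parameter `k` and functions `F₁(y²)`, `F₂(y²)`. -/
def exampleCoframe (k : ℝ) (F₁ F₂ : ℝ → ℝ) : Fin 4 → OneForm E4 :=
  ![fun y => (2 * Real.exp (-3 * y 3)) •
      (dy 0 y + (-16 * y 2 ^ 2 + F₁ (y 1) + y 2 * F₂ (y 1)) • dy 1 y),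
    fun y => (8 * Real.exp (-2 * y 3)) • (dy 2 y - y 0 • dy 1 y),
    fun y => Real.exp (y 3) • dy 1 y,
    fun y => (-1 / 2 : ℝ) • dy 3 y
      - (1 / 2 * k * Real.exp (-2 * y 3)) • (dy 2 y - y 0 • dy 1 y)]

end PKE

end

noncomputable section

namespace PKE

variable {M : Type*} [TopologicalSpace M] [ChartedSpace E4 M]

section Functions

variable {V W : Set M} {f f' : M → ℝ}

theorem SmoothFun.mono (h : SmoothFun V f) (hW : W ⊆ V) : SmoothFun W f := ContMDiffOn.mono h hW

theorem SmoothFun.congr (h : SmoothFun V f) (hf : ∀ x ∈ V, f' x = f x) : SmoothFun V f' :=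
  ContMDiffOn.congr h hf

theorem SmoothFun.const (c : ℝ) : SmoothFun V (fun _ => c) := contMDiffOn_const

theorem SmoothFun.add (h : SmoothFun V f) (h' : SmoothFun V f') :
    SmoothFun V (fun x => f x + f' x) := ContMDiffOn.add h h'

theorem SmoothFun.mul (h : SmoothFun V f) (h' : SmoothFun V f') :
    SmoothFun V (fun x => f x * f' x) := ContMDiffOn.mul h h'

theorem SmoothFun.neg (h : SmoothFun V f) : SmoothFun V (fun x => -f x) := ContMDiffOn.neg h

theorem SmoothFun.sub (h : SmoothFun V f) (h' : SmoothFun V f') :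
    SmoothFun V (fun x => f x - f' x) := ContMDiffOn.sub h h'

theorem SmoothFun.comp_real (h : SmoothFun V f) {φ : ℝ → ℝ}
    (hφ : ∀ x ∈ V, ContDiffAt ℝ ∞ φ (f x)) :
    SmoothFun V (fun x => φ (f x)) := fun x hx =>
  ContMDiffAt.comp_contMDiffWithinAt x (hφ x hx).contMDiffAt (h x hx)

theorem SmoothFun.inv (h : SmoothFun V f) (h0 : ∀ x ∈ V, f x ≠ 0) :
    SmoothFun V (fun x => (f x)⁻¹) :=
  h.comp_real (φ := fun y => y⁻¹) fun _ hx => contDiffAt_inv ℝ (h0 _ hx)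

theorem SmoothFun.div (h : SmoothFun V f) (h' : SmoothFun V f') (h0 : ∀ x ∈ V, f' x ≠ 0) :
    SmoothFun V (fun x => f x / f' x) :=
  (h.mul (h'.inv h0)).congr fun _ _ => div_eq_mul_inv _ _

theorem SmoothFun.sqrt (h : SmoothFun V f) (h0 : ∀ x ∈ V, f x ≠ 0) :
    SmoothFun V (fun x => Real.sqrt (f x)) :=
  h.comp_real (φ := Real.sqrt) fun x hx => Real.contDiffAt_sqrt (h0 x hx)

theorem SmoothFun.sum {ι : Type*} (s : Finset ι) {F : ι → M → ℝ} (h : ∀ i ∈ s, SmoothFun V (F i)) :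
    SmoothFun V (fun x => ∑ i ∈ s, F i x) := by
  classical
  induction s using Finset.induction_on with
  | empty => simpa using SmoothFun.const 0
  | insert a s ha ih =>
    simp only [Finset.sum_insert ha]
    exact (h a (by simp)).add (ih fun i hi => h i (by simp [hi]))

theorem SmoothFun.continuousOn (h : SmoothFun V f) : ContinuousOn f V := ContMDiffOn.continuousOn h

theorem SmoothFun.mdifferentiableAt (h : SmoothFun V f) (hV : IsOpen V) {x : M} (hx : x ∈ V) :
    MDifferentiableAt (𝓡 4) 𝓘(ℝ, ℝ) f x :=
  (ContMDiffOn.contMDiffAt h (hV.mem_nhds hx)).mdifferentiableAt (by simp)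

end Functions

section Deriv

variable {V : Set M} {f f' : M → ℝ} {x : M}

theorem dirDeriv_congr (hV : IsOpen V) (hx : x ∈ V) (h : ∀ y ∈ V, f y = f' y)
    (v : TangentSpace (𝓡 4) x) : dirDeriv f x v = dirDeriv f' x v := by
  have : f =ᶠ[nhds x] f' := Filter.eventuallyEq_of_mem (hV.mem_nhds hx) h
  rw [dirDeriv, dirDeriv, this.mfderiv_eq]
  rfl

theorem dirDeriv_const (c : ℝ) (v : TangentSpace (𝓡 4) x) : dirDeriv (fun _ => c) x v = 0 := by
  rw [dirDeriv, mfderiv_const]; rfl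

theorem dirDeriv_eq_zero (hV : IsOpen V) (hx : x ∈ V) {c : ℝ} (h : ∀ y ∈ V, f y = c)
    (v : TangentSpace (𝓡 4) x) : dirDeriv f x v = 0 := by
  rw [dirDeriv_congr hV hx h, dirDeriv_const]

theorem dirDeriv_add (h : SmoothFun V f) (h' : SmoothFun V f') (hV : IsOpen V) (hx : x ∈ V)
    (v : TangentSpace (𝓡 4) x) :
    dirDeriv (fun y => f y + f' y) x v = dirDeriv f x v + dirDeriv f' x v := by
  have := mfderiv_add (h.mdifferentiableAt hV hx) (h'.mdifferentiableAt hV hx)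
  exact congrArg (fun L : TangentSpace (𝓡 4) x →L[ℝ] ℝ => L v) this

theorem dirDeriv_mul (h : SmoothFun V f) (h' : SmoothFun V f') (hV : IsOpen V) (hx : x ∈ V)
    (v : TangentSpace (𝓡 4) x) :
    dirDeriv (fun y => f y * f' y) x v = f x * dirDeriv f' x v + f' x * dirDeriv f x v := by
  have := (((h.mdifferentiableAt hV hx).hasMFDerivAt).mul
    ((h'.mdifferentiableAt hV hx).hasMFDerivAt)).mfderiv
  exact congrArg (fun L : TangentSpace (𝓡 4) x →L[ℝ] ℝ => L v) this

theorem dirDeriv_neg (f : M → ℝ) (v : TangentSpace (𝓡 4) x) :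
    dirDeriv (fun y => -f y) x v = -dirDeriv f x v := by
  have : mfderiv (𝓡 4) 𝓘(ℝ, ℝ) (-f) x = -mfderiv (𝓡 4) 𝓘(ℝ, ℝ) f x := mfderiv_neg
  exact congrArg (fun L : TangentSpace (𝓡 4) x →L[ℝ] ℝ => L v) this

theorem dirDeriv_sub (h : SmoothFun V f) (h' : SmoothFun V f') (hV : IsOpen V) (hx : x ∈ V)
    (v : TangentSpace (𝓡 4) x) :
    dirDeriv (fun y => f y - f' y) x v = dirDeriv f x v - dirDeriv f' x v := by
  simp only [sub_eq_add_neg]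
  rw [dirDeriv_add h h'.neg hV hx, dirDeriv_neg]

theorem dirDeriv_sum {ι : Type*} (s : Finset ι) {F : ι → M → ℝ} (h : ∀ i ∈ s, SmoothFun V (F i))
    (hV : IsOpen V) (hx : x ∈ V) (v : TangentSpace (𝓡 4) x) :
    dirDeriv (fun y => ∑ i ∈ s, F i y) x v = ∑ i ∈ s, dirDeriv (F i) x v := by
  classical
  induction s using Finset.induction_on with
  | empty => simpa using dirDeriv_const 0 v
  | insert a s ha ih =>
    simp only [Finset.sum_insert ha]
    rw [dirDeriv_add (h a (by simp)) (SmoothFun.sum s fun i hi => h i (by simp [hi])) hV hx,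
      ih fun i hi => h i (by simp [hi])]

theorem dirDeriv_smul_right (f : M → ℝ) (c : ℝ) (v : TangentSpace (𝓡 4) x) :
    dirDeriv f x (c • v) = c * dirDeriv f x v := map_smul (mfderiv _ _ f x) c v

theorem dirDeriv_sum_right {ι : Type*} (s : Finset ι) (f : M → ℝ) (v : ι → TangentSpace (𝓡 4) x) :
    dirDeriv f x (∑ i ∈ s, v i) = ∑ i ∈ s, dirDeriv f x (v i) := map_sum (mfderiv _ _ f x) v s

end Deriv

section VectorFields

variable {V W : Set M} {X Y Z : VField M} {f : M → ℝ} {x : M}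

theorem bracket_congr {X' Y' : VField M} (hV : IsOpen V) (hx : x ∈ V) (hX : ∀ y ∈ V, X y = X' y)
    (hY : ∀ y ∈ V, Y y = Y' y) : bracket X Y x = bracket X' Y' x :=
  Filter.EventuallyEq.mlieBracket_vectorField_eq (Filter.eventuallyEq_of_mem (hV.mem_nhds hx) hX)
    (Filter.eventuallyEq_of_mem (hV.mem_nhds hx) hY)

theorem bracket_swap (X Y : VField M) (x : M) : bracket X Y x = -bracket Y X x :=
  VectorField.mlieBracket_swap_apply

variable [IsManifold (𝓡 4) ∞ M]

theorem SmoothVField.mono (h : SmoothVField V X) (hW : W ⊆ V) : SmoothVField W X :=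
  ContMDiffOn.mono h hW

theorem SmoothVField.congr (h : SmoothVField V X) (hX : ∀ x ∈ V, Y x = X x) : SmoothVField V Y :=
  ContMDiffOn.congr h fun x hx => by rw [hX x hx]

theorem SmoothVField.add (h : SmoothVField V X) (h' : SmoothVField V Y) :
    SmoothVField V (fun x => X x + Y x) := ContMDiffOn.add_section h h'

theorem SmoothVField.smul (hf : SmoothFun V f) (h : SmoothVField V X) :
    SmoothVField V (fun x => f x • X x) := ContMDiffOn.smul_section hf h

theorem SmoothVField.const_smul (c : ℝ) (h : SmoothVField V X) :
    SmoothVField V (fun x => c • X x) := SmoothVField.smul (SmoothFun.const c) h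

theorem SmoothVField.sum {ι : Type*} (s : Finset ι) {X : ι → VField M}
    (h : ∀ i ∈ s, SmoothVField V (X i)) : SmoothVField V (fun x => ∑ i ∈ s, X i x) := by
  exact ContMDiffOn.sum_section h

theorem SmoothVField.contMDiffAt (h : SmoothVField V X) (hV : IsOpen V) (hx : x ∈ V) :
    ContMDiffAt (𝓡 4) (𝓡 4).tangent ∞ (fun x => (⟨x, X x⟩ : TangentBundle (𝓡 4) M)) x :=
  ContMDiffOn.contMDiffAt h (hV.mem_nhds hx)

theorem SmoothVField.mdifferentiableAt (h : SmoothVField V X) (hV : IsOpen V) (hx : x ∈ V) :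
    MDifferentiableAt (𝓡 4) (𝓡 4).tangent (fun x => (⟨x, X x⟩ : TangentBundle (𝓡 4) M)) x :=
  (h.contMDiffAt hV hx).mdifferentiableAt (by simp)

instance isManifold_minSmoothness_two : IsManifold (𝓡 4) (minSmoothness ℝ 2) M :=
  IsManifold.of_le (n := ∞) (by rw [minSmoothness_of_isRCLikeNormedField]; exact WithTop.coe_le_coe.2 le_top)

instance isManifold_minSmoothness_three : IsManifold (𝓡 4) (minSmoothness ℝ 3) M :=
  IsManifold.of_le (n := ∞) (by rw [minSmoothness_of_isRCLikeNormedField]; exact WithTop.coe_le_coe.2 le_top)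

instance isManifold_infty_add_one : IsManifold (𝓡 4) (∞ + 1) M :=
  inferInstanceAs (IsManifold (𝓡 4) ∞ M)

theorem SmoothVField.bracket (hV : IsOpen V) (h : SmoothVField V X) (h' : SmoothVField V Y) :
    SmoothVField V (bracket X Y) := fun x hx =>
  (ContMDiffAt.mlieBracket_vectorField (n := ⊤) (m := ⊤) (h.contMDiffAt hV hx)
    (h'.contMDiffAt hV hx)
    (by rw [minSmoothness_of_isRCLikeNormedField]; rfl)).contMDiffWithinAt

theorem SmoothFun.dirDeriv (hV : IsOpen V) (hf : SmoothFun V f) (h : SmoothVField V X) :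
    SmoothFun V (fun x => dirDeriv f x (X x)) := by
  have h1 := ContMDiffOn.contMDiffOn_tangentMapWithin (m := ∞) hf (by simp) hV.uniqueMDiffOn
  have h2 := (contMDiff_snd_tangentBundle_modelSpace (n := ∞) ℝ 𝓘(ℝ, ℝ)).comp_contMDiffOn
    (h1.comp h (fun x hx => hx))
  refine h2.congr fun x hx => ?_
  simp only [Function.comp, tangentMapWithin, PKE.dirDeriv]
  rw [mfderivWithin_of_mem_nhds (hV.mem_nhds hx)]

theorem bracket_smul_right (X : VField M) (hV : IsOpen V) (hx : x ∈ V) (hf : SmoothFun V f)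
    (h : SmoothVField V Y) :
    bracket X (fun y => f y • Y y) x = dirDeriv f x (X x) • Y x + f x • bracket X Y x :=
  VectorField.mlieBracket_smul_right (hf.mdifferentiableAt hV hx) (h.mdifferentiableAt hV hx)

theorem bracket_add_right (X : VField M) (hV : IsOpen V) (hx : x ∈ V) (h : SmoothVField V Y)
    (h' : SmoothVField V Z) :
    bracket X (fun y => Y y + Z y) x = bracket X Y x + bracket X Z x :=
  VectorField.mlieBracket_add_right (h.mdifferentiableAt hV hx) (h'.mdifferentiableAt hV hx)

theorem bracket_sum_right {ι : Type*} (s : Finset ι) (X : VField M) (hV : IsOpen V) (hx : x ∈ V)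
    {Y : ι → VField M} (h : ∀ i ∈ s, SmoothVField V (Y i)) :
    bracket X (fun y => ∑ i ∈ s, Y i y) x = ∑ i ∈ s, bracket X (Y i) x := by
  classical
  induction s using Finset.induction_on with
  | empty =>
    simp only [Finset.sum_empty]
    exact congrFun (VectorField.mlieBracket_zero_right (I := 𝓡 4) (W := X)) x
  | insert a s ha ih =>
    simp only [Finset.sum_insert ha]
    rw [bracket_add_right X hV hx (h a (by simp)) (SmoothVField.sum s fun i hi => h i (by simp [hi])),
      ih fun i hi => h i (by simp [hi])]

theorem minSmoothness_two_le : minSmoothness ℝ 2 ≤ (∞ : WithTop ℕ∞) := by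
  rw [minSmoothness_of_isRCLikeNormedField]; exact WithTop.coe_le_coe.2 le_top

theorem jacobi (hV : IsOpen V) (hx : x ∈ V) (hX : SmoothVField V X) (hY : SmoothVField V Y)
    (hZ : SmoothVField V Z) :
    bracket X (bracket Y Z) x = bracket (bracket X Y) Z x + bracket Y (bracket X Z) x :=
  VectorField.leibniz_identity_mlieBracket_apply ((hX.contMDiffAt hV hx).of_le minSmoothness_two_le)
    ((hY.contMDiffAt hV hx).of_le minSmoothness_two_le)
    ((hZ.contMDiffAt hV hx).of_le minSmoothness_two_le)

/-- The bracket acts on functions as the commutator, as soon as some vector field does not vanish. -/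
theorem dirDeriv_bracket (hV : IsOpen V) (hx : x ∈ V) (hX : SmoothVField V X)
    (hY : SmoothVField V Y) (hZ : SmoothVField V Z) (hZ0 : Z x ≠ 0) (hf : SmoothFun V f) :
    dirDeriv f x (bracket X Y x) = dirDeriv (fun y => dirDeriv f y (Y y)) x (X x)
      - dirDeriv (fun y => dirDeriv f y (X y)) x (Y x) := by
  have key : ∀ {X Y : VField M}, SmoothVField V X → SmoothVField V Y →
      bracket X (bracket Y (fun y => f y • Z y)) x =
        (dirDeriv (fun y => dirDeriv f y (Y y)) x (X x) • Z x
          + dirDeriv f x (Y x) • bracket X Z x) +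
        (dirDeriv f x (X x) • bracket Y Z x + f x • bracket X (bracket Y Z) x) := by
    intro X Y hX hY
    rw [bracket_congr hV hx (fun _ _ => rfl)
      (fun y hy => bracket_smul_right Y hV hy hf hZ),
      bracket_add_right X hV hx (SmoothVField.smul (hf.dirDeriv hV hY) hZ)
      (SmoothVField.smul hf (hY.bracket hV hZ)),
      bracket_smul_right X hV hx (hf.dirDeriv hV hY) hZ,
      bracket_smul_right X hV hx hf (hY.bracket hV hZ)]
  have h1 := jacobi hV hx hX hY (SmoothVField.smul hf hZ)
  rw [key hX hY, key hY hX, bracket_smul_right _ hV hx hf hZ, jacobi hV hx hX hY hZ] at h1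
  have h2 : (dirDeriv f x (bracket X Y x) - (dirDeriv (fun y => dirDeriv f y (Y y)) x (X x)
      - dirDeriv (fun y => dirDeriv f y (X y)) x (Y x))) • Z x = 0 := by
    linear_combination (norm := module) (-1 : ℝ) • h1
  rcases smul_eq_zero.1 h2 with h | h
  · linarith
  · exact absurd h hZ0

end VectorFields

end PKE

namespace PKE

/-- The index `bar a` is the one with `η a (bar a) = 1`. -/
def bar : Fin 4 → Fin 4 := ![2, 3, 0, 1]

@[simp] theorem bar_bar (a : Fin 4) : bar (bar a) = a := by fin_cases a <;> rfl
@[simp] theorem bar_zero : bar 0 = 2 := rfl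
@[simp] theorem bar_one : bar 1 = 3 := rfl
@[simp] theorem bar_two : bar 2 = 0 := rfl
@[simp] theorem bar_three : bar 3 = 1 := rfl

theorem sum_bar {A : Type*} [AddCommMonoid A] (f : Fin 4 → A) : ∑ a, f (bar a) = ∑ a, f a :=
  Equiv.sum_comp ⟨bar, bar, bar_bar, bar_bar⟩ f

theorem η_apply (a b : Fin 4) : η a b = if b = bar a then 1 else 0 := by
  fin_cases a <;> fin_cases b <;> simp [η, bar]

theorem sum_η_mul (a : Fin 4) (f : Fin 4 → ℝ) : ∑ b, η a b * f b = f (bar a) := by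
  simp [η_apply]

section Matrices

variable {A : Type*} [CommRing A] [Algebra ℝ A] {n : Type*}

theorem map_derivation_mul [Fintype n] (D : Derivation ℝ A A) (X Y : Matrix n n A) :
    (X * Y).map D = X.map D * Y + X * Y.map D := by
  ext i j
  simp only [Matrix.map_apply, Matrix.mul_apply, Matrix.add_apply, map_sum, Derivation.leibniz,
    smul_eq_mul, ← Finset.sum_add_distrib]
  exact Finset.sum_congr rfl fun k _ => by ring

theorem map_derivation_smul (D : Derivation ℝ A A) (u : A) (X : Matrix n n A) :
    (u • X).map D = D u • X + u • X.map D := by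
  ext i j
  simp only [Matrix.map_apply, Matrix.smul_apply, Matrix.add_apply, Derivation.leibniz, smul_eq_mul]
  ring

theorem map_derivation_add (D : Derivation ℝ A A) (X Y : Matrix n n A) :
    (X + Y).map D = X.map D + Y.map D := by
  ext i j; simp

theorem map_derivation_sum {ι : Type*} (s : Finset ι) (D : Derivation ℝ A A) (X : ι → Matrix n n A) :
    (∑ i ∈ s, X i).map D = ∑ i ∈ s, (X i).map D := by
  ext i j; simp [Matrix.sum_apply]

end Matrices

/-- The Levi-Civita connection of a metric in a null frame, in algebraic form: `D a` is the
derivative along the `a`-th frame vector, and `Γ a b c = Γᵃ_b(e_c)`. -/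
structure FrameAlg (A : Type*) [CommRing A] [Algebra ℝ A] where
  D : Fin 4 → Derivation ℝ A A
  Γ : Fin 4 → Fin 4 → Fin 4 → A
  comm : ∀ c d u, D c (D d u) - D d (D c u) = ∑ b, (Γ b d c - Γ b c d) * D b u
  jacobi : ∀ a b c d,
    D b (Γ a d c - Γ a c d) + ∑ k, (Γ k d c - Γ k c d) * (Γ a k b - Γ a b k)
    + (D c (Γ a b d - Γ a d b) + ∑ k, (Γ k b d - Γ k d b) * (Γ a k c - Γ a c k))
    + (D d (Γ a c b - Γ a b c) + ∑ k, (Γ k c b - Γ k b c) * (Γ a k d - Γ a d k)) = 0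
  metric : ∀ a b c, Γ (bar a) b c + Γ (bar b) a c = 0

namespace FrameAlg

variable {A : Type*} [CommRing A] [Algebra ℝ A] (C : FrameAlg A)

/-- The coefficients of the Lie brackets of the frame vectors. -/
def str (a c d : Fin 4) : A := C.Γ a d c - C.Γ a c d

/-- The curvature components. -/
def R (a b c d : Fin 4) : A :=
  C.D c (C.Γ a b d) - C.D d (C.Γ a b c) - ∑ k, C.str k c d * C.Γ a b k
    + ∑ k, (C.Γ a k c * C.Γ k b d - C.Γ a k d * C.Γ k b c)

theorem R_swap (a b c d : Fin 4) : C.R a b c d = -C.R a b d c := by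
  simp only [R, str, Fin.sum_univ_four]
  ring

theorem first_bianchi (a b c d : Fin 4) : C.R a b c d + C.R a c d b + C.R a d b c = 0 := by
  have h := C.jacobi a b c d
  simp only [map_sub, Fin.sum_univ_four] at h
  simp only [R, str, Fin.sum_univ_four]
  linear_combination h

theorem Γ_bar (a b c : Fin 4) : C.Γ (bar a) b c = -C.Γ (bar b) a c :=
  eq_neg_of_add_eq_zero_left (C.metric a b c)

theorem R_bar (a b c d : Fin 4) : C.R (bar a) b c d = -C.R (bar b) a c d := by
  have h : ∀ c d, ∑ k, C.Γ (bar a) k c * C.Γ k b d = ∑ k, C.Γ (bar b) k d * C.Γ k a c := by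
    intro c d
    rw [← sum_bar (fun k => C.Γ (bar b) k d * C.Γ k a c)]
    refine Finset.sum_congr rfl fun k _ => ?_
    have h1 := C.Γ_bar a k c
    have h2 := C.Γ_bar (bar k) b d
    rw [bar_bar] at h2
    rw [h1, h2]; ring
  have e : ∀ k, C.Γ (bar a) b k = -C.Γ (bar b) a k := C.Γ_bar a b
  simp only [R, Finset.sum_sub_distrib, h, e, map_neg, mul_neg, Finset.sum_neg_distrib]
  ring

/-- The curvature with all indices lowered. -/
def Rl (a b c d : Fin 4) : A := C.R (bar a) b c d

theorem R_eq_Rl (a b c d : Fin 4) : C.R a b c d = C.Rl (bar a) b c d := by simp [Rl]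

theorem Rl_swap (a b c d : Fin 4) : C.Rl a b c d = -C.Rl a b d c := C.R_swap _ _ _ _

theorem Rl_swap' (a b c d : Fin 4) : C.Rl a b c d = -C.Rl b a c d := C.R_bar _ _ _ _

theorem Rl_cyc (a b c d : Fin 4) : C.Rl a b c d + C.Rl a c d b + C.Rl a d b c = 0 :=
  C.first_bianchi _ _ _ _

theorem Rl_pair (a b c d : Fin 4) : C.Rl a b c d = C.Rl c d a b := by
  have h : (2 : ℝ) • C.Rl a b c d = (2 : ℝ) • C.Rl c d a b := by
    simp only [two_smul]
    linear_combination C.Rl_cyc a b c d - C.Rl_cyc b c d a - C.Rl_cyc c d a b + C.Rl_cyc d a b c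
      + C.Rl_swap' b d a c + C.Rl_swap' b a c d + C.Rl_swap' c a b d - C.Rl_swap a c b d
      + C.Rl_swap' c b d a - C.Rl_swap' d a b c - C.Rl_swap d b c a - C.Rl_swap' d c a b
  have := congrArg ((1 / 2 : ℝ) • ·) h
  simpa [smul_smul] using this

/-- The connection matrix in the direction of the `c`-th frame vector. -/
def G (c : Fin 4) : Matrix (Fin 4) (Fin 4) A := Matrix.of fun a b => C.Γ a b c

/-- The curvature matrix. -/
def Rm (c d : Fin 4) : Matrix (Fin 4) (Fin 4) A := Matrix.of fun a b => C.R a b c d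

theorem Rm_eq (c d : Fin 4) : C.Rm c d = (C.G d).map (C.D c) - (C.G c).map (C.D d)
    - ∑ k, C.str k c d • C.G k + (C.G c * C.G d - C.G d * C.G c) := by
  ext a b
  simp [Rm, R, G, Matrix.sum_apply, Matrix.mul_apply, Finset.sum_sub_distrib]

theorem comm_matrix (c d : Fin 4) (X : Matrix (Fin 4) (Fin 4) A) :
    (X.map (C.D d)).map (C.D c) - (X.map (C.D c)).map (C.D d)
      = ∑ k, C.str k c d • X.map (C.D k) := by
  ext a b
  simp [Matrix.sum_apply, C.comm, str]

/-- `C'` is obtained from `C` by passing to the frame `e'_b = h^a_b e_a`, where `k` is the inverse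
matrix of `h`. -/
structure Change (C C' : FrameAlg A) (h k : Matrix (Fin 4) (Fin 4) A) : Prop where
  mul_inv : h * k = 1
  inv_mul : k * h = 1
  D_eq : ∀ b u, C'.D b u = ∑ a, h a b * C.D a u
  Γ_eq : ∀ a b c, C'.Γ a b c = ∑ i, k a i * (C'.D c (h i b) + ∑ m, ∑ j, h m c * C.Γ i j m * h j b)

variable {C} {C' : FrameAlg A} {h k : Matrix (Fin 4) (Fin 4) A}

theorem Change.G_eq (H : Change C C' h k) (c : Fin 4) :
    C'.G c = k * (h.map (C'.D c) + (∑ m, h m c • C.G m) * h) := by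
  ext a b
  simp [G, H.Γ_eq, Matrix.mul_apply, Matrix.sum_apply, Finset.sum_mul]

theorem Change.mul_G (H : Change C C' h k) (c : Fin 4) :
    h * C'.G c = h.map (C'.D c) + (∑ m, h m c • C.G m) * h := by
  rw [H.G_eq, ← mul_assoc, H.mul_inv, one_mul]

theorem Change.sum_str (H : Change C C' h k) (n c d : Fin 4) :
    ∑ l, C'.str l c d * h n l = C'.D c (h n d) - C'.D d (h n c)
      + ∑ m, ∑ l, h m c * h l d * C.str n m l := by
  have e : ∀ c d, ∑ l, h n l * C'.Γ l d c = C'.D c (h n d) + ∑ m, ∑ j, h m c * C.Γ n j m * h j d := by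
    intro c d
    have := congrFun (congrFun (H.mul_G c) n) d
    simpa [Matrix.mul_apply, G, Matrix.sum_apply, Finset.sum_mul] using this
  have e1 := e c d
  have e2 := e d c
  simp only [str, sub_mul, Finset.sum_sub_distrib, mul_sub]
  simp only [mul_comm (C'.Γ _ _ _) (h _ _), e1, e2]
  rw [Finset.sum_comm (f := fun m l => h m c * h l d * C.Γ n m l)]
  simp only [mul_right_comm (h _ _) (C.Γ _ _ _) (h _ _), mul_comm (h _ d) (h _ c)]
  ring

theorem Change.Rm_eq (H : Change C C' h k) (c d : Fin 4) :
    C'.Rm c d = k * (∑ m, ∑ n, (h m c * h n d) • C.Rm m n) * h := by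
  have key : h * C'.Rm c d = (∑ m, ∑ n, (h m c * h n d) • C.Rm m n) * h := by
    set P : Fin 4 → Matrix (Fin 4) (Fin 4) A := fun c => ∑ m, h m c • C.G m with hP
    have hG : ∀ c, h * C'.G c = h.map (C'.D c) + P c * h := H.mul_G
    have hDG : ∀ c d, h * (C'.G d).map (C'.D c) = (h.map (C'.D d)).map (C'.D c)
        + (P d).map (C'.D c) * h + P d * h.map (C'.D c) - h.map (C'.D c) * C'.G d := by
      intro c d
      have := congrArg (fun X : Matrix (Fin 4) (Fin 4) A => X.map (C'.D c)) (hG d)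
      simp only [map_derivation_mul, map_derivation_add] at this
      rw [eq_sub_iff_add_eq, add_comm, this]; abel
    have h1 : h * C'.Rm c d = ((P d).map (C'.D c) - (P c).map (C'.D d)
        - ∑ k, C'.str k c d • P k + (P c * P d - P d * P c)) * h := by
      rw [FrameAlg.Rm_eq, mul_add, mul_sub, mul_sub, mul_sub, hDG, hDG, ← mul_assoc, ← mul_assoc, hG,
        hG]
      have h2 : h * ∑ k, C'.str k c d • C'.G k
          = ∑ k, C'.str k c d • h.map (C'.D k) + (∑ k, C'.str k c d • P k) * h := by
        rw [Finset.mul_sum, Finset.sum_mul, ← Finset.sum_add_distrib]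
        refine Finset.sum_congr rfl fun k _ => ?_
        rw [mul_smul_comm, hG, smul_add, smul_mul_assoc]
      rw [h2, ← comm_matrix]
      have h3 : P c * h * C'.G d = P c * (h.map (C'.D d) + P d * h) := by rw [mul_assoc, hG]
      have h4 : P d * h * C'.G c = P d * (h.map (C'.D c) + P c * h) := by rw [mul_assoc, hG]
      simp only [add_mul, h3, h4]
      noncomm_ring
    rw [h1]
    congr 1
    have hDP : ∀ c d, (P d).map (C'.D c) = ∑ n, (C'.D c (h n d) • C.G n
        + ∑ m, (h m c * h n d) • (C.G n).map (C.D m)) := by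
      intro c d
      simp only [hP, map_derivation_sum, map_derivation_smul]
      refine Finset.sum_congr rfl fun n _ => congrArg _ ?_
      ext a b
      simp only [Matrix.smul_apply, Matrix.map_apply, H.D_eq, Matrix.sum_apply, smul_eq_mul,
        Finset.mul_sum]
      exact Finset.sum_congr rfl fun m _ => by ring
    have hS : ∑ k, C'.str k c d • P k = ∑ n, ((C'.D c (h n d) - C'.D d (h n c)) • C.G n
        + ∑ m, ∑ l, (h m c * h l d * C.str n m l) • C.G n) := by
      simp only [hP, Finset.smul_sum, smul_smul]
      rw [Finset.sum_comm]
      refine Finset.sum_congr rfl fun n _ => ?_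
      rw [← Finset.sum_smul, H.sum_str, add_smul, Finset.sum_smul]
      simp only [Finset.sum_smul]
    rw [hDP, hDP, hS]
    have hPP : P c * P d - P d * P c
        = ∑ m, ∑ n, (h m c * h n d) • (C.G m * C.G n - C.G n * C.G m) := by
      have : ∀ c d, P c * P d = ∑ m, ∑ n, (h m c * h n d) • (C.G m * C.G n) := by
        intro c d
        rw [hP, Finset.sum_mul]
        simp only [Finset.mul_sum, smul_mul_assoc, mul_smul_comm, smul_smul, mul_comm (h _ d) (h _ c)]
      rw [this, this, Finset.sum_comm (f := fun m n => (h m d * h n c) • (C.G m * C.G n))]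
      simp only [mul_comm (h _ d) (h _ c), smul_sub, Finset.sum_sub_distrib]
    rw [hPP]
    simp only [FrameAlg.Rm_eq, smul_add, smul_sub, Finset.smul_sum, smul_smul,
      Finset.sum_add_distrib, Finset.sum_sub_distrib, sub_smul]
    rw [Finset.sum_comm (f := fun n m => (h m c * h n d) • (C.G n).map (C.D m)),
      Finset.sum_comm (f := fun n m => ∑ l, (h m c * h l d * C.str n m l) • C.G n)]
    have e3 : ∑ m, ∑ n, ∑ l, (h m c * h l d * C.str n m l) • C.G n
        = ∑ m, ∑ n, ∑ l, (h m c * h n d * C.str l m n) • C.G l :=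
      Finset.sum_congr rfl fun m _ => Finset.sum_comm
    rw [e3]
    simp only [mul_comm (h _ d) (h _ c)]
    abel
  rw [mul_assoc, ← key, ← mul_assoc, H.inv_mul, one_mul]

theorem Change.R_eq (H : Change C C' h k) (a b c d : Fin 4) :
    C'.R a b c d = ∑ i, ∑ j, ∑ m, ∑ n, k a i * h j b * h m c * h n d * C.R i j m n := by
  have := congrFun (congrFun (H.Rm_eq c d) a) b
  simp only [Rm, Matrix.of_apply, Matrix.mul_apply, Matrix.sum_apply, Matrix.smul_apply,
    Finset.sum_mul, Finset.mul_sum, smul_eq_mul] at this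
  rw [this]
  refine ((Finset.sum_congr rfl fun j _ => (Finset.sum_congr rfl fun m _ =>
    Finset.sum_comm).trans Finset.sum_comm).trans Finset.sum_comm).trans ?_
  refine Finset.sum_congr rfl fun i _ => Finset.sum_congr rfl fun j _ => Finset.sum_congr rfl
    fun m _ => Finset.sum_congr rfl fun n _ => by ring

/-- Uniqueness of the Levi-Civita connection: a frame change whose connection satisfies the
structure equations is a `Change`. -/
theorem Change.of_torsion (hk : h * k = 1) (kh : k * h = 1)
    (hD : ∀ b u, C'.D b u = ∑ a, h a b * C.D a u) (hbar : ∀ a n, k (bar a) n = h (bar n) a)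
    (htor : ∀ n c d, ∑ l, h n l * C'.str l c d
      = (C'.D c (h n d) + ∑ m, ∑ j, h m c * C.Γ n j m * h j d)
        - (C'.D d (h n c) + ∑ m, ∑ j, h m d * C.Γ n j m * h j c)) :
    Change C C' h k := by
  refine ⟨hk, kh, hD, fun a b c => ?_⟩
  set W : Fin 4 → Fin 4 → Fin 4 → A :=
    fun n b c => C'.D c (h n b) + ∑ m, ∑ j, h m c * C.Γ n j m * h j b with hW
  set Δ : Fin 4 → Fin 4 → Fin 4 → A := fun a b c => C'.Γ (bar a) b c - ∑ n, k (bar a) n * W n b c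
    with hΔ
  have hkh : ∀ a b, ∑ n, k a n * h n b = if a = b then 1 else 0 := fun a b => by
    have := congrFun (congrFun kh a) b
    rwa [Matrix.mul_apply, Matrix.one_apply] at this
  have sym : ∀ a b c, Δ a b c = Δ a c b := by
    intro a b c
    have h1 : ∑ n, k (bar a) n * ∑ l, h n l * C'.str l c b = C'.str (bar a) c b := by
      simp only [Finset.mul_sum]
      rw [Finset.sum_comm]
      simp only [← mul_assoc, ← Finset.sum_mul, hkh]
      simp
    have h2 : C'.str (bar a) c b = ∑ n, k (bar a) n * (W n b c - W n c b) := by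
      rw [← h1]
      exact Finset.sum_congr rfl fun n _ => by rw [htor]
    simp only [str, mul_sub, Finset.sum_sub_distrib] at h2
    simp only [hΔ]
    linear_combination h2
  have alt : ∀ a b c, Δ a b c = -Δ b a c := by
    intro a b c
    have h1 := C'.metric a b c
    have h2 : ∑ n, k (bar a) n * C'.D c (h n b) + ∑ n, k (bar b) n * C'.D c (h n a) = 0 := by
      have := congrArg (C'.D c) (hkh (bar a) b)
      have h0 : C'.D c (if bar a = b then 1 else 0) = 0 := by split_ifs <;> simp
      rw [h0, map_sum] at this
      simp only [Derivation.leibniz, smul_eq_mul, Finset.sum_add_distrib] at this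
      rw [← this]
      congr 1
      rw [← sum_bar]
      refine Finset.sum_congr rfl fun n _ => ?_
      rw [hbar, hbar]; simp
    have h3 : ∑ n, k (bar a) n * ∑ m, ∑ j, h m c * C.Γ n j m * h j b
        + ∑ n, k (bar b) n * ∑ m, ∑ j, h m c * C.Γ n j m * h j a = 0 := by
      have e1 : ∑ n, k (bar b) n * ∑ m, ∑ j, h m c * C.Γ n j m * h j a
          = ∑ n, ∑ m, ∑ j, h j b * (h m c * C.Γ (bar j) (bar n) m * h (bar n) a) := by
        simp only [Finset.mul_sum, hbar]
        rw [Finset.sum_comm, ← Finset.sum_comm]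
        rw [← sum_bar]
        have : ∀ F : Fin 4 → Fin 4 → Fin 4 → A, ∑ n, ∑ m, ∑ j, F n m j
            = ∑ n, ∑ m, ∑ j, F j m (bar n) := by
          intro F
          rw [Finset.sum_comm]
          conv_rhs => rw [Finset.sum_comm]
          refine Finset.sum_congr rfl fun m _ => ?_
          rw [Finset.sum_comm, ← sum_bar]
        rw [this]
        simp only [bar_bar]
      rw [e1, ← Finset.sum_add_distrib]
      refine Finset.sum_eq_zero fun n _ => ?_
      rw [Finset.mul_sum, ← Finset.sum_add_distrib]
      refine Finset.sum_eq_zero fun m _ => ?_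
      rw [Finset.mul_sum, ← Finset.sum_add_distrib]
      refine Finset.sum_eq_zero fun j _ => ?_
      have := C.Γ_bar j (bar n) m
      rw [bar_bar] at this
      rw [hbar, this]; ring
    simp only [hΔ, hW, mul_add, Finset.sum_add_distrib]
    linear_combination h1 - h2 - h3
  have h2 : ∀ a b c, (2 : ℝ) • Δ a b c = 0 := by
    intro a b c
    rw [two_smul]
    linear_combination alt a b c - sym b a c - alt b c a + sym c b a + alt c a b - sym a c b
  have h4 := congrArg ((1 / 2 : ℝ) • ·) (h2 (bar a) b c)
  simp only [smul_smul, smul_zero] at h4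
  norm_num [hΔ, sub_eq_zero] at h4
  exact h4

end FrameAlg

end PKE

namespace PKE

variable {M : Type*} [TopologicalSpace M] [ChartedSpace E4 M]

/-- The ring of smooth functions on `V`. -/
def smoothRing (V : Set M) : Subalgebra ℝ (V → ℝ) where
  carrier := {f | ∃ F : M → ℝ, SmoothFun V F ∧ ∀ x : V, F x = f x}
  mul_mem' := by
    rintro _ _ ⟨F, hF, h⟩ ⟨F', hF', h'⟩
    exact ⟨_, hF.mul hF', fun x => by simp [h, h']⟩
  add_mem' := by
    rintro _ _ ⟨F, hF, h⟩ ⟨F', hF', h'⟩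
    exact ⟨_, hF.add hF', fun x => by simp [h, h']⟩
  algebraMap_mem' c := ⟨fun _ => c, SmoothFun.const c, fun _ => rfl⟩

namespace smoothRing

variable {V : Set M} {f f' : M → ℝ}

/-- The restriction of a smooth function. -/
def mk (f : M → ℝ) (hf : SmoothFun V f) : smoothRing V := ⟨fun x => f x, f, hf, fun _ => rfl⟩

/-- An extension of a smooth function on `V` to `M`. -/
def lift (u : smoothRing V) : M → ℝ := u.2.choose

theorem smooth_lift (u : smoothRing V) : SmoothFun V (lift u) := u.2.choose_spec.1

theorem lift_apply (u : smoothRing V) (x : V) : (lift u) x = u.1 x := u.2.choose_spec.2 x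

@[simp] theorem mk_apply (hf : SmoothFun V f) (x : V) : (mk f hf).1 x = f x := rfl

theorem mk_lift (u : smoothRing V) : mk (lift u) (smoothRing.smooth_lift u) = u :=
  Subtype.ext (funext fun x => (smoothRing.lift_apply u) x)

theorem eq_of {u v : smoothRing V} (h : ∀ x : V, u.1 x = v.1 x) : u = v :=
  Subtype.ext (funext h)

@[simp] theorem add_apply (u v : smoothRing V) (x : V) : (u + v).1 x = u.1 x + v.1 x := rfl
@[simp] theorem mul_apply (u v : smoothRing V) (x : V) : (u * v).1 x = u.1 x * v.1 x := rfl
@[simp] theorem sub_apply (u v : smoothRing V) (x : V) : (u - v).1 x = u.1 x - v.1 x := rfl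
@[simp] theorem neg_apply (u : smoothRing V) (x : V) : (-u).1 x = -u.1 x := rfl
@[simp] theorem zero_apply (x : V) : (0 : smoothRing V).1 x = 0 := rfl
@[simp] theorem one_apply (x : V) : (1 : smoothRing V).1 x = 1 := rfl
@[simp] theorem smul_apply (c : ℝ) (u : smoothRing V) (x : V) : (c • u).1 x = c * u.1 x := rfl
@[simp] theorem algebraMap_apply (c : ℝ) (x : V) : (algebraMap ℝ (smoothRing V) c).1 x = c := rfl

@[simp] theorem sum_apply {ι : Type*} (s : Finset ι) (u : ι → smoothRing V) (x : V) :
    (∑ i ∈ s, u i).1 x = ∑ i ∈ s, (u i).1 x := by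
  classical
  induction s using Finset.induction_on with
  | empty => simp
  | insert a s ha ih => simp [Finset.sum_insert ha, ih]

end smoothRing

theorem finrank_tangentSpace (x : M) : Module.finrank ℝ (TangentSpace (𝓡 4) x) = 4 :=
  finrank_euclideanSpace_fin (𝕜 := ℝ) (n := 4)

theorem linearIndependent_of_dual {E : Type*} [AddCommGroup E] [Module ℝ E] {θ : Fin 4 → Module.Dual ℝ E}
    {e : Fin 4 → E} (h : ∀ a b, θ a (e b) = if a = b then 1 else 0) : LinearIndependent ℝ e := by
  rw [Fintype.linearIndependent_iff]
  intro c hc i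
  have := congrArg (θ i) hc
  simpa [h] using this

theorem sum_dual_smul {x : M} {θ : Fin 4 → Module.Dual ℝ (TangentSpace (𝓡 4) x)}
    {e : Fin 4 → TangentSpace (𝓡 4) x} (h : ∀ a b, θ a (e b) = if a = b then 1 else 0)
    (v : TangentSpace (𝓡 4) x) : ∑ a, θ a v • e a = v := by
  let B := basisOfLinearIndependentOfCardEqFinrank (linearIndependent_of_dual h)
    (by rw [finrank_tangentSpace, Fintype.card_fin])
  have hB : ∀ a, B a = e a := fun a => by simp [B]
  have : ∀ a, θ a v = B.repr v a := by
    intro a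
    conv_lhs => rw [← B.sum_repr v]
    simp [hB, h]
  conv_rhs => rw [← B.sum_repr v]
  simp [hB, this]

variable [IsManifold (𝓡 4) ∞ M] {V : Set M}

/-- The derivative along a smooth vector field, on smooth functions. -/
def fieldDer (hV : IsOpen V) {X : VField M} (hX : SmoothVField V X) :
    Derivation ℝ (smoothRing V) (smoothRing V) :=
  Derivation.mk'
    { toFun := fun u => smoothRing.mk _ ((smoothRing.smooth_lift u).dirDeriv hV hX)
      map_add' := fun u v => smoothRing.eq_of fun x => by
        simp only [smoothRing.mk_apply, smoothRing.add_apply]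
        rw [← dirDeriv_add (smoothRing.smooth_lift u) (smoothRing.smooth_lift v) hV x.2]
        refine dirDeriv_congr hV x.2 (fun y hy => ?_) _
        rw [(smoothRing.lift_apply (u + v)) ⟨y, hy⟩, (smoothRing.lift_apply u) ⟨y, hy⟩,
          (smoothRing.lift_apply v) ⟨y, hy⟩]
        rfl
      map_smul' := fun c u => smoothRing.eq_of fun x => by
        simp only [smoothRing.mk_apply, smoothRing.smul_apply, RingHom.id_apply]
        have := dirDeriv_mul (SmoothFun.const c) (smoothRing.smooth_lift u) hV x.2 (X x)
        rw [dirDeriv_const, mul_zero, add_zero] at this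
        rw [← this]
        refine dirDeriv_congr hV x.2 (fun y hy => ?_) _
        rw [(smoothRing.lift_apply (c • u)) ⟨y, hy⟩, (smoothRing.lift_apply u) ⟨y, hy⟩]
        rfl }
    fun u v => smoothRing.eq_of fun x => by
      simp only [LinearMap.coe_mk, AddHom.coe_mk, smoothRing.mk_apply, smoothRing.add_apply,
        smul_eq_mul, smoothRing.mul_apply]
      rw [← (smoothRing.lift_apply u), ← (smoothRing.lift_apply v), ← dirDeriv_mul
        (smoothRing.smooth_lift u) (smoothRing.smooth_lift v) hV x.2]
      refine dirDeriv_congr hV x.2 (fun y hy => ?_) _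
      rw [(smoothRing.lift_apply (u * v)) ⟨y, hy⟩, (smoothRing.lift_apply u) ⟨y, hy⟩,
          (smoothRing.lift_apply v) ⟨y, hy⟩]
      rfl

theorem fieldDer_mk (hV : IsOpen V) {X : VField M} (hX : SmoothVField V X) {f : M → ℝ}
    (hf : SmoothFun V f) : fieldDer hV hX (smoothRing.mk f hf) = smoothRing.mk _ (hf.dirDeriv hV hX) :=
  smoothRing.eq_of fun x => dirDeriv_congr hV x.2
    (fun y hy => (smoothRing.lift_apply (smoothRing.mk f hf)) ⟨y, hy⟩) _

/-- Smoothness of a metric, as in `IsParaKaehlerEinstein`. -/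
def SmoothMetric (g : BilinField M) : Prop :=
  ∀ (V : Set M) (X Y : VField M), IsOpen V → SmoothVField V X → SmoothVField V Y →
    SmoothFun V (fun x => g x (X x) (Y x))

namespace IsNullFrameOn

variable {g : BilinField M} {F F' : MovingFrame M}

theorem mono (hF : IsNullFrameOn g V F) {W : Set M} (hW : IsOpen W) (hWV : W ⊆ V) :
    IsNullFrameOn g W F where
  isOpen := hW
  smooth a := (hF.smooth a).mono hWV
  dual x hx := hF.dual x (hWV hx)
  metric_eq x hx := hF.metric_eq x (hWV hx)
  torsion_free x hx := hF.torsion_free x (hWV hx)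
  metricity x hx := hF.metricity x (hWV hx)

theorem sum_coframe (hF : IsNullFrameOn g V F) {x : M} (hx : x ∈ V) (v : TangentSpace (𝓡 4) x) :
    ∑ a, F.coframe a x v • F.frame a x = v := sum_dual_smul (hF.dual x hx) v

theorem frame_ne_zero (hF : IsNullFrameOn g V F) {x : M} (hx : x ∈ V) (a : Fin 4) :
    F.frame a x ≠ 0 := (linearIndependent_of_dual (hF.dual x hx)).ne_zero a

theorem metric_apply (hF : IsNullFrameOn g V F) {x : M} (hx : x ∈ V) (v w : TangentSpace (𝓡 4) x) :
    g x v w = ∑ a, F.coframe a x v * F.coframe (bar a) x w := by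
  rw [hF.metric_eq x hx, MovingFrame.metric]
  simp [LinearMap.sum_apply, η_apply, LinearMap.BilinForm.linMulLin_apply]

theorem metric_frame_left (hF : IsNullFrameOn g V F) {x : M} (hx : x ∈ V) (a : Fin 4)
    (v : TangentSpace (𝓡 4) x) : g x (F.frame a x) v = F.coframe (bar a) x v := by
  rw [hF.metric_apply hx]
  simp [hF.dual x hx]

theorem metric_frame_right (hF : IsNullFrameOn g V F) {x : M} (hx : x ∈ V) (a : Fin 4)
    (v : TangentSpace (𝓡 4) x) : g x v (F.frame a x) = F.coframe (bar a) x v := by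
  rw [hF.metric_apply hx, ← sum_bar]
  simp [hF.dual x hx]

theorem coframe_eq (hF : IsNullFrameOn g V F) {x : M} (hx : x ∈ V) (a : Fin 4)
    (v : TangentSpace (𝓡 4) x) : F.coframe a x v = g x (F.frame (bar a) x) v := by
  rw [hF.metric_frame_left hx, bar_bar]

theorem smooth_coframe (hF : IsNullFrameOn g V F) (hg : SmoothMetric g) (a : Fin 4) {X : VField M}
    (hX : SmoothVField V X) : SmoothFun V (fun x => F.coframe a x (X x)) :=
  (hg V _ X hF.isOpen (hF.smooth (bar a)) hX).congr fun _ hx => hF.coframe_eq hx a _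

theorem conn_bar (hF : IsNullFrameOn g V F) {x : M} (hx : x ∈ V) (a b : Fin 4) :
    F.conn (bar a) b x + F.conn (bar b) a x = 0 := by
  have := hF.metricity x hx a b
  simpa [η_apply, Finset.sum_add_distrib] using this

theorem torsion (hF : IsNullFrameOn g V F) {x : M} (hx : x ∈ V) (a c d : Fin 4) :
    F.coframe a x (bracket (F.frame c) (F.frame d) x)
      = F.conn a d x (F.frame c x) - F.conn a c x (F.frame d x) := by
  have h := hF.torsion_free x hx a c d
  have e : ∀ b, ∀ v, dirDeriv (fun y => F.coframe a y (F.frame b y)) x v = 0 := fun b v =>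
    dirDeriv_eq_zero hF.isOpen hx (fun y hy => hF.dual y hy a b) v
  simp only [dOne, e, wedge, hF.dual x hx, Finset.sum_sub_distrib] at h
  simp at h
  linarith

/-- The Koszul formula in a null frame. -/
theorem koszul (hF : IsNullFrameOn g V F) {x : M} (hx : x ∈ V) (a b c : Fin 4) :
    F.conn a b x (F.frame c x) = (F.coframe a x (bracket (F.frame c) (F.frame b) x)
      - F.coframe (bar b) x (bracket (F.frame c) (F.frame (bar a)) x)
      + F.coframe (bar c) x (bracket (F.frame (bar a)) (F.frame b) x)) / 2 := by
  rw [hF.torsion hx, hF.torsion hx, hF.torsion hx]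
  have h : ∀ p q r, F.conn p q x (F.frame r x) = -F.conn (bar q) (bar p) x (F.frame r x) := by
    intro p q r
    have := congrArg (fun L : Module.Dual ℝ (TangentSpace (𝓡 4) x) => L (F.frame r x))
      (hF.conn_bar hx (bar p) q)
    simp only [LinearMap.add_apply, LinearMap.zero_apply, bar_bar] at this
    linarith
  have h1 := h (bar b) (bar a) c
  have h2 := h (bar b) c (bar a)
  have h3 := h a c b
  simp only [bar_bar] at h1 h2
  rw [h1, h2, h3]
  ring

theorem smooth_conn (hF : IsNullFrameOn g V F) (hg : SmoothMetric g) (a b c : Fin 4) :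
    SmoothFun V (fun x => F.conn a b x (F.frame c x)) := by
  have h : ∀ a b c, SmoothFun V (fun x => F.coframe a x (bracket (F.frame b) (F.frame c) x)) :=
    fun a b c => hF.smooth_coframe hg a ((hF.smooth b).bracket hF.isOpen (hF.smooth c))
  refine ((((h a c b).sub (h (bar b) c (bar a))).add (h (bar c) (bar a) b)).mul
    (SmoothFun.const (1 / 2))).congr fun x hx => ?_
  rw [hF.koszul hx]; ring

theorem conn_apply (hF : IsNullFrameOn g V F) {x : M} (hx : x ∈ V) (a b : Fin 4)
    (v : TangentSpace (𝓡 4) x) :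
    F.conn a b x v = ∑ c, F.coframe c x v * F.conn a b x (F.frame c x) := by
  conv_lhs => rw [← hF.sum_coframe hx v]
  simp

theorem conn_eq_sum (hF : IsNullFrameOn g V F) {x : M} (hx : x ∈ V) (a b : Fin 4) :
    F.conn a b x = ∑ c, F.conn a b x (F.frame c x) • F.coframe c x := by
  ext v
  rw [hF.conn_apply hx]
  simp [mul_comm]

theorem bracket_eq_sum (hF : IsNullFrameOn g V F) {x : M} (hx : x ∈ V) (X Y : VField M) :
    bracket X Y x = ∑ a, F.coframe a x (bracket X Y x) • F.frame a x := (hF.sum_coframe hx _).symm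

/-- The first structure equation, on arbitrary smooth vector fields. -/
theorem dOne_coframe (hF : IsNullFrameOn g V F) (hg : SmoothMetric g) {x : M} (hx : x ∈ V)
    (n : Fin 4) {X Y : VField M} (hX : SmoothVField V X) (hY : SmoothVField V Y) :
    dOne (F.coframe n) X Y x = -∑ b, wedge (F.conn n b) (F.coframe b) X Y x := by
  have hV := hF.isOpen
  have half : ∀ {X Y : VField M}, SmoothVField V X → SmoothVField V Y → bracket X Y x
      = ∑ l, (dirDeriv (fun y => F.coframe l y (Y y)) x (X x) • F.frame l x
        + F.coframe l x (Y x) • bracket X (F.frame l) x) := by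
    intro X Y hX hY
    rw [bracket_congr hV hx (fun _ _ => rfl) (fun y hy => (hF.sum_coframe hy (Y y)).symm),
      bracket_sum_right _ _ hV hx fun l _ => SmoothVField.smul (hF.smooth_coframe hg l hY)
        (hF.smooth l)]
    exact Finset.sum_congr rfl fun l _ => bracket_smul_right _ hV hx (hF.smooth_coframe hg l hY)
      (hF.smooth l)
  have hd : ∀ l, F.coframe n x (bracket X (F.frame l) x)
      = -dirDeriv (fun y => F.coframe n y (X y)) x (F.frame l x)
        - ∑ m, F.coframe m x (X x) * (F.conn n m x (F.frame l x) - F.conn n l x (F.frame m x)) := by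
    intro l
    rw [bracket_swap, half (hF.smooth l) hX]
    simp [hF.dual x hx, hF.torsion hx, Finset.sum_add_distrib]
    ring
  have hXY : F.coframe n x (bracket X Y x) = dirDeriv (fun y => F.coframe n y (Y y)) x (X x)
      + ∑ l, F.coframe l x (Y x) * F.coframe n x (bracket X (F.frame l) x) := by
    rw [half hX hY]
    simp [hF.dual x hx, Finset.sum_add_distrib]
  have hYn : dirDeriv (fun y => F.coframe n y (X y)) x (Y x)
      = ∑ l, F.coframe l x (Y x) * dirDeriv (fun y => F.coframe n y (X y)) x (F.frame l x) := by
    conv_lhs => rw [← hF.sum_coframe hx (Y x)]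
    rw [dirDeriv_sum_right]
    simp only [dirDeriv_smul_right]
  simp only [dOne, wedge, hXY, hYn, hd]
  have e1 : ∑ l, F.coframe l x (Y x) * ∑ m, F.coframe m x (X x) * F.conn n m x (F.frame l x)
      = ∑ b, F.conn n b x (Y x) * F.coframe b x (X x) := by
    simp only [hF.conn_apply hx n _ (Y x), Finset.sum_mul, Finset.mul_sum]
    rw [Finset.sum_comm]
    exact Finset.sum_congr rfl fun _ _ => Finset.sum_congr rfl fun _ _ => by ring
  have e2 : ∑ l, F.coframe l x (Y x) * ∑ m, F.coframe m x (X x) * F.conn n l x (F.frame m x)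
      = ∑ b, F.conn n b x (X x) * F.coframe b x (Y x) := by
    simp only [hF.conn_apply hx n _ (X x), Finset.sum_mul, Finset.mul_sum]
    exact Finset.sum_congr rfl fun _ _ => Finset.sum_congr rfl fun _ _ => by ring
  simp only [mul_sub, Finset.sum_sub_distrib, mul_neg, Finset.sum_neg_distrib, e1, e2]
  ring

/-- The algebraic form of a null frame. -/
def alg (hF : IsNullFrameOn g V F) (hg : SmoothMetric g) : FrameAlg (smoothRing V) where
  D a := fieldDer hF.isOpen (hF.smooth a)
  Γ a b c := smoothRing.mk _ (hF.smooth_conn hg a b c)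
  comm c d u := by
    obtain ⟨f, hf, rfl⟩ : ∃ f hf, smoothRing.mk f hf = u := ⟨_, _, (smoothRing.mk_lift u)⟩
    refine smoothRing.eq_of fun x => ?_
    simp only [fieldDer_mk, smoothRing.sub_apply, smoothRing.sum_apply, smoothRing.mul_apply,
      smoothRing.mk_apply]
    rw [← dirDeriv_bracket hF.isOpen x.2 (hF.smooth c) (hF.smooth d) (hF.smooth 0)
      (hF.frame_ne_zero x.2 0) hf, hF.bracket_eq_sum x.2, dirDeriv_sum_right]
    simp only [dirDeriv_smul_right, hF.torsion x.2]
  jacobi a b c d := by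
    refine smoothRing.eq_of fun x => ?_
    have hs : ∀ k c d, SmoothFun V
        (fun y => F.coframe k y (bracket (F.frame c) (F.frame d) y)) := fun k c d =>
      hF.smooth_coframe hg k ((hF.smooth c).bracket hF.isOpen (hF.smooth d))
    have h : ∀ b c d, F.coframe a x (bracket (F.frame b) (bracket (F.frame c) (F.frame d)) x)
        = (fieldDer hF.isOpen (hF.smooth b) (smoothRing.mk _ (hF.smooth_conn hg a d c)
            - smoothRing.mk _ (hF.smooth_conn hg a c d))
          + ∑ k, (smoothRing.mk _ (hF.smooth_conn hg k d c)
            - smoothRing.mk _ (hF.smooth_conn hg k c d)) *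
            (smoothRing.mk _ (hF.smooth_conn hg a k b)
            - smoothRing.mk _ (hF.smooth_conn hg a b k))).1 x := by
      intro b c d
      have e1 : smoothRing.mk _ (hF.smooth_conn hg a d c)
            - smoothRing.mk _ (hF.smooth_conn hg a c d) = smoothRing.mk _ (hs a c d) :=
        smoothRing.eq_of fun y => (hF.torsion y.2 a c d).symm
      rw [e1, fieldDer_mk, bracket_congr hF.isOpen x.2 (fun _ _ => rfl)
        (fun y hy => hF.bracket_eq_sum hy _ _), bracket_sum_right _ _ hF.isOpen x.2
        fun k _ => SmoothVField.smul (hs k c d) (hF.smooth k), map_sum]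
      have e2 : ∀ k, F.coframe a x (bracket (F.frame b) (fun y => F.coframe k y
          (bracket (F.frame c) (F.frame d) y) • F.frame k y) x)
          = (if a = k then dirDeriv (fun y => F.coframe k y
          (bracket (F.frame c) (F.frame d) y)) x (F.frame b x) else 0)
          + F.coframe k x (bracket (F.frame c) (F.frame d) x)
            * F.coframe a x (bracket (F.frame b) (F.frame k) x) := by
        intro k
        rw [bracket_smul_right _ hF.isOpen x.2 (hs k c d) (hF.smooth k)]
        simp [hF.dual x x.2]
      simp only [e2, Finset.sum_add_distrib]
      simp [hF.torsion x.2]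
    have hj := congrArg (F.coframe a x) (PKE.jacobi hF.isOpen x.2 (hF.smooth b) (hF.smooth c)
      (hF.smooth d))
    have hc : bracket (F.frame c) (bracket (F.frame b) (F.frame d)) x
        = -bracket (F.frame c) (bracket (F.frame d) (F.frame b)) x := by
      have := bracket_smul_right (F.frame c) hF.isOpen x.2 (SmoothFun.const (-1))
        ((hF.smooth d).bracket hF.isOpen (hF.smooth b))
      rw [dirDeriv_const] at this
      rw [bracket_congr hF.isOpen x.2 (fun _ _ => rfl) (fun y hy => ?_), this]
      · module
      · rw [bracket_swap]; module
    rw [map_add, bracket_swap _ (F.frame d), hc, map_neg, map_neg] at hj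
    rw [h, h, h] at hj
    simp only [smoothRing.add_apply, smoothRing.zero_apply] at hj ⊢
    linarith
  metric a b c := smoothRing.eq_of fun x => by
    have := congrArg (fun L : Module.Dual ℝ (TangentSpace (𝓡 4) x.1) => L (F.frame c x))
      (hF.conn_bar x.2 a b)
    simpa using this

variable (hF : IsNullFrameOn g V F) (hg : SmoothMetric g)

theorem alg_D (a : Fin 4) : (hF.alg hg).D a = fieldDer hF.isOpen (hF.smooth a) := rfl

theorem alg_D_apply (a : Fin 4) {u : smoothRing V} {f : M → ℝ} (hf : SmoothFun V f)
    (h : ∀ y : V, u.1 y = f y) (x : V) :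
    ((hF.alg hg).D a u).1 x = dirDeriv f x (F.frame a x) := by
  obtain rfl : u = smoothRing.mk f hf := smoothRing.eq_of h
  rw [alg_D, fieldDer_mk]; rfl

@[simp] theorem alg_Γ_apply (a b c : Fin 4) (x : V) :
    ((hF.alg hg).Γ a b c).1 x = F.conn a b x (F.frame c x) := rfl

theorem riemann_eq (a b c d : Fin 4) (x : V) : F.riemann a b c d x = ((hF.alg hg).R a b c d).1 x := by
  have h1 : ((hF.alg hg).D c ((hF.alg hg).Γ a b d)).1 x
      = dirDeriv (fun y => F.conn a b y (F.frame d y)) x (F.frame c x) :=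
    hF.alg_D_apply hg c (hF.smooth_conn hg a b d) (fun _ => rfl) x
  have h2 : ((hF.alg hg).D d ((hF.alg hg).Γ a b c)).1 x
      = dirDeriv (fun y => F.conn a b y (F.frame c y)) x (F.frame d x) :=
    hF.alg_D_apply hg d (hF.smooth_conn hg a b c) (fun _ => rfl) x
  simp only [MovingFrame.riemann, FrameAlg.R, dOne, wedge, smoothRing.add_apply,
    smoothRing.sub_apply, smoothRing.sum_apply, smoothRing.mul_apply, h1, h2, alg_Γ_apply,
    FrameAlg.str]
  rw [hF.bracket_eq_sum x.2, map_sum]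
  simp only [map_smul, smul_eq_mul, hF.torsion x.2]

end IsNullFrameOn

/-- The matrix of the frame of `F'` in the frame of `F`. -/
def transition {g : BilinField M} {F F' : MovingFrame M} (hF : IsNullFrameOn g V F)
    (hF' : IsNullFrameOn g V F') (hg : SmoothMetric g) : Matrix (Fin 4) (Fin 4) (smoothRing V) :=
  Matrix.of fun a b => smoothRing.mk _ (hF.smooth_coframe hg a (hF'.smooth b))

variable {g : BilinField M} {F F' : MovingFrame M} (hF : IsNullFrameOn g V F)
    (hF' : IsNullFrameOn g V F') (hg : SmoothMetric g)

@[simp] theorem transition_apply (a b : Fin 4) (x : V) :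
    (transition hF hF' hg a b).1 x = F.coframe a x (F'.frame b x) := rfl

theorem frame_eq_sum (hF : IsNullFrameOn g V F) {x : M} (hx : x ∈ V) (b : Fin 4) :
    F'.frame b x = ∑ a, F.coframe a x (F'.frame b x) • F.frame a x := (hF.sum_coframe hx _).symm

theorem transition_mul : transition hF hF' hg * transition hF' hF hg = 1 := by
  ext1 a b
  refine smoothRing.eq_of fun x => ?_
  rw [Matrix.mul_apply, smoothRing.sum_apply, Matrix.one_apply]
  simp only [smoothRing.mul_apply, transition_apply]
  have := congrArg (F.coframe a x) (frame_eq_sum (F := F') (F' := F) hF' x.2 b)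
  rw [hF.dual x x.2] at this
  simp only [map_sum, map_smul, smul_eq_mul] at this
  simp only [mul_comm (F.coframe _ _ _)]
  rw [← this]
  split_ifs <;> simp

theorem transition_bar (a n : Fin 4) :
    transition hF' hF hg (bar a) n = transition hF hF' hg (bar n) a :=
  smoothRing.eq_of fun x => by
    rw [transition_apply, transition_apply, ← hF'.metric_frame_left x.2, ← hF.metric_frame_right x.2]

theorem change_transition :
    FrameAlg.Change (hF.alg hg) (hF'.alg hg) (transition hF hF' hg) (transition hF' hF hg) := by
  have hD : ∀ b u, (hF'.alg hg).D b u
      = ∑ a, transition hF hF' hg a b * (hF.alg hg).D a u := by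
    intro b u
    obtain ⟨f, hf, rfl⟩ : ∃ f hf, smoothRing.mk f hf = u := ⟨_, _, (smoothRing.mk_lift u)⟩
    refine smoothRing.eq_of fun x => ?_
    simp only [IsNullFrameOn.alg_D, fieldDer_mk, smoothRing.sum_apply, smoothRing.mul_apply,
      smoothRing.mk_apply, transition_apply]
    rw [frame_eq_sum hF x.2 b, dirDeriv_sum_right]
    simp only [dirDeriv_smul_right]
    rw [← frame_eq_sum hF x.2 b]
  refine FrameAlg.Change.of_torsion (transition_mul ..) (transition_mul ..) hD
    (transition_bar hF hF' hg) fun n c d => smoothRing.eq_of fun x => ?_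
  have h := hF.dOne_coframe hg x.2 n (hF'.smooth c) (hF'.smooth d)
  have hDa : ∀ c d, ((hF'.alg hg).D c (transition hF hF' hg n d)).1 x
      = dirDeriv (fun y => F.coframe n y (F'.frame d y)) x (F'.frame c x) := fun c d =>
    hF'.alg_D_apply hg c (hF.smooth_coframe hg n (hF'.smooth d)) (fun _ => rfl) x
  have hb : F.coframe n x (bracket (F'.frame c) (F'.frame d) x)
      = ∑ l, F.coframe n x (F'.frame l x) * ((hF'.alg hg).str l c d).1 x := by
    rw [hF'.bracket_eq_sum x.2, map_sum]
    simp only [map_smul, smul_eq_mul, hF'.torsion x.2, FrameAlg.str, smoothRing.sub_apply,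
      IsNullFrameOn.alg_Γ_apply]
    exact Finset.sum_congr rfl fun l _ => mul_comm _ _
  have hw : ∀ c d, ∑ b, F.conn n b x (F'.frame c x) * F.coframe b x (F'.frame d x)
      = ∑ m, ∑ j, F.coframe m x (F'.frame c x) * F.conn n j x (F.frame m x)
        * F.coframe j x (F'.frame d x) := by
    intro c d
    simp only [hF.conn_apply x.2 n _ (F'.frame c x), Finset.sum_mul]
    rw [Finset.sum_comm]
  simp only [smoothRing.sum_apply, smoothRing.mul_apply, transition_apply, smoothRing.add_apply,
    smoothRing.sub_apply, hDa, ← hb, IsNullFrameOn.alg_Γ_apply, ← hw]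
  simp only [dOne, wedge, Finset.sum_sub_distrib] at h
  linarith

end PKE

namespace PKE
namespace FrameAlg

variable {A : Type*} [CommRing A] [Algebra ℝ A] (C : FrameAlg A)

/-- The exterior derivative of a one-form. -/
def dForm (w : Fin 4 → A) (c d : Fin 4) : A :=
  C.D c (w d) - C.D d (w c) - ∑ k, C.str k c d * w k

theorem dForm_closed (w : Fin 4 → A) (c d e : Fin 4) :
    (C.D c (C.dForm w d e) - ∑ k, C.str k c d * C.dForm w k e)
      + (C.D d (C.dForm w e c) - ∑ k, C.str k d e * C.dForm w k c)
      + (C.D e (C.dForm w c d) - ∑ k, C.str k e c * C.dForm w k d) = 0 := by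
  have h1 := C.comm c d (w e)
  have h2 := C.comm d e (w c)
  have h3 := C.comm e c (w d)
  have j := fun k => C.jacobi k c d e
  have anti : ∀ k c d, C.str k d c = -C.str k c d := fun k c d => by simp [str]
  change ∀ k, C.D c (C.str k d e) + ∑ l, C.str l d e * C.str k c l
    + (C.D d (C.str k e c) + ∑ l, C.str l e c * C.str k d l)
    + (C.D e (C.str k c d) + ∑ l, C.str l c d * C.str k e l) = 0 at j
  change _ = ∑ b, C.str b c d * _ at h1
  change _ = ∑ b, C.str b d e * _ at h2
  change _ = ∑ b, C.str b e c * _ at h3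
  have key : ∑ k, (C.D c (C.str k d e) + ∑ l, C.str l d e * C.str k c l
    + (C.D d (C.str k e c) + ∑ l, C.str l e c * C.str k d l)
    + (C.D e (C.str k c d) + ∑ l, C.str l c d * C.str k e l)) * w k = 0 := by
    simp [j]
  simp only [add_mul, Finset.sum_add_distrib, Finset.sum_mul] at key
  rw [Finset.sum_comm (f := fun k l => C.str l d e * C.str k c l * w k),
    Finset.sum_comm (f := fun k l => C.str l e c * C.str k d l * w k),
    Finset.sum_comm (f := fun k l => C.str l c d * C.str k e l * w k)] at key
  have hk : ∀ (f : Fin 4 → A) e, ∑ k, f k * C.dForm w k e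
      = ∑ k, f k * C.D k (w e) - ∑ k, f k * C.D e (w k) + ∑ k, ∑ l, f k * C.str l e k * w l := by
    intro f e
    simp only [dForm, anti _ e, mul_sub, neg_mul, Finset.sum_neg_distrib, Finset.sum_sub_distrib,
      Finset.mul_sum, mul_neg, mul_assoc]
    ring
  rw [hk, hk, hk]
  simp only [dForm, map_sub, map_sum, Derivation.leibniz, smul_eq_mul,
    Finset.sum_add_distrib]
  simp only [mul_comm (w _)]
  linear_combination h1 + h2 + h3 - key

theorem second_bianchi (a b c d e : Fin 4) :
    (C.D c (C.R a b d e) - ∑ k, C.str k c d * C.R a b k e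
        + ∑ k, (C.Γ a k c * C.R k b d e - C.R a k d e * C.Γ k b c))
      + (C.D d (C.R a b e c) - ∑ k, C.str k d e * C.R a b k c
        + ∑ k, (C.Γ a k d * C.R k b e c - C.R a k e c * C.Γ k b d))
      + (C.D e (C.R a b c d) - ∑ k, C.str k e c * C.R a b k d
        + ∑ k, (C.Γ a k e * C.R k b c d - C.R a k c d * C.Γ k b e)) = 0 := by
  have main : ((C.Rm d e).map (C.D c) - ∑ k, C.str k c d • C.Rm k e
        + (C.G c * C.Rm d e - C.Rm d e * C.G c))
      + ((C.Rm e c).map (C.D d) - ∑ k, C.str k d e • C.Rm k c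
        + (C.G d * C.Rm e c - C.Rm e c * C.G d))
      + ((C.Rm c d).map (C.D e) - ∑ k, C.str k e c • C.Rm k d
        + (C.G e * C.Rm c d - C.Rm c d * C.G e)) = 0 := by
    set W : Fin 4 → Fin 4 → Matrix (Fin 4) (Fin 4) A := fun c d =>
      (C.G d).map (C.D c) - (C.G c).map (C.D d) - ∑ k, C.str k c d • C.G k with hW
    have hR : ∀ c d, C.Rm c d = W c d + (C.G c * C.G d - C.G d * C.G c) := C.Rm_eq
    have closed : ((W d e).map (C.D c) - ∑ k, C.str k c d • W k e)
        + ((W e c).map (C.D d) - ∑ k, C.str k d e • W k c)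
        + ((W c d).map (C.D e) - ∑ k, C.str k e c • W k d) = 0 := by
      ext a b
      have := C.dForm_closed (fun k => C.Γ a b k) c d e
      simpa [hW, Matrix.sum_apply, dForm, G] using this
    have hsub : ∀ (D : Derivation ℝ A A) (X Y : Matrix (Fin 4) (Fin 4) A),
        (X - Y).map D = X.map D - Y.map D := fun D X Y => by ext i j; simp
    have hS : ∀ c d e, ∑ k, C.str k c d • C.Rm k e = ∑ k, C.str k c d • W k e
        + ((∑ k, C.str k c d • C.G k) * C.G e - C.G e * ∑ k, C.str k c d • C.G k) := by
      intro c d e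
      simp only [hR, smul_add, smul_sub, Finset.sum_add_distrib, Finset.sum_sub_distrib,
        Finset.sum_mul, Finset.mul_sum, smul_mul_assoc, mul_smul_comm]
    rw [hS, hS, hS, ← sub_eq_zero.2 closed]
    simp only [hR, map_derivation_add, hsub, map_derivation_mul]
    simp only [show ∀ c d, W c d = (C.G d).map (C.D c) - (C.G c).map (C.D d)
      - ∑ k, C.str k c d • C.G k from fun _ _ => rfl, mul_add, add_mul, mul_sub, sub_mul, mul_assoc]
    abel
  have := congrFun (congrFun main a) b
  simpa [Rm, Matrix.sum_apply, Matrix.mul_apply, G, Finset.sum_sub_distrib] using this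

end FrameAlg
end PKE

namespace PKE
namespace FrameAlg

variable {A : Type*} [CommRing A] [Algebra ℝ A] {C : FrameAlg A}

theorem eq_zero_of_smul {r : ℝ} (hr : r ≠ 0) {u : A} (h : algebraMap ℝ A r * u = 0) : u = 0 := by
  have := congrArg (algebraMap ℝ A r⁻¹ * ·) h
  simpa [← mul_assoc, ← map_mul, hr] using this

theorem eq_zero_of_ofNat_mul (n : ℕ) [n.AtLeastTwo] {u : A} (h : (OfNat.ofNat n : A) * u = 0) :
    u = 0 :=
  eq_zero_of_smul (r := OfNat.ofNat n) (by simp) (by rwa [map_ofNat])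

/-- The Ricci tensor. -/
def Ric (C : FrameAlg A) (a b : Fin 4) : A := ∑ c, C.R c a c b

theorem Γ02 (C : FrameAlg A) (c : Fin 4) : C.Γ 0 2 c = 0 :=
  eq_zero_of_ofNat_mul 2
    (by have := C.metric 2 2 c; simp only [bar_two] at this; linear_combination this)
theorem Γ13 (C : FrameAlg A) (c : Fin 4) : C.Γ 1 3 c = 0 :=
  eq_zero_of_ofNat_mul 2
    (by have := C.metric 3 3 c; simp only [bar_three] at this; linear_combination this)
theorem Γ20 (C : FrameAlg A) (c : Fin 4) : C.Γ 2 0 c = 0 :=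
  eq_zero_of_ofNat_mul 2
    (by have := C.metric 0 0 c; simp only [bar_zero] at this; linear_combination this)
theorem Γ31 (C : FrameAlg A) (c : Fin 4) : C.Γ 3 1 c = 0 :=
  eq_zero_of_ofNat_mul 2
    (by have := C.metric 1 1 c; simp only [bar_one] at this; linear_combination this)
theorem Γ22 (C : FrameAlg A) (c : Fin 4) : C.Γ 2 2 c = -C.Γ 0 0 c := C.Γ_bar 0 2 c
theorem Γ23 (C : FrameAlg A) (c : Fin 4) : C.Γ 2 3 c = -C.Γ 1 0 c := C.Γ_bar 0 3 c
theorem Γ32 (C : FrameAlg A) (c : Fin 4) : C.Γ 3 2 c = -C.Γ 0 1 c := C.Γ_bar 1 2 c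
theorem Γ33 (C : FrameAlg A) (c : Fin 4) : C.Γ 3 3 c = -C.Γ 1 1 c := C.Γ_bar 1 3 c
theorem Rl_self (C : FrameAlg A) (a c d : Fin 4) : C.Rl a a c d = 0 :=
  eq_zero_of_ofNat_mul 2 (by linear_combination C.Rl_swap' a a c d)
theorem Rl_self' (C : FrameAlg A) (a c d : Fin 4) : C.Rl c d a a = 0 :=
  eq_zero_of_ofNat_mul 2 (by linear_combination C.Rl_swap c d a a)

theorem R_self (C : FrameAlg A) (a b c : Fin 4) : C.R a b c c = 0 := by
  rw [C.R_eq_Rl, C.Rl_self']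

/-- The connection preserves the splitting of the tangent bundle into the spans of `e₁, e₂` and
`e₃, e₄`. -/
structure Block (C : FrameAlg A) : Prop where
  Γ03 : ∀ c, C.Γ 0 3 c = 0
  Γ30 : ∀ c, C.Γ 3 0 c = 0

namespace Block

theorem Γ12 (B : Block C) (c : Fin 4) : C.Γ 1 2 c = 0 := by
  have := C.metric 3 2 c; simp only [bar_three, bar_two, B.Γ03] at this; linear_combination this
theorem Γ21 (B : Block C) (c : Fin 4) : C.Γ 2 1 c = 0 := by
  have := C.metric 0 1 c; simp only [bar_one, bar_zero, B.Γ30] at this; linear_combination this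

theorem Rl01 (B : Block C) (c d : Fin 4) : C.Rl 0 1 c d = 0 := by
  simp [Rl, R, Fin.sum_univ_four, B.Γ21, C.Γ31, C.Γ20]
theorem Rl23 (B : Block C) (c d : Fin 4) : C.Rl 2 3 c d = 0 := by
  simp [Rl, R, Fin.sum_univ_four, B.Γ03, C.Γ13, C.Γ02]
theorem Rl10 (B : Block C) (c d : Fin 4) : C.Rl 1 0 c d = 0 := by rw [Rl_swap', B.Rl01, neg_zero]
theorem Rl_01 (B : Block C) (c d : Fin 4) : C.Rl c d 0 1 = 0 := by rw [Rl_pair, B.Rl01]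
theorem Rl_23 (B : Block C) (c d : Fin 4) : C.Rl c d 2 3 = 0 := by rw [Rl_pair, B.Rl23]

end Block

/-- Para-Kähler and Einstein; `12 * κ` is the scalar curvature. -/
structure IsKE (C : FrameAlg A) (κ : A) : Prop extends Block C where
  einstein : ∀ a b, C.Ric a b = if b = bar a then 3 * κ else 0

/-- The relations between the curvature components of a para-Kähler-Einstein metric. -/
theorem IsKE.components {κ : A} (H : IsKE C κ) :
    C.Rl 0 2 0 2 = -C.Rl 0 3 1 2 - 3 * κ ∧ C.Rl 1 3 1 3 = -C.Rl 0 3 1 2 - 3 * κ ∧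
    C.Rl 0 2 1 3 = C.Rl 0 3 1 2 ∧ C.Rl 0 2 0 3 = -C.Rl 1 3 0 3 ∧ C.Rl 1 3 1 2 = -C.Rl 0 2 1 2 := by
  have h := C.Rl_cyc 0 2 1 3
  have h02 := H.einstein 0 2
  have h13 := H.einstein 1 3
  have h03 := H.einstein 0 3
  have h12 := H.einstein 1 2
  simp only [Ric, Fin.sum_univ_four, C.R_eq_Rl, Rl_self, Rl_self', H.Rl10, H.Rl01, bar_zero,
    bar_one, bar_two, bar_three, if_true, Fin.reduceEq, if_false] at h h02 h13 h03 h12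
  rw [C.Rl_swap 0 3 2 1] at h
  rw [C.Rl_swap' 2 0, C.Rl_swap' 3 0] at h02 h03
  rw [C.Rl_swap' 2 1, C.Rl_swap' 3 1] at h13 h12
  have p1 := C.Rl_pair 1 2 0 3
  have p2 := C.Rl_pair 0 3 1 3
  have p3 := C.Rl_pair 1 2 0 2
  have p4 := C.Rl_pair 1 3 1 2
  refine ⟨?_, ?_, ?_, ?_, ?_⟩
  · linear_combination -h02
  · linear_combination -h13 - p1
  · linear_combination h
  · linear_combination -h03 - p2
  · linear_combination -h12 - p3

/-- The curvature `Ωᵃ_b` when `Ψ₀ = Ψ₁ = Ψ₂ = Ψ₃ = 0` and `Ψ₄ = ψ`. -/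
structure IsTypeN (C : FrameAlg A) (κ ψ : A) : Prop extends Block C where
  R_01 : ∀ a b, C.R a b 0 1 = 0
  R_23 : ∀ a b, C.R a b 2 3 = 0
  R0002 : C.R 0 0 0 2 = 2 * κ
  R0003 : C.R 0 0 0 3 = 0
  R0012 : C.R 0 0 1 2 = 0
  R0013 : C.R 0 0 1 3 = κ
  R0102 : C.R 0 1 0 2 = 0
  R0103 : C.R 0 1 0 3 = κ
  R0112 : C.R 0 1 1 2 = -ψ
  R0113 : C.R 0 1 1 3 = 0
  R1002 : C.R 1 0 0 2 = 0
  R1003 : C.R 1 0 0 3 = 0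
  R1012 : C.R 1 0 1 2 = κ
  R1013 : C.R 1 0 1 3 = 0
  R1102 : C.R 1 1 0 2 = κ
  R1103 : C.R 1 1 0 3 = 0
  R1112 : C.R 1 1 1 2 = 0
  R1113 : C.R 1 1 1 3 = 2 * κ

theorem IsKE.isTypeN {κ ψ : A} (H : IsKE C κ) (h0 : C.Rl 0 3 0 3 = 0) (h1 : C.Rl 1 3 0 3 = 0)
    (h2 : C.Rl 0 3 1 2 = -κ) (h3 : C.Rl 0 2 1 2 = 0) (h4 : C.Rl 1 2 1 2 = ψ) : IsTypeN C κ ψ := by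
  obtain ⟨c1, c2, c3, c4, c5⟩ := H.components
  refine ⟨H.toBlock, fun a b => by rw [C.R_eq_Rl, H.Rl_01], fun a b => by rw [C.R_eq_Rl, H.Rl_23],
    ?_, ?_, ?_, ?_, ?_, ?_, ?_, ?_, ?_, ?_, ?_, ?_, ?_, ?_, ?_, ?_⟩
  all_goals simp only [C.R_eq_Rl, bar_zero, bar_one, C.Rl_swap' 2 0, C.Rl_swap' 2 1,
    C.Rl_swap' 3 0, C.Rl_swap' 3 1]
  · linear_combination -c1 + h2
  · linear_combination -c4 + h1
  · linear_combination -h3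
  · linear_combination -c3 - h2
  · linear_combination -C.Rl_pair 1 2 0 2 - h3
  · linear_combination -C.Rl_pair 1 2 0 3 - h2
  · linear_combination -h4
  · linear_combination -C.Rl_pair 1 2 1 3 - c5 + h3
  · linear_combination -C.Rl_pair 0 3 0 2 - c4 + h1
  · linear_combination -h0
  · linear_combination -h2
  · linear_combination -C.Rl_pair 0 3 1 3 - h1
  · linear_combination -C.Rl_pair 1 3 0 2 - c3 - h2
  · linear_combination -h1
  · linear_combination -c5 + h3
  · linear_combination -c2 + h2

namespace IsTypeN

variable {κ ψ : A}

theorem bianchi (H : IsTypeN C κ ψ) :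
    3 * (ψ * C.Γ 1 0 0) = 0 ∧ 3 * (ψ * C.Γ 1 0 3) = 0 := by
  have B1 := C.second_bianchi 0 0 0 1 2
  have B2 := C.second_bianchi 1 1 0 1 2
  have B3 := C.second_bianchi 0 0 1 2 3
  have B4 := C.second_bianchi 1 1 1 2 3
  have hD : ∀ D : Derivation ℝ A A, D (2 * κ) = 2 * D κ := fun D => by
    rw [two_mul, map_add, two_mul]
  simp only [Fin.sum_univ_four, C.R_swap _ _ 2 0, C.R_swap _ _ 2 1, C.R_swap _ _ 3 0,
    C.R_swap _ _ 3 1, C.R_swap _ _ 1 0, C.R_swap _ _ 3 2, H.R_01, H.R_23, H.R0002, H.R0003, H.R0012,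
    H.R0013, H.R0102, H.R0112, H.R0113, H.R1002, H.R1012, H.R1013, H.R1102,
    H.R1103, H.R1112, H.R1113, C.Γ02, H.Γ03, H.Γ12, C.Γ13, C.Γ20, H.Γ21, H.Γ30, C.Γ31, C.Γ22, C.Γ23,
    C.Γ32, C.Γ33, str, map_zero, map_neg, R_self, hD] at B1 B2 B3 B4
  constructor
  · linear_combination B1 - 2 * B2
  · linear_combination 2 * B3 - B4

end IsTypeN

/-- The frame is normalized up to the value of `J₄`. -/
structure IsSemiNormalized (C : FrameAlg A) (κ : A) (c d : ℝ) : Prop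
    extends IsTypeN C κ (algebraMap ℝ A c) where
  c_ne : c ≠ 0
  d_ne : d ≠ 0
  Γ102 : C.Γ 1 0 2 = algebraMap ℝ A d

namespace IsSemiNormalized

variable {κ : A} {c d : ℝ}

theorem relations (H : IsSemiNormalized C κ c d) :
    C.Γ 1 0 0 = 0 ∧ C.Γ 1 0 3 = 0 ∧ C.Γ 1 1 0 = -C.Γ 1 0 1 ∧ C.Γ 1 1 3 = C.Γ 1 0 2 ∧
    2 * C.Γ 0 0 0 = -3 * C.Γ 1 0 1 ∧ 2 * C.Γ 0 0 3 = 3 * C.Γ 1 0 2 := by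
  obtain ⟨h0, h3⟩ := H.bianchi
  replace h0 := eq_zero_of_smul H.c_ne (eq_zero_of_ofNat_mul 3 h0)
  replace h3 := eq_zero_of_smul H.c_ne (eq_zero_of_ofNat_mul 3 h3)
  have B1 := C.second_bianchi 0 1 0 1 2
  have B2 := C.second_bianchi 0 1 1 2 3
  have E1 := H.R1002
  have E2 := H.R_23 1 0
  simp only [R] at E1 E2
  simp only [Fin.sum_univ_four, C.R_swap _ _ 2 0, C.R_swap _ _ 2 1, C.R_swap _ _ 3 0,
    C.R_swap _ _ 3 1, C.R_swap _ _ 1 0, C.R_swap _ _ 3 2, H.R_01, H.R_23, H.R0002, H.R0012,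
    H.R0013, H.R0102, H.R0103, H.R0112, H.R0113, H.R1102, H.R1112, H.R1113, C.Γ02, H.Γ03, H.Γ12,
    C.Γ13, C.Γ20, H.Γ21, H.Γ30, C.Γ31, C.Γ22, C.Γ23, C.Γ32, C.Γ33, str, map_zero, map_neg, R_self,
    h0, h3, H.Γ102, Derivation.map_algebraMap] at B1 B2 E1 E2
  have e1 : C.Γ 1 1 0 + C.Γ 1 0 1 = 0 := eq_zero_of_smul H.d_ne (by linear_combination E1)
  have e2 : C.Γ 1 1 3 - algebraMap ℝ A d = 0 := eq_zero_of_smul H.d_ne (by linear_combination -E2)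
  have b1 : 2 * C.Γ 1 1 0 - C.Γ 1 0 1 - 2 * C.Γ 0 0 0 = 0 :=
    eq_zero_of_smul H.c_ne (by linear_combination B1)
  have b2 : algebraMap ℝ A d - 2 * C.Γ 0 0 3 + 2 * C.Γ 1 1 3 = 0 :=
    eq_zero_of_smul H.c_ne (by linear_combination B2)
  rw [H.Γ102]
  refine ⟨h0, h3, ?_, ?_, ?_, ?_⟩
  · linear_combination e1
  · linear_combination e2
  · linear_combination -b1 + 2 * e1
  · linear_combination -b2 + 2 * e2

theorem relations' (H : IsSemiNormalized C κ c d) (h002 : C.Γ 0 0 2 = 0) :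
    5 * C.Γ 1 0 2 * C.Γ 0 1 0 = -(2 * C.Γ 0 0 1 + 3 * C.Γ 1 1 1) * C.Γ 1 0 2 + 7 * κ ∧
    5 * C.Γ 0 1 3 = 3 * C.Γ 1 1 2 := by
  obtain ⟨h0, h3, h110, h113, h000, h003⟩ := H.relations
  have E1 := H.R0002
  have E2 := H.R_23 0 0
  have E3 := H.R1012
  have D1 := congrArg (C.D 2) h000
  have D2 := congrArg (C.D 2) h003
  have hD2 : ∀ D : Derivation ℝ A A, ∀ u, D (2 * u) = 2 * D u := fun D u => by
    rw [two_mul, map_add, two_mul]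
  have hD3 : ∀ D : Derivation ℝ A A, ∀ u, D (-3 * u) = -3 * D u := fun D u => by
    rw [show -3 * u = -(u + u + u) by ring, map_neg, map_add, map_add]; ring
  have hD3' : ∀ D : Derivation ℝ A A, ∀ u, D (3 * u) = 3 * D u := fun D u => by
    rw [show 3 * u = u + u + u by ring, map_add, map_add]; ring
  simp only [hD2, hD3, hD3', H.Γ102, Derivation.map_algebraMap, mul_zero] at D1 D2
  simp only [R] at E1 E2 E3
  simp only [Fin.sum_univ_four, C.Γ02, H.Γ03, H.Γ12,
    C.Γ13, C.Γ20, H.Γ21, H.Γ30, C.Γ31, C.Γ22, C.Γ23, C.Γ32, C.Γ33, str, map_zero,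
    h0, h3, h002, H.Γ102, Derivation.map_algebraMap] at E1 E2 E3 ⊢
  rw [H.Γ102] at h003
  refine ⟨by linear_combination 2 * E1 + D1 + 3 * E3 - C.Γ 0 1 0 * h003, ?_⟩
  have : 5 * C.Γ 0 1 3 - 3 * C.Γ 1 1 2 = 0 := eq_zero_of_smul H.d_ne (by
    linear_combination -2 * E2 + D2 + (C.Γ 1 1 2 - C.Γ 0 1 3) * h003)
  linear_combination this

end IsSemiNormalized
end FrameAlg
end PKE

namespace PKE

variable {M : Type*} [TopologicalSpace M] [ChartedSpace E4 M]

/-- The eigenvalues of the para-complex structure on the frame vectors. -/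
def sgn : Fin 4 → ℝ := ![1, 1, -1, -1]

theorem sgn_mul_self (a : Fin 4) : sgn a * sgn a = 1 := by fin_cases a <;> simp [sgn]

@[simp] theorem sgn_bar (a : Fin 4) : sgn (bar a) = -sgn a := by fin_cases a <;> simp [sgn, bar]

theorem paracomplex_apply (F : MovingFrame M) (x : M) (v : TangentSpace (𝓡 4) x) :
    F.paracomplex x v = ∑ a, (sgn a * F.coframe a x v) • F.frame a x := by
  simp [MovingFrame.paracomplex, Fin.sum_univ_four, sgn]
  abel

theorem paracomplex_frame {F : MovingFrame M} {x : M}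
    (h : ∀ a b, F.coframe a x (F.frame b x) = if a = b then 1 else 0) (a : Fin 4) :
    F.paracomplex x (F.frame a x) = sgn a • F.frame a x := by
  simp [paracomplex_apply, h]

theorem coframe_paracomplex {F : MovingFrame M} {x : M}
    (h : ∀ a b, F.coframe a x (F.frame b x) = if a = b then 1 else 0) (a : Fin 4)
    (v : TangentSpace (𝓡 4) x) :
    F.coframe a x (F.paracomplex x v) = sgn a * F.coframe a x v := by
  simp [paracomplex_apply, h]

theorem scalar_eq (F : MovingFrame M) (x : M) : F.scalar x = ∑ a, F.ricci a (bar a) x := by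
  simp only [MovingFrame.scalar, sum_η_mul]

variable [IsManifold (𝓡 4) ∞ M] {V : Set M}

theorem IsParaKaehlerEinstein.smoothMetric {g : BilinField M} {K : EndField M}
    (hP : IsParaKaehlerEinstein g K) : SmoothMetric g := hP.smooth_metric

theorem IsNullFrameOn.conn_bar_apply {g : BilinField M} {F : MovingFrame M}
    (hF : IsNullFrameOn g V F) {x : M} (hx : x ∈ V) (a b : Fin 4) (v : TangentSpace (𝓡 4) x) :
    F.conn (bar a) b x v = -F.conn (bar b) a x v := by
  have := congrArg (fun L : Module.Dual ℝ (TangentSpace (𝓡 4) x) => L v) (hF.conn_bar hx a b)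
  simp only [LinearMap.add_apply, LinearMap.zero_apply] at this
  linarith

namespace IsAdaptedOn

variable {g : BilinField M} {K : EndField M} {F F' : MovingFrame M}

theorem mono (hF : IsAdaptedOn g K V F) {W : Set M} (hW : IsOpen W) (hWV : W ⊆ V) :
    IsAdaptedOn g K W F :=
  ⟨hF.toIsNullFrameOn.mono hW hWV, fun x hx => hF.paracomplex_eq x (hWV hx)⟩

theorem K_frame (hF : IsAdaptedOn g K V F) {x : M} (hx : x ∈ V) (a : Fin 4) :
    K x (F.frame a x) = sgn a • F.frame a x := by
  rw [hF.paracomplex_eq x hx, paracomplex_frame (hF.dual x hx)]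

theorem coframe_K (hF : IsAdaptedOn g K V F) {x : M} (hx : x ∈ V) (a : Fin 4)
    (v : TangentSpace (𝓡 4) x) : F.coframe a x (K x v) = sgn a * F.coframe a x v := by
  rw [hF.paracomplex_eq x hx, coframe_paracomplex (hF.dual x hx)]

theorem coframe_eq_zero (hF : IsAdaptedOn g K V F) {x : M} (hx : x ∈ V) {a : Fin 4} {r : ℝ}
    {v : TangentSpace (𝓡 4) x} (hv : K x v = r • v) (h : sgn a ≠ r) : F.coframe a x v = 0 := by
  have h1 := hF.coframe_K hx a v
  rw [hv, map_smul, smul_eq_mul] at h1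
  have : (sgn a - r) * F.coframe a x v = 0 := by linear_combination -h1
  exact (mul_eq_zero.1 this).resolve_left (sub_ne_zero.2 h)

theorem form_frame_right (hF : IsAdaptedOn g K V F) {x : M} (hx : x ∈ V) (a : Fin 4)
    (v : TangentSpace (𝓡 4) x) :
    (g x).comp (K x) LinearMap.id v (F.frame a x) = -sgn a * F.coframe (bar a) x v := by
  rw [LinearMap.BilinForm.comp_apply, LinearMap.id_apply, hF.metric_frame_right hx, hF.coframe_K hx,
    sgn_bar]

theorem bracket_form (hP : IsParaKaehlerEinstein g K) (hF : IsAdaptedOn g K V F) {x : M}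
    (hx : x ∈ V) (a b c : Fin 4) :
    sgn c * F.coframe (bar c) x (bracket (F.frame a) (F.frame b) x)
      + sgn a * F.coframe (bar a) x (bracket (F.frame b) (F.frame c) x)
      + sgn b * F.coframe (bar b) x (bracket (F.frame c) (F.frame a) x) = 0 := by
  have h := hP.closed V _ _ _ hF.isOpen (hF.smooth a) (hF.smooth b) (hF.smooth c) x hx
  have e : ∀ a b, ∀ v, dirDeriv (fun y => (g y).comp (K y) LinearMap.id (F.frame a y) (F.frame b y))
      x v = 0 := fun a b v => dirDeriv_eq_zero (c := -sgn b * if bar b = a then 1 else 0) hF.isOpen hx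
      (fun y hy => by rw [hF.form_frame_right hy, hF.dual y hy]) v
  simp only [dTwo, e, hF.form_frame_right hx] at h
  linarith

theorem conn_zero_three (hP : IsParaKaehlerEinstein g K) (hF : IsAdaptedOn g K V F) {x : M}
    (hx : x ∈ V) (c : Fin 4) : F.conn 0 3 x (F.frame c x) = 0 := by
  have cb := fun a b d => hF.conn_bar_apply hx a b (F.frame d x)
  have hb := hP.integrable_neg V _ _ hF.isOpen (hF.smooth 2) (hF.smooth 3)
    (fun y hy => by rw [hF.K_frame hy]; simp [sgn]) (fun y hy => by rw [hF.K_frame hy]; simp [sgn]) x hx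
  have h0 := hF.coframe_eq_zero hx (a := 0) (r := -1) (by rw [hb, neg_one_smul]) (by norm_num [sgn])
  have h1 := hF.coframe_eq_zero hx (a := 1) (r := -1) (by rw [hb, neg_one_smul]) (by norm_num [sgn])
  have h2 := bracket_form hP hF hx 2 3 0
  have h3 := bracket_form hP hF hx 2 3 1
  simp only [hF.torsion hx, bar_zero, bar_one, bar_two, bar_three] at h0 h1 h2 h3
  simp only [sgn, Matrix.cons_val] at h2 h3
  have c1 := cb 3 3
  have c2 := cb 3 2
  have c3 := cb 2 2
  have c4 := cb 0 2
  have c5 := cb 0 3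
  have c6 := cb 1 2
  have c7 := cb 1 3
  simp only [bar_zero, bar_one, bar_two, bar_three] at c1 c2 c3 c4 c5 c6 c7
  match c with
  | 0 => linarith [c1 0, c2 0, c3 0, c4 2, c4 3, c5 2, c5 3, c6 2, c6 3, c7 2, c7 3]
  | 1 => linarith [c1 1, c2 1, c3 1, c4 2, c4 3, c5 2, c5 3, c6 2, c6 3, c7 2, c7 3]
  | 2 => linarith [c3 3]
  | 3 => linarith [c1 2, c2 3]

theorem conn_three_zero (hP : IsParaKaehlerEinstein g K) (hF : IsAdaptedOn g K V F) {x : M}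
    (hx : x ∈ V) (c : Fin 4) : F.conn 3 0 x (F.frame c x) = 0 := by
  have cb := fun a b d => hF.conn_bar_apply hx a b (F.frame d x)
  have hb := hP.integrable_pos V _ _ hF.isOpen (hF.smooth 0) (hF.smooth 1)
    (fun y hy => by rw [hF.K_frame hy]; simp [sgn]) (fun y hy => by rw [hF.K_frame hy]; simp [sgn]) x hx
  have h0 := hF.coframe_eq_zero hx (a := 2) (r := 1) (by rw [hb, one_smul])
    (by change (-1 : ℝ) ≠ 1; norm_num)
  have h1 := hF.coframe_eq_zero hx (a := 3) (r := 1) (by rw [hb, one_smul])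
    (by change (-1 : ℝ) ≠ 1; norm_num)
  have h2 := bracket_form hP hF hx 0 1 2
  have h3 := bracket_form hP hF hx 0 1 3
  simp only [hF.torsion hx, bar_zero, bar_one, bar_two, bar_three] at h0 h1 h2 h3
  simp only [sgn, Matrix.cons_val] at h2 h3
  have c1 := cb 1 1
  have c2 := cb 1 0
  have c3 := cb 0 0
  have c4 := cb 2 0
  have c5 := cb 2 1
  have c6 := cb 3 0
  have c7 := cb 3 1
  simp only [bar_zero, bar_one, bar_two, bar_three] at c1 c2 c3 c4 c5 c6 c7
  match c with
  | 0 => linarith [c1 0, c2 0, c3 0, c3 1]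
  | 1 => linarith [c1 1, c2 1, c3 1, c1 0]
  | 2 => linarith [c1 2, c2 2, c3 2, c4 0, c4 1, c5 0, c5 1, c6 0, c6 1, c7 0, c7 1]
  | 3 => linarith [c1 3, c2 3, c3 3, c4 0, c4 1, c5 0, c5 1, c6 0, c6 1, c7 0, c7 1]

theorem block (hP : IsParaKaehlerEinstein g K) (hF : IsAdaptedOn g K V F) :
    (hF.alg hP.smoothMetric).Block where
  Γ03 c := smoothRing.eq_of fun x => conn_zero_three hP hF x.2 c
  Γ30 c := smoothRing.eq_of fun x => conn_three_zero hP hF x.2 c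

end IsAdaptedOn

section Curvature

variable {g : BilinField M} {K : EndField M} {F F' : MovingFrame M}

theorem IsNullFrameOn.ricci_eq (hF : IsNullFrameOn g V F) (hg : SmoothMetric g) (a b : Fin 4) (x : V) :
    F.ricci a b x = ((hF.alg hg).Ric a b).1 x := by
  simp [MovingFrame.ricci, FrameAlg.Ric, hF.riemann_eq hg]

theorem IsNullFrameOn.riemannLow_eq (hF : IsNullFrameOn g V F) (hg : SmoothMetric g)
    (a b c d : Fin 4) (x : V) : F.riemannLow a b c d x = ((hF.alg hg).Rl a b c d).1 x := by
  simp [MovingFrame.riemannLow, sum_η_mul, FrameAlg.Rl, hF.riemann_eq hg]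

/-- A twelfth of the scalar curvature. -/
def IsNullFrameOn.κ (hF : IsNullFrameOn g V F) (hg : SmoothMetric g) : smoothRing V :=
  (1 / 12 : ℝ) • ∑ a, (hF.alg hg).Ric a (bar a)

theorem IsNullFrameOn.κ_apply (hF : IsNullFrameOn g V F) (hg : SmoothMetric g) (x : V) :
    (hF.κ hg).1 x = F.scalar x / 12 := by
  simp only [κ, smoothRing.smul_apply, smoothRing.sum_apply, ← hF.ricci_eq hg, scalar_eq]
  ring

theorem IsAdaptedOn.isKE (hF : IsAdaptedOn g K V F) (hP : IsParaKaehlerEinstein g K) :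
    (hF.alg hP.smoothMetric).IsKE (hF.κ hP.smoothMetric) where
  toBlock := IsAdaptedOn.block hP hF
  einstein a b := smoothRing.eq_of fun x => by
    have h := hP.einstein V F hF.toIsNullFrameOn x x.2 a b
    rw [hF.ricci_eq hP.smoothMetric, η_apply] at h
    rw [h]
    split_ifs
    · have : ((3 : smoothRing V) * hF.κ hP.smoothMetric).1 x = 3 * (F.scalar x / 12) := by
        rw [← hF.κ_apply hP.smoothMetric]; rfl
      rw [this]; ring
    · simp

theorem IsNullFrameOn.schouten_eq (hF : IsNullFrameOn g V F) (hE : IsEinstein g) {x : M}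
    (hx : x ∈ V) (a b : Fin 4) : F.schouten a b x = F.scalar x / 24 * η a b := by
  rw [MovingFrame.schouten, hE V F hF x hx]; ring

theorem IsNullFrameOn.weyl_eq (hF : IsNullFrameOn g V F) (hE : IsEinstein g) {x : M} (hx : x ∈ V)
    (a b c d : Fin 4) : F.weyl a b c d x
      = F.riemannLow a b c d x + F.scalar x / 12 * (η a d * η b c - η a c * η b d) := by
  have hs : ∀ a b : Fin 4, η b a = η a b := fun a b => by
    rw [η_apply, η_apply]
    exact if_congr ⟨fun h => by rw [h, bar_bar], fun h => by rw [h, bar_bar]⟩ rfl rfl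
  simp only [MovingFrame.weyl, hF.schouten_eq hE hx]
  rw [hs c b, hs d b, hs d a, hs c a]; ring

theorem IsNullFrameOn.Ψ₀_eq (hF : IsNullFrameOn g V F) (hg : SmoothMetric g) (hE : IsEinstein g)
    (x : V) : F.Ψ₀ x = ((hF.alg hg).Rl 0 3 0 3).1 x := by
  simp [MovingFrame.Ψ₀, hF.weyl_eq hE x.2, hF.riemannLow_eq hg, η_apply]
theorem IsNullFrameOn.Ψ₁_eq (hF : IsNullFrameOn g V F) (hg : SmoothMetric g) (hE : IsEinstein g)
    (x : V) : F.Ψ₁ x = ((hF.alg hg).Rl 1 3 0 3).1 x := by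
  simp [MovingFrame.Ψ₁, hF.weyl_eq hE x.2, hF.riemannLow_eq hg, η_apply]
theorem IsNullFrameOn.Ψ₂_eq (hF : IsNullFrameOn g V F) (hg : SmoothMetric g) (hE : IsEinstein g)
    (x : V) : F.Ψ₂ x = -((hF.alg hg).Rl 0 3 1 2).1 x - (hF.κ hg).1 x := by
  simp [MovingFrame.Ψ₂, hF.weyl_eq hE x.2, hF.riemannLow_eq hg, η_apply, hF.κ_apply]; ring
theorem IsNullFrameOn.Ψ₃_eq (hF : IsNullFrameOn g V F) (hg : SmoothMetric g) (hE : IsEinstein g)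
    (x : V) : F.Ψ₃ x = ((hF.alg hg).Rl 0 2 1 2).1 x := by
  simp [MovingFrame.Ψ₃, hF.weyl_eq hE x.2, hF.riemannLow_eq hg, η_apply]
theorem IsNullFrameOn.Ψ₄_eq (hF : IsNullFrameOn g V F) (hg : SmoothMetric g) (hE : IsEinstein g)
    (x : V) : F.Ψ₄ x = ((hF.alg hg).Rl 1 2 1 2).1 x := by
  simp [MovingFrame.Ψ₄, hF.weyl_eq hE x.2, hF.riemannLow_eq hg, η_apply]
theorem IsNullFrameOn.Ψ₂'_eq (hF : IsNullFrameOn g V F) (hg : SmoothMetric g) (hE : IsEinstein g)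
    (x : V) : F.Ψ₂' x = ((hF.alg hg).Rl 0 1 2 3).1 x - (hF.κ hg).1 x := by
  simp [MovingFrame.Ψ₂', hF.weyl_eq hE x.2, hF.riemannLow_eq hg, η_apply, hF.κ_apply]; ring

end Curvature

end PKE

namespace PKE
namespace FrameAlg

variable {A : Type*} [CommRing A] [Algebra ℝ A] {C C' : FrameAlg A}
  {h k : Matrix (Fin 4) (Fin 4) A} {κ κ' : A}

/-- A frame change between null frames that diagonalize the same para-complex structure. -/
structure AdaptedChange (C C' : FrameAlg A) (h k : Matrix (Fin 4) (Fin 4) A) : Prop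
    extends Change C C' h k where
  inv_bar : ∀ a n, k (bar a) n = h (bar n) a
  block : ∀ a b, sgn a ≠ sgn b → h a b = 0

theorem sum_four {B : Type*} [AddCommMonoid B] (f : Fin 4 → Fin 4 → Fin 4 → Fin 4 → B) :
    ∑ a, ∑ b, ∑ c, ∑ d, f a b c d
      = ∑ p : Fin 4 × Fin 4 × Fin 4 × Fin 4, f p.1 p.2.1 p.2.2.1 p.2.2.2 := by
  simp [Fintype.sum_prod_type]

/-- `R(v, w, v, w)`. -/
def quad (C : FrameAlg A) (v w : Fin 4 → A) : A :=
  ∑ a, ∑ b, ∑ c, ∑ d, v a * w b * v c * w d * C.Rl a b c d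

namespace AdaptedChange

theorem Rl_eq (H : AdaptedChange C C' h k) (a b c d : Fin 4) :
    C'.Rl a b c d = ∑ i, ∑ j, ∑ m, ∑ n, h i a * h j b * h m c * h n d * C.Rl i j m n := by
  rw [Rl, H.R_eq, ← sum_bar]
  simp only [H.inv_bar, bar_bar, Rl]

theorem quad_eq (H : AdaptedChange C C' h k) (v w : Fin 4 → A) :
    C'.quad v w = C.quad (fun i => ∑ a, h i a * v a) (fun i => ∑ a, h i a * w a) := by
  simp only [quad, H.Rl_eq]
  have e : ∀ f g p q : Fin 4 → A, (∑ a, f a) * (∑ a, g a) * (∑ a, p a) * (∑ a, q a)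
      = ∑ a, ∑ b, ∑ c, ∑ d, f a * g b * p c * q d := by
    intro f g p q
    simp only [mul_assoc, ← Finset.mul_sum, ← Finset.sum_mul]
  simp only [e]
  simp only [sum_four, Finset.mul_sum, Finset.sum_mul]
  rw [Finset.sum_comm]
  exact Finset.sum_congr rfl fun p _ => Finset.sum_congr rfl fun q _ => by ring

theorem h02 (H : AdaptedChange C C' h k) : h 0 2 = 0 := H.block _ _ (by simp [sgn]; norm_num)
theorem h03 (H : AdaptedChange C C' h k) : h 0 3 = 0 := H.block _ _ (by simp [sgn]; norm_num)
theorem h12 (H : AdaptedChange C C' h k) : h 1 2 = 0 := H.block _ _ (by simp [sgn]; norm_num)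
theorem h13 (H : AdaptedChange C C' h k) : h 1 3 = 0 := H.block _ _ (by simp [sgn]; norm_num)
theorem h20 (H : AdaptedChange C C' h k) : h 2 0 = 0 := H.block _ _ (by simp [sgn]; norm_num)
theorem h30 (H : AdaptedChange C C' h k) : h 3 0 = 0 := H.block _ _ (by simp [sgn]; norm_num)
theorem h21 (H : AdaptedChange C C' h k) : h 2 1 = 0 := H.block _ _ (by simp [sgn]; norm_num)
theorem h31 (H : AdaptedChange C C' h k) : h 3 1 = 0 := H.block _ _ (by simp [sgn]; norm_num)

theorem dual (H : AdaptedChange C C' h k) (a b : Fin 4) :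
    ∑ n, h (bar n) (bar a) * h n b = if a = b then 1 else 0 := by
  have := congrFun (congrFun H.inv_mul a) b
  rw [Matrix.mul_apply, Matrix.one_apply] at this
  rw [← this]
  exact Finset.sum_congr rfl fun n _ => by rw [← H.inv_bar, bar_bar]

theorem dual_relations (H : AdaptedChange C C' h k) :
    h 2 2 * h 0 0 + h 3 2 * h 1 0 = 1 ∧ h 2 2 * h 0 1 + h 3 2 * h 1 1 = 0 ∧
    h 2 3 * h 0 0 + h 3 3 * h 1 0 = 0 ∧ h 2 3 * h 0 1 + h 3 3 * h 1 1 = 1 := by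
  have e1 := H.dual 0 0
  have e2 := H.dual 0 1
  have e3 := H.dual 1 0
  have e4 := H.dual 1 1
  simp [Fin.sum_univ_four, H.h20, H.h30, H.h21, H.h31] at e1 e2 e3 e4
  exact ⟨e1, e2, e3, e4⟩

end AdaptedChange

/-- The quartic of the anti-self-dual Weyl curvature. -/
def quartic (C : FrameAlg A) (κ s t : A) : A :=
  C.Rl 1 2 1 2 * t ^ 4 + 4 * C.Rl 0 2 1 2 * t ^ 3 * s + 6 * (-C.Rl 0 3 1 2 - κ) * t ^ 2 * s ^ 2
    + 4 * C.Rl 1 3 0 3 * t * s ^ 3 + C.Rl 0 3 0 3 * s ^ 4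

theorem IsKE.quad_eq (H : IsKE C κ) (s t μ : A) :
    C.quad ![s, t, 0, 0] ![0, 0, -(μ * t), μ * s] = μ ^ 2 * C.quartic κ s t := by
  obtain ⟨c1, c2, c3, c4, c5⟩ := H.components
  simp only [quad, Fin.sum_univ_four, Matrix.cons_val, mul_zero, zero_mul, add_zero,
    zero_add, quartic]
  rw [C.Rl_pair 1 2 0 2, C.Rl_pair 1 2 0 3, C.Rl_pair 1 3 0 2, C.Rl_pair 0 3 0 2,
    C.Rl_pair 1 3 1 2, C.Rl_pair 0 3 1 3]
  rw [C.Rl_pair 1 2 1 3]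
  simp only [c1, c2, c3, c4, c5]
  ring

theorem AdaptedChange.quartic_eq (H : AdaptedChange C C' h k) (hC : IsKE C κ) (hC' : IsKE C' κ')
    (s t : A) : C'.quartic κ' s t = (h 2 2 * h 3 3 - h 2 3 * h 3 2) ^ 2 *
      C.quartic κ (h 0 0 * s + h 0 1 * t) (h 1 0 * s + h 1 1 * t) := by
  have h1 : C'.quad ![s, t, 0, 0] ![0, 0, -t, s] = C'.quartic κ' s t := by
    simpa using hC'.quad_eq s t 1
  rw [← h1, H.quad_eq, ← hC.quad_eq]
  obtain ⟨e1, e2, e3, e4⟩ := H.dual_relations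
  congr 1
  · funext i
    fin_cases i <;> simp [Fin.sum_univ_four, H.h20, H.h30, H.h21, H.h31]
  · funext i
    fin_cases i <;> simp [Fin.sum_univ_four, H.h02, H.h03, H.h12, H.h13]
    · linear_combination (h 2 2 * t) * e4 - (h 2 3 * t) * e2 + (h 2 2 * s) * e3 - h 2 3 * s * e1
    · linear_combination (h 3 2 * t) * e4 - (h 3 3 * t) * e2 + (h 3 2 * s) * e3 - h 3 3 * s * e1

/-- The coefficient `J₂` under a triangular change of frame. -/
theorem AdaptedChange.Γ102_eq (H : AdaptedChange C C' h k) (h10 : h 1 0 = 0) (h103 : C.Γ 1 0 3 = 0) :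
    C'.Γ 1 0 2 = h 3 3 * C.Γ 1 0 2 := by
  obtain ⟨e1, e2, e3, e4⟩ := H.dual_relations
  have hk : ∀ n, k 1 n = h (bar n) 3 := H.inv_bar 3
  rw [H.Γ_eq]
  simp [Fin.sum_univ_four, hk, H.h02, H.h03, H.h12, H.h13, H.h20, H.h30, h10, h103] at e1 e3 ⊢
  have h23 : h 2 3 = 0 := by linear_combination h 2 2 * e3 - h 2 3 * e1
  rw [h23]
  linear_combination h 3 3 * C.Γ 1 0 2 * e1

/-- The coefficient `J₄` under a triangular change of frame. -/
theorem AdaptedChange.Γ002_eq (H : AdaptedChange C C' h k) (h10 : h 1 0 = 0) (h103 : C.Γ 1 0 3 = 0) :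
    C'.Γ 0 0 2 = h 2 2 * C'.D 2 (h 0 0) + h 2 2 * C.Γ 0 0 2 + h 3 2 * (C.Γ 0 0 3 + C.Γ 1 0 2) := by
  obtain ⟨e1, e2, e3, e4⟩ := H.dual_relations
  have hk : ∀ n, k 0 n = h (bar n) 2 := H.inv_bar 2
  rw [H.Γ_eq]
  simp [Fin.sum_univ_four, hk, H.h02, H.h12, H.h20, H.h30, h10, h103] at e1 ⊢
  linear_combination (h 2 2 * C.Γ 0 0 2 + h 3 2 * C.Γ 0 0 3 + h 3 2 * C.Γ 1 0 2) * e1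

end FrameAlg

end PKE

namespace PKE

variable {M : Type*} [TopologicalSpace M] [ChartedSpace E4 M]

namespace MovingFrame

/-- The moving frame with frame vectors `e`, with its metric dual coframe and the connection forms
given by the Koszul formula. -/
def ofFrame (g : BilinField M) (e : Fin 4 → VField M) : MovingFrame M where
  coframe a x := g x (e (bar a) x)
  frame := e
  conn a b x := ∑ c, ((g x (e (bar a) x) (bracket (e c) (e b) x)
      - g x (e b x) (bracket (e c) (e (bar a)) x)
      + g x (e c x) (bracket (e (bar a)) (e b) x)) / 2) • g x (e (bar c) x)

end MovingFrame

variable [IsManifold (𝓡 4) ∞ M] {V : Set M} {g : BilinField M} {K : EndField M}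

theorem isNullFrameOn_ofFrame {e : Fin 4 → VField M} (hV : IsOpen V)
    (he : ∀ a, SmoothVField V (e a))
    (hG : ∀ x ∈ V, ∀ a b, g x (e a x) (e b x) = if b = bar a then 1 else 0) :
    IsNullFrameOn g V (MovingFrame.ofFrame g e) := by
  have hd : ∀ x ∈ V, ∀ a b, (MovingFrame.ofFrame g e).coframe a x
      ((MovingFrame.ofFrame g e).frame b x) = if a = b then 1 else 0 := by
    intro x hx a b
    change g x (e (bar a) x) (e b x) = _
    rw [hG x hx, bar_bar]
    exact if_congr eq_comm rfl rfl
  have hconn : ∀ x ∈ V, ∀ a b c, (MovingFrame.ofFrame g e).conn a b x (e c x)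
      = (g x (e (bar a) x) (bracket (e c) (e b) x) - g x (e b x) (bracket (e c) (e (bar a)) x)
      + g x (e c x) (bracket (e (bar a)) (e b) x)) / 2 := by
    intro x hx a b c
    simp [MovingFrame.ofFrame, LinearMap.sum_apply, hG x hx]
  refine ⟨hV, he, hd, fun x hx => ?_, fun x hx a c d => ?_, fun x hx a b => ?_⟩
  · ext v w
    have := sum_dual_smul (hd x hx) v
    conv_lhs => rw [← this]
    simp [MovingFrame.metric, LinearMap.sum_apply, η_apply, LinearMap.BilinForm.linMulLin_apply,
      MovingFrame.ofFrame]
  · have e1 : ∀ b, ∀ v, dirDeriv (fun y => (MovingFrame.ofFrame g e).coframe a y (e b y)) x v = 0 :=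
      fun b v => dirDeriv_eq_zero hV hx (fun y hy => hd y hy a b) v
    have e2 : ∀ a b, (MovingFrame.ofFrame g e).coframe a x (e b x) = if a = b then 1 else 0 := hd x hx
    have hf : (MovingFrame.ofFrame g e).frame = e := rfl
    simp only [dOne, hf, e1, wedge, e2, Finset.sum_sub_distrib]
    simp only [mul_ite, mul_one, mul_zero, Finset.sum_ite_eq', Finset.mem_univ, if_true, hconn x hx]
    rw [bracket_swap (e d) (e c), bracket_swap (e d) (e (bar a)), bracket_swap (e c) (e (bar a))]
    simp only [MovingFrame.ofFrame, map_neg]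
    ring
  · ext v
    have h1 : ∀ a b, (MovingFrame.ofFrame g e).conn a b x v = ∑ c,
        (MovingFrame.ofFrame g e).coframe c x v * (MovingFrame.ofFrame g e).conn a b x (e c x) := by
      intro a b
      conv_lhs => rw [← sum_dual_smul (hd x hx) v]
      simp only [map_sum, map_smul, smul_eq_mul]
      rfl
    have h2 : ∀ c, (MovingFrame.ofFrame g e).conn (bar a) b x (e c x)
        + (MovingFrame.ofFrame g e).conn (bar b) a x (e c x) = 0 := by
      intro c
      rw [hconn x hx, hconn x hx, bracket_swap (e (bar (bar b)))]
      simp only [bar_bar, map_neg]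
      ring
    simp only [η_apply, Finset.sum_add_distrib, ite_smul, one_smul, zero_smul, Finset.sum_ite_eq',
      Finset.mem_univ, if_true, LinearMap.add_apply, LinearMap.zero_apply]
    rw [h1, h1, ← Finset.sum_add_distrib]
    exact Finset.sum_eq_zero fun c _ => by rw [← mul_add, h2, mul_zero]

theorem isAdaptedOn_ofFrame {e : Fin 4 → VField M} (hV : IsOpen V)
    (he : ∀ a, SmoothVField V (e a))
    (hG : ∀ x ∈ V, ∀ a b, g x (e a x) (e b x) = if b = bar a then 1 else 0)
    (hK : ∀ x ∈ V, ∀ a, K x (e a x) = sgn a • e a x) :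
    IsAdaptedOn g K V (MovingFrame.ofFrame g e) where
  toIsNullFrameOn := isNullFrameOn_ofFrame hV he hG
  paracomplex_eq x hx := by
    have hF := isNullFrameOn_ofFrame hV he hG
    ext1 v
    conv_lhs => rw [← hF.sum_coframe hx v]
    rw [paracomplex_apply, map_sum]
    refine Finset.sum_congr rfl fun a _ => ?_
    rw [map_smul, mul_comm, mul_smul]
    exact congrArg _ (hK x hx a)

namespace IsAdaptedOn

variable {F F' : MovingFrame M}

theorem exists_change_matrix (hF : IsAdaptedOn g K V F) {H : M → Matrix (Fin 4) (Fin 4) ℝ}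
    (hs : ∀ a b, SmoothFun V fun x => H x a b)
    (hG : ∀ x ∈ V, ∀ b c, ∑ a, H x a b * H x (bar a) c = if c = bar b then 1 else 0)
    (hb : ∀ x ∈ V, ∀ a b, sgn a ≠ sgn b → H x a b = 0) :
    ∃ F' : MovingFrame M, IsAdaptedOn g K V F' ∧
      ∀ x ∈ V, ∀ a b, F.coframe a x (F'.frame b x) = H x a b := by
  refine ⟨MovingFrame.ofFrame g fun b x => ∑ a, H x a b • F.frame a x,
    isAdaptedOn_ofFrame hF.isOpen (fun b => ?_) (fun x hx b c => ?_) (fun x hx b => ?_),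
    fun x hx a b => ?_⟩
  · exact SmoothVField.sum _ fun a _ => SmoothVField.smul (hs a b) (hF.smooth a)
  · rw [hF.metric_apply hx, ← hG x hx]
    simp [hF.dual x hx]
  · rw [map_sum, Finset.smul_sum]
    refine Finset.sum_congr rfl fun a _ => ?_
    rw [map_smul, hF.K_frame hx, smul_smul, smul_smul]
    by_cases h : sgn a = sgn b
    · rw [h, mul_comm]
    · rw [hb x hx a b h, zero_mul, mul_zero]
  · change F.coframe a x (∑ c, H x c b • F.frame c x) = _
    simp [hF.dual x hx]

/-- Adapted frames can be changed by `GL₂`-valued functions. -/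
theorem exists_change (hF : IsAdaptedOn g K V F) {p q r s : M → ℝ} (hp : SmoothFun V p)
    (hq : SmoothFun V q) (hr : SmoothFun V r) (hs : SmoothFun V s)
    (hd : ∀ x ∈ V, p x * s x - q x * r x ≠ 0) :
    ∃ F' : MovingFrame M, IsAdaptedOn g K V F' ∧
      ∀ x ∈ V, ∀ a b, F.coframe a x (F'.frame b x)
        = !![p x, q x, 0, 0; r x, s x, 0, 0;
          0, 0, s x / (p x * s x - q x * r x), -r x / (p x * s x - q x * r x);
          0, 0, -q x / (p x * s x - q x * r x), p x / (p x * s x - q x * r x)] a b := by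
  have hD := (hp.mul hs).sub (hq.mul hr)
  refine hF.exists_change_matrix (fun a b => ?_) (fun x hx b c => ?_) (fun x hx a b hab => ?_)
  · have h0 : SmoothFun V (fun _ : M => (0 : ℝ)) := SmoothFun.const 0
    fin_cases a <;> fin_cases b
    exacts [hp, hq, h0, h0, hr, hs, h0, h0, h0, h0, hs.div hD hd, hr.neg.div hD hd, h0, h0,
      hq.neg.div hD hd, hp.div hD hd]
  · have hd := hd x hx
    generalize p x = p, q x = q, r x = r, s x = s at hd ⊢
    have e1 : p * (s / (p * s - q * r)) + r * (-q / (p * s - q * r)) = 1 := by field_simp; ring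
    have e2 : p * (-r / (p * s - q * r)) + r * (p / (p * s - q * r)) = 0 := by field_simp; ring
    have e3 : q * (s / (p * s - q * r)) + s * (-q / (p * s - q * r)) = 0 := by field_simp; ring
    have e4 : q * (-r / (p * s - q * r)) + s * (p / (p * s - q * r)) = 1 := by field_simp; ring
    generalize s / (p * s - q * r) = u, -q / (p * s - q * r) = v, -r / (p * s - q * r) = w,
      p / (p * s - q * r) = z at e1 e2 e3 e4 ⊢
    fin_cases b <;> fin_cases c <;> simp [Fin.sum_univ_four] <;> linarith
  · revert hab
    fin_cases a <;> fin_cases b <;> simp [sgn]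

end IsAdaptedOn

end PKE

namespace PKE

variable {M : Type*} [TopologicalSpace M] [ChartedSpace E4 M]

/-- Evaluation of smooth functions at a point. -/
def smoothRing.ev {V : Set M} (x : V) : smoothRing V →+* ℝ :=
  (Pi.evalRingHom (fun _ : V => ℝ) x).comp (smoothRing V).val.toRingHom

@[simp] theorem smoothRing.ev_apply {V : Set M} (x : V) (u : smoothRing V) :
    smoothRing.ev x u = u.1 x := rfl

theorem smoothRing.smoothFun {V : Set M} (u : smoothRing V) {f : M → ℝ} (h : ∀ x : V, f x = u.1 x) :
    SmoothFun V f :=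
  (smoothRing.smooth_lift u).congr fun x hx => by
    rw [h ⟨x, hx⟩, ← smoothRing.lift_apply u ⟨x, hx⟩]

namespace MovingFrame

variable {F : MovingFrame M} {x : M}

theorem quartic_zero_right (F : MovingFrame M) (x : M) (s : ℝ) :
    F.quartic x s 0 = F.Ψ₀ x * s ^ 4 := by simp [quartic]

theorem quartic_zero_left (F : MovingFrame M) (x : M) (t : ℝ) :
    F.quartic x 0 t = F.Ψ₄ x * t ^ 4 := by simp [quartic]

/-- A quartic that is a multiple of `t ^ 4` has the obvious coefficients. -/
theorem coefficients_of_quartic {p : ℝ} (h : ∀ s t, F.quartic x s t = p * t ^ 4) :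
    F.Ψ₀ x = 0 ∧ F.Ψ₁ x = 0 ∧ F.Ψ₂ x = 0 ∧ F.Ψ₃ x = 0 ∧ F.Ψ₄ x = p := by
  have h0 := h 1 0
  have h1 := h 0 1
  have h2 := h 1 1
  have h3 := h 1 (-1)
  have h4 := h 1 2
  simp only [quartic] at h0 h1 h2 h3 h4
  refine ⟨?_, ?_, ?_, ?_, ?_⟩ <;> linarith

theorem quartic_of_coefficients (h : F.Ψ₀ x = 0 ∧ F.Ψ₁ x = 0 ∧ F.Ψ₂ x = 0 ∧ F.Ψ₃ x = 0)
    (s t : ℝ) : F.quartic x s t = F.Ψ₄ x * t ^ 4 := by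
  simp [quartic, h]

/-- The repeated root of the quartic in terms of its coefficients. -/
theorem PetrovTypeN.quartic_eq (h : F.PetrovTypeN x) (h4 : F.Ψ₄ x ≠ 0) (s t : ℝ) :
    F.quartic x s (-(F.Ψ₃ x / F.Ψ₄ x) * s + t) = F.Ψ₄ x * t ^ 4 := by
  obtain ⟨c, a, b, hc, -, hq⟩ := h
  have hp : F.quartic x 0 1 = F.Ψ₄ x := by simp [quartic_zero_left]
  have h0 := hq 0 1
  have h2 := hq 1 1
  have h3 := hq 1 (-1)
  have h4' := hq 1 2
  have h1 := hq 1 0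
  have e3 : F.Ψ₃ x = -(c * a ^ 3 * b) := by
    simp only [quartic] at h0 h1 h2 h3 h4'
    linarith
  have e4 : F.Ψ₄ x = c * a ^ 4 := by rw [← hp, h0]; ring
  have ha : a ≠ 0 := by
    rintro rfl
    exact h4 (by rw [e4]; ring)
  have e : -(F.Ψ₃ x / F.Ψ₄ x) = b / a := by
    rw [e3, e4]; field_simp
  rw [e, hq, e4]
  field_simp
  ring

end MovingFrame

variable [IsManifold (𝓡 4) ∞ M] {V : Set M} {g : BilinField M} {K : EndField M} {F F' : MovingFrame M}

namespace IsAdaptedOn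

theorem adaptedChange (hF : IsAdaptedOn g K V F) (hF' : IsAdaptedOn g K V F') (hg : SmoothMetric g) :
    FrameAlg.AdaptedChange (hF.alg hg) (hF'.alg hg)
      (transition hF.toIsNullFrameOn hF'.toIsNullFrameOn hg)
      (transition hF'.toIsNullFrameOn hF.toIsNullFrameOn hg) where
  toChange := change_transition _ _ hg
  inv_bar := transition_bar _ _ hg
  block _ b hab := smoothRing.eq_of fun x => hF.coframe_eq_zero x.2 (hF'.K_frame x.2 b) hab

theorem dual_relations (hF : IsAdaptedOn g K V F) (hF' : IsAdaptedOn g K V F') (hg : SmoothMetric g)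
    {x : M} (hx : x ∈ V) {m : Fin 4 → Fin 4 → ℝ} (hm : ∀ a b, F.coframe a x (F'.frame b x) = m a b) :
    m 2 2 * m 0 0 + m 3 2 * m 1 0 = 1 ∧ m 2 2 * m 0 1 + m 3 2 * m 1 1 = 0 ∧
    m 2 3 * m 0 0 + m 3 3 * m 1 0 = 0 ∧ m 2 3 * m 0 1 + m 3 3 * m 1 1 = 1 := by
  obtain ⟨e1, e2, e3, e4⟩ := (hF.adaptedChange hF' hg).dual_relations
  have e1 := congrArg (smoothRing.ev ⟨x, hx⟩) e1
  have e2 := congrArg (smoothRing.ev ⟨x, hx⟩) e2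
  have e3 := congrArg (smoothRing.ev ⟨x, hx⟩) e3
  have e4 := congrArg (smoothRing.ev ⟨x, hx⟩) e4
  simp only [map_add, map_mul, map_one, map_zero, smoothRing.ev_apply, transition_apply, hm]
    at e1 e2 e3 e4
  exact ⟨e1, e2, e3, e4⟩

theorem quartic_alg (hF : IsAdaptedOn g K V F) (hP : IsParaKaehlerEinstein g K) (x : V)
    (s t : smoothRing V) : F.quartic x (s.1 x) (t.1 x)
      = smoothRing.ev x ((hF.alg hP.smoothMetric).quartic (hF.κ hP.smoothMetric) s t) := by
  simp only [MovingFrame.quartic, FrameAlg.quartic, hF.Ψ₀_eq hP.smoothMetric hP.einstein,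
    hF.Ψ₁_eq hP.smoothMetric hP.einstein, hF.Ψ₂_eq hP.smoothMetric hP.einstein,
    hF.Ψ₃_eq hP.smoothMetric hP.einstein, hF.Ψ₄_eq hP.smoothMetric hP.einstein,
    map_add, map_mul, map_pow, map_sub, map_neg, map_ofNat, smoothRing.ev_apply]

/-- The quartic under a change of adapted frame. -/
theorem quartic_change (hF : IsAdaptedOn g K V F) (hF' : IsAdaptedOn g K V F')
    (hP : IsParaKaehlerEinstein g K) {x : M} (hx : x ∈ V) {m : Fin 4 → Fin 4 → ℝ}
    (hm : ∀ a b, F.coframe a x (F'.frame b x) = m a b) (s t : ℝ) :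
    F'.quartic x s t = (m 2 2 * m 3 3 - m 2 3 * m 3 2) ^ 2
      * F.quartic x (m 0 0 * s + m 0 1 * t) (m 1 0 * s + m 1 1 * t) := by
  have h := congrArg (smoothRing.ev ⟨x, hx⟩) ((hF.adaptedChange hF' hP.smoothMetric).quartic_eq
    (hF.isKE hP) (hF'.isKE hP) (algebraMap ℝ _ s) (algebraMap ℝ _ t))
  rw [map_mul, ← hF'.quartic_alg hP, ← hF.quartic_alg hP] at h
  simpa only [map_add, map_mul, map_pow, map_sub, smoothRing.ev_apply, transition_apply, hm,
    smoothRing.algebraMap_apply, smoothRing.add_apply, smoothRing.mul_apply] using h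

end IsAdaptedOn

/-- Adapted frames in which the quartic is a nonzero multiple of `t ^ 4`. -/
structure IsPrincipalOn (g : BilinField M) (K : EndField M) (V : Set M) (F : MovingFrame M) : Prop
    extends IsAdaptedOn g K V F where
  Ψ_eq : ∀ x ∈ V, F.Ψ₀ x = 0 ∧ F.Ψ₁ x = 0 ∧ F.Ψ₂ x = 0 ∧ F.Ψ₃ x = 0
  Ψ₄_ne : ∀ x ∈ V, F.Ψ₄ x ≠ 0

namespace IsPrincipalOn

theorem isTypeN (hF : IsPrincipalOn g K V F) (hP : IsParaKaehlerEinstein g K) :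
    (hF.alg hP.smoothMetric).IsTypeN (hF.κ hP.smoothMetric) ((hF.alg hP.smoothMetric).Rl 1 2 1 2) := by
  refine (hF.isKE hP).isTypeN (smoothRing.eq_of fun x => ?_) (smoothRing.eq_of fun x => ?_)
    (smoothRing.eq_of fun x => ?_) (smoothRing.eq_of fun x => ?_) rfl
  · rw [← hF.Ψ₀_eq hP.smoothMetric hP.einstein]; exact (hF.Ψ_eq x x.2).1
  · rw [← hF.Ψ₁_eq hP.smoothMetric hP.einstein]; exact (hF.Ψ_eq x x.2).2.1
  · have := (hF.Ψ_eq x x.2).2.2.1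
    rw [hF.Ψ₂_eq hP.smoothMetric hP.einstein] at this
    rw [smoothRing.neg_apply]
    linarith
  · rw [← hF.Ψ₃_eq hP.smoothMetric hP.einstein]; exact (hF.Ψ_eq x x.2).2.2.2

theorem Γ103 (hF : IsPrincipalOn g K V F) (hP : IsParaKaehlerEinstein g K) :
    (hF.alg hP.smoothMetric).Γ 1 0 3 = 0 := by
  refine smoothRing.eq_of fun x => ?_
  have h := congrArg (smoothRing.ev x) (FrameAlg.eq_zero_of_ofNat_mul 3 (hF.isTypeN hP).bianchi.2)
  rw [map_mul, smoothRing.ev_apply, ← hF.Ψ₄_eq hP.smoothMetric hP.einstein] at h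
  exact (mul_eq_zero.1 h).resolve_left (hF.Ψ₄_ne x x.2)

theorem transition_zero (hF : IsPrincipalOn g K V F) (hF' : IsAdaptedOn g K V F')
    (h0 : ∀ x ∈ V, F'.Ψ₀ x = 0) (hP : IsParaKaehlerEinstein g K) {x : M} (hx : x ∈ V) :
    F.coframe 1 x (F'.frame 0 x) = 0 := by
  have h := hF.quartic_change hF' hP hx (fun _ _ => rfl) 1 0
  obtain ⟨e1, e2, e3, e4⟩ := hF.dual_relations hF' hP.smoothMetric hx (fun _ _ => rfl)
  rw [F.quartic_of_coefficients (hF.Ψ_eq x hx), F'.quartic_zero_right, h0 x hx] at h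
  generalize hm : (fun a b => F.coframe a x (F'.frame b x)) = m at *
  have hm : ∀ a b, F.coframe a x (F'.frame b x) = m a b := fun a b => by rw [← hm]
  simp only [hm, mul_one, mul_zero, add_zero, one_pow] at h e1 e2 e3 e4 ⊢
  have hd : (m 2 2 * m 3 3 - m 2 3 * m 3 2) * (m 0 0 * m 1 1 - m 0 1 * m 1 0) = 1 := by
    linear_combination (m 2 3 * m 0 1 + m 3 3 * m 1 1) * e1 + e4
      - (m 2 3 * m 0 0 + m 3 3 * m 1 0) * e2
  have hd0 : (m 2 2 * m 3 3 - m 2 3 * m 3 2) ^ 2 ≠ 0 :=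
    pow_ne_zero _ (left_ne_zero_of_mul (by rw [hd]; exact one_ne_zero))
  have h1 := (mul_eq_zero.1 h.symm).resolve_left hd0
  exact pow_eq_zero_iff (by norm_num) |>.1 ((mul_eq_zero.1 h1).resolve_left (hF.Ψ₄_ne x hx))

/-- The invariants of a principal frame under a change of frame. -/
theorem change (hF : IsPrincipalOn g K V F) (hF' : IsPrincipalOn g K V F')
    (hP : IsParaKaehlerEinstein g K) {x : M} (hx : x ∈ V) {m : Fin 4 → Fin 4 → ℝ}
    (hm : ∀ a b, F.coframe a x (F'.frame b x) = m a b) :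
    m 1 0 = 0 ∧ m 2 3 = 0 ∧ m 2 2 * m 0 0 = 1 ∧ m 3 3 * m 1 1 = 1 ∧
      m 2 2 * m 0 1 + m 3 2 * m 1 1 = 0 ∧
      F'.Ψ₄ x = (m 2 2 * m 1 1) ^ 2 * F.Ψ₄ x ∧ F'.J₂ x = m 3 3 * F.J₂ x ∧
      F'.J₄ x = m 2 2 * dirDeriv (fun y => F.coframe 0 y (F'.frame 0 y)) x (F'.frame 2 x)
        + m 2 2 * F.J₄ x + m 3 2 * (F.conn 0 0 x (F.frame 3 x) + F.J₂ x) := by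
  have h10 : m 1 0 = 0 := by
    rw [← hm]; exact hF.transition_zero hF'.toIsAdaptedOn (fun y hy => (hF'.Ψ_eq y hy).1) hP hx
  obtain ⟨e1, e2, e3, e4⟩ := hF.dual_relations hF'.toIsAdaptedOn hP.smoothMetric hx hm
  have q := hF.quartic_change hF'.toIsAdaptedOn hP hx hm 0 1
  rw [F.quartic_of_coefficients (hF.Ψ_eq x hx), F'.quartic_of_coefficients (hF'.Ψ_eq x hx)] at q
  have H := hF.adaptedChange hF'.toIsAdaptedOn hP.smoothMetric
  have H10 : transition hF.toIsNullFrameOn hF'.toIsNullFrameOn hP.smoothMetric 1 0 = 0 :=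
    smoothRing.eq_of fun y =>
      hF.transition_zero hF'.toIsAdaptedOn (fun y hy => (hF'.Ψ_eq y hy).1) hP y.2
  have J := congrArg (smoothRing.ev ⟨x, hx⟩) (H.Γ102_eq H10 (hF.Γ103 hP))
  have J' := congrArg (smoothRing.ev ⟨x, hx⟩) (H.Γ002_eq H10 (hF.Γ103 hP))
  have hD : ((hF'.alg hP.smoothMetric).D 2
      (transition hF.toIsNullFrameOn hF'.toIsNullFrameOn hP.smoothMetric 0 0)).1 ⟨x, hx⟩
      = dirDeriv (fun y => F.coframe 0 y (F'.frame 0 y)) x (F'.frame 2 x) :=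
    hF'.alg_D_apply hP.smoothMetric 2
      (hF.smooth_coframe hP.smoothMetric 0 (hF'.smooth 0)) (fun _ => rfl) ⟨x, hx⟩
  simp only [map_mul, map_add, smoothRing.ev_apply, transition_apply, hm, hD,
    IsNullFrameOn.alg_Γ_apply] at J J'
  rw [h10] at e1 e3
  have h23 : m 2 3 = 0 := by linear_combination m 2 2 * e3 - m 2 3 * e1
  rw [h23] at e4
  refine ⟨h10, h23, by linarith, by linarith, e2, ?_, J, J'⟩
  rw [h23, h10] at q
  linear_combination q + (m 2 2 ^ 2 * m 1 1 ^ 2 * F.Ψ₄ x) * (m 3 3 * m 1 1 + 1) * e4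

end IsPrincipalOn

end PKE

namespace PKE

variable {M : Type*} [TopologicalSpace M] [ChartedSpace E4 M]
theorem reflect_coframe (F : MovingFrame M) (a : Fin 4) (x : M) :
    F.reflect.coframe a x = (![-1, 1, -1, 1] a : ℝ) • F.coframe a x := rfl

variable [IsManifold (𝓡 4) ∞ M] {V : Set M} {g : BilinField M} {K : EndField M} {F F' : MovingFrame M}

namespace IsPrincipalOn

theorem mono (hF : IsPrincipalOn g K V F) {W : Set M} (hW : IsOpen W) (hWV : W ⊆ V) :
    IsPrincipalOn g K W F :=
  ⟨hF.toIsAdaptedOn.mono hW hWV, fun x hx => hF.Ψ_eq x (hWV hx), fun x hx => hF.Ψ₄_ne x (hWV hx)⟩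

theorem smooth_Ψ₄ (hF : IsPrincipalOn g K V F) (hP : IsParaKaehlerEinstein g K) :
    SmoothFun V F.Ψ₄ :=
  smoothRing.smoothFun _ (hF.Ψ₄_eq hP.smoothMetric hP.einstein)

/-- Triangular changes of frame. -/
theorem exists_change (hF : IsPrincipalOn g K V F) (hP : IsParaKaehlerEinstein g K) {p q s : M → ℝ}
    (hp : SmoothFun V p) (hq : SmoothFun V q) (hs : SmoothFun V s) (hp0 : ∀ x ∈ V, p x ≠ 0)
    (hs0 : ∀ x ∈ V, s x ≠ 0) :
    ∃ F' : MovingFrame M, IsPrincipalOn g K V F' ∧ ∀ x ∈ V,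
      F'.Ψ₄ x = (s x / p x) ^ 2 * F.Ψ₄ x ∧ F'.J₂ x = F.J₂ x / s x ∧
      F'.J₄ x = dirDeriv p x (F'.frame 2 x) / p x + F.J₄ x / p x
        - q x / (p x * s x) * (F.conn 0 0 x (F.frame 3 x) + F.J₂ x) := by
  obtain ⟨F', hF', hm⟩ := hF.toIsAdaptedOn.exists_change hp hq (SmoothFun.const 0) hs
    (by simpa using fun x hx => ⟨hp0 x hx, hs0 x hx⟩)
  have key : ∀ x ∈ V, ∀ a b, F'.quartic x a b = ((s x / p x) ^ 2 * F.Ψ₄ x) * b ^ 4 := by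
    intro x hx a b
    rw [hF.quartic_change hF' hP hx (hm x hx), F.quartic_of_coefficients (hF.Ψ_eq x hx)]
    have := hp0 x hx
    have := hs0 x hx
    simp
    field_simp
  have hF'' : IsPrincipalOn g K V F' := by
    refine ⟨hF', fun x hx => ?_, fun x hx => ?_⟩
    · obtain ⟨h0, h1, h2, h3, -⟩ := F'.coefficients_of_quartic (key x hx)
      exact ⟨h0, h1, h2, h3⟩
    · rw [(F'.coefficients_of_quartic (key x hx)).2.2.2.2]
      exact mul_ne_zero (pow_ne_zero _ (div_ne_zero (hs0 x hx) (hp0 x hx))) (hF.Ψ₄_ne x hx)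
  refine ⟨F', hF'', fun x hx => ⟨(F'.coefficients_of_quartic (key x hx)).2.2.2.2, ?_⟩⟩
  obtain ⟨-, -, -, -, -, -, h2, h4⟩ := hF.change hF'' hP hx (hm x hx)
  have e : dirDeriv (fun y => F.coframe 0 y (F'.frame 0 y)) x (F'.frame 2 x)
      = dirDeriv p x (F'.frame 2 x) :=
    dirDeriv_congr hF.isOpen hx (fun y hy => by rw [hm y hy]; rfl) _
  have := hp0 x hx
  have := hs0 x hx
  rw [h2, h4, e]
  simp
  constructor
  · field_simp
  · field_simp
    ring

theorem isSemiNormalized (hF : IsPrincipalOn g K V F) (hP : IsParaKaehlerEinstein g K) {c d : ℝ}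
    (hc : c ≠ 0) (hd : d ≠ 0) (h4 : ∀ x ∈ V, F.Ψ₄ x = c) (h2 : ∀ x ∈ V, F.J₂ x = d) :
    (hF.alg hP.smoothMetric).IsSemiNormalized (hF.κ hP.smoothMetric) c d where
  toIsTypeN := by
    have h : algebraMap ℝ (smoothRing V) c = (hF.alg hP.smoothMetric).Rl 1 2 1 2 :=
      smoothRing.eq_of fun x => by
        rw [← hF.Ψ₄_eq hP.smoothMetric hP.einstein, h4 x x.2, smoothRing.algebraMap_apply]
    rw [h]
    exact hF.isTypeN hP
  c_ne := hc
  d_ne := hd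
  Γ102 := smoothRing.eq_of fun x => h2 x x.2

theorem conn_zero_zero_three (hF : IsPrincipalOn g K V F) (hP : IsParaKaehlerEinstein g K) {c d : ℝ}
    (hc : c ≠ 0) (hd : d ≠ 0) (h4 : ∀ x ∈ V, F.Ψ₄ x = c) (h2 : ∀ x ∈ V, F.J₂ x = d) {x : M}
    (hx : x ∈ V) : F.conn 0 0 x (F.frame 3 x) = 3 / 2 * d := by
  have H := hF.isSemiNormalized hP hc hd h4 h2
  have h := congrArg (smoothRing.ev ⟨x, hx⟩) H.relations.2.2.2.2.2
  rw [H.Γ102] at h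
  simp only [map_mul, map_ofNat, smoothRing.ev_apply, IsNullFrameOn.alg_Γ_apply,
    smoothRing.algebraMap_apply] at h
  linarith

/-- Normalization of a principal frame. -/
theorem exists_normalized (hF : IsPrincipalOn g K V F) (hP : IsParaKaehlerEinstein g K)
    (hJ : ∀ x ∈ V, F.J₂ x ≠ 0) {c d : ℝ} (hd : d ≠ 0) (hc : ∀ x ∈ V, 0 < F.Ψ₄ x / c)
    (hc0 : c ≠ 0) : ∃ F' : MovingFrame M, IsNormalizedOn g K V F' c d := by
  have hr : SmoothFun V (fun x => F.J₂ x / d) :=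
    (hF.smooth_conn hP.smoothMetric 1 0 2).div (SmoothFun.const d) fun _ _ => hd
  have hq := (((hF.smooth_Ψ₄ hP).div (SmoothFun.const c) fun _ _ => hc0).sqrt
    fun x hx => (hc x hx).ne')
  have hq0 : ∀ x ∈ V, Real.sqrt (F.Ψ₄ x / c) ≠ 0 := fun x hx => (Real.sqrt_pos.2 (hc x hx)).ne'
  have hr0 : ∀ x ∈ V, F.J₂ x / d ≠ 0 := fun x hx => div_ne_zero (hJ x hx) hd
  obtain ⟨F₁, hF₁, h₁⟩ := hF.exists_change hP (hr.mul hq) (SmoothFun.const 0) hr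
    (fun x hx => mul_ne_zero (hr0 x hx) (hq0 x hx)) hr0
  have h4 : ∀ x ∈ V, F₁.Ψ₄ x = c := by
    intro x hx
    have h := (h₁ x hx).1
    have := Real.sq_sqrt (hc x hx).le
    have := hr0 x hx
    have := hq0 x hx
    have h5 := hF.Ψ₄_ne x hx
    have e : (F.J₂ x / d / (F.J₂ x / d * Real.sqrt (F.Ψ₄ x / c))) ^ 2 = (F.Ψ₄ x / c)⁻¹ := by
      rw [div_mul_cancel_left₀ (hr0 x hx), inv_pow, Real.sq_sqrt (hc x hx).le]
    rw [h, e]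
    field_simp
  have h2 : ∀ x ∈ V, F₁.J₂ x = d := by
    intro x hx
    have := hJ x hx
    rw [(h₁ x hx).2.1]
    field_simp
  have hq : SmoothFun V (fun x => F₁.J₄ x * (2 / (5 * d))) :=
    (hF₁.smooth_conn hP.smoothMetric 0 0 2).mul (SmoothFun.const _)
  obtain ⟨F₂, hF₂, h₂⟩ := hF₁.exists_change hP (SmoothFun.const 1) hq (SmoothFun.const 1)
    (fun _ _ => one_ne_zero) (fun _ _ => one_ne_zero)
  refine ⟨F₂, hF₂.toIsAdaptedOn, fun x hx => (hF₂.Ψ_eq x hx).1, fun x hx => (hF₂.Ψ_eq x hx).2.1,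
    fun x hx => (hF₂.Ψ_eq x hx).2.2.1, fun x hx => (hF₂.Ψ_eq x hx).2.2.2, fun x hx => ?_,
    fun x hx => ?_, fun x hx => ?_⟩
  · rw [(h₂ x hx).1, h4 x hx]; ring
  · rw [(h₂ x hx).2.1, h2 x hx]; ring
  · rw [(h₂ x hx).2.2, dirDeriv_const, hF₁.conn_zero_zero_three hP hc0 hd h4 h2 hx, h2 x hx]
    field_simp
    ring

end IsPrincipalOn

theorem exists_principal (hP : IsParaKaehlerEinstein g K) (hF : IsAdaptedOn g K V F)
    (hN : ∀ x ∈ V, F.PetrovTypeN x) (h4 : ∀ x ∈ V, F.Ψ₄ x ≠ 0) :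
    ∃ F' : MovingFrame M, IsPrincipalOn g K V F' ∧ ∀ x ∈ V, F'.Ψ₄ x = F.Ψ₄ x := by
  have s3 : SmoothFun V F.Ψ₃ := smoothRing.smoothFun _ (hF.Ψ₃_eq hP.smoothMetric hP.einstein)
  have s4 : SmoothFun V F.Ψ₄ := smoothRing.smoothFun _ (hF.Ψ₄_eq hP.smoothMetric hP.einstein)
  obtain ⟨F', hF', hm⟩ := hF.exists_change (SmoothFun.const 1) (SmoothFun.const 0)
    (s3.div s4 h4).neg (SmoothFun.const 1) (by simp)
  have key : ∀ x ∈ V, ∀ a b, F'.quartic x a b = F.Ψ₄ x * b ^ 4 := by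
    intro x hx a b
    rw [hF.quartic_change hF' hP hx (hm x hx), ← (hN x hx).quartic_eq (h4 x hx) a b]
    simp
  have e := fun x hx => F'.coefficients_of_quartic (key x hx)
  exact ⟨F', ⟨hF', fun x hx => ⟨(e x hx).1, (e x hx).2.1, (e x hx).2.2.1, (e x hx).2.2.2.1⟩,
    fun x hx => by rw [(e x hx).2.2.2.2]; exact h4 x hx⟩, fun x hx => (e x hx).2.2.2.2⟩

theorem exists_Ψ₄_ne_zero (hP : IsParaKaehlerEinstein g K) (hF : IsAdaptedOn g K V F) {x : M}
    (hx : x ∈ V) (hN : F.PetrovTypeN x) :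
    ∃ F' : MovingFrame M, IsAdaptedOn g K V F' ∧ F'.Ψ₄ x ≠ 0 := by
  by_cases h4 : F.Ψ₄ x = 0
  · obtain ⟨F', hF', hm⟩ := hF.exists_change (SmoothFun.const 0) (SmoothFun.const 1)
      (SmoothFun.const 1) (SmoothFun.const 0) (by simp)
    refine ⟨F', hF', ?_⟩
    have h := hF.quartic_change hF' hP hx (hm x hx) 0 1
    simp at h
    rw [F'.quartic_zero_left, F.quartic_zero_right] at h
    simp only [one_pow, mul_one] at h
    rw [h]
    obtain ⟨c, a, b, hc, hab, hq⟩ := hN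
    intro h0
    have q0 := hq 0 1
    have q1 := hq 1 0
    rw [F.quartic_zero_left, h4] at q0
    rw [F.quartic_zero_right, h0] at q1
    simp [hc] at q0 q1
    exact hab (by rw [q0, q1])
  · exact ⟨F, hF, h4⟩

namespace IsNormalizedOn

variable {c d : ℝ}

theorem isPrincipalOn (hF : IsNormalizedOn g K V F c d) (hc : c ≠ 0) : IsPrincipalOn g K V F :=
  ⟨hF.toIsAdaptedOn, fun x hx => ⟨hF.Ψ₀_eq x hx, hF.Ψ₁_eq x hx, hF.Ψ₂_eq x hx, hF.Ψ₃_eq x hx⟩,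
    fun x hx => by rw [hF.Ψ₄_eq x hx]; exact hc⟩

theorem reducedConnection (hF : IsNormalizedOn g K V F c d) (hP : IsParaKaehlerEinstein g K)
    (hc : c ≠ 0) (hd : d ≠ 0) :
    F.ReducedConnection V (fun x => F.conn 1 0 x (F.frame 1 x)) (fun _ => d)
      (fun x => F.conn 0 0 x (F.frame 1 x)) (fun _ => 0) (fun x => F.conn 1 1 x (F.frame 1 x))
      (fun x => F.conn 1 1 x (F.frame 2 x)) (fun x => F.conn 0 1 x (F.frame 1 x))
      (fun x => F.conn 0 1 x (F.frame 2 x)) := by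
  intro x hx
  have hg := hP.smoothMetric
  have H := (hF.isPrincipalOn hc).isSemiNormalized hP hc hd hF.Ψ₄_eq hF.J₂_eq
  have H02 : (hF.alg hg).Γ 0 0 2 = 0 := smoothRing.eq_of fun x => hF.J₄_eq x x.2
  obtain ⟨r1, r2, r3, r4, r5, r6⟩ := H.relations
  obtain ⟨r7, r8⟩ := H.relations' H02
  have k := hF.Ψ₂'_eq hg hP.einstein ⟨x, hx⟩
  rw [H.Rl01, smoothRing.zero_apply, zero_sub] at k
  replace r1 := congrArg (smoothRing.ev ⟨x, hx⟩) r1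
  replace r2 := congrArg (smoothRing.ev ⟨x, hx⟩) r2
  replace r3 := congrArg (smoothRing.ev ⟨x, hx⟩) r3
  replace r4 := congrArg (smoothRing.ev ⟨x, hx⟩) r4
  replace r5 := congrArg (smoothRing.ev ⟨x, hx⟩) r5
  replace r6 := congrArg (smoothRing.ev ⟨x, hx⟩) r6
  replace r7 := congrArg (smoothRing.ev ⟨x, hx⟩) r7
  replace r8 := congrArg (smoothRing.ev ⟨x, hx⟩) r8
  have j2 : F.conn 1 0 x (F.frame 2 x) = d := hF.J₂_eq x hx
  have j4 : F.conn 0 0 x (F.frame 2 x) = 0 := hF.J₄_eq x hx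
  simp only [map_mul, map_add, map_neg, map_zero, map_ofNat, smoothRing.ev_apply,
    IsNullFrameOn.alg_Γ_apply, j2] at r1 r2 r3 r4 r5 r6 r7 r8
  have e5 : F.conn 0 0 x (F.frame 0 x) = -(3 / 2 * F.conn 1 0 x (F.frame 1 x)) := by linarith
  have e6 : F.conn 0 0 x (F.frame 3 x) = 3 / 2 * d := by linarith
  have e7 : F.conn 0 1 x (F.frame 0 x) = -(1 / 5 * (2 * F.conn 0 0 x (F.frame 1 x)
      + 3 * F.conn 1 1 x (F.frame 1 x) + 7 * (F.Ψ₂' x / d))) := by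
    rw [k]
    field_simp
    linear_combination r7
  have e8 : F.conn 0 1 x (F.frame 3 x) = 3 / 5 * F.conn 1 1 x (F.frame 2 x) := by linarith
  refine ⟨?_, ?_, ?_, ?_, ?_, ?_⟩
  · rw [hF.conn_eq_sum hx 1 0, Fin.sum_univ_four, r1, r2, j2]
    simp
  · rw [hF.conn_eq_sum hx 0 0, Fin.sum_univ_four, e5, e6, j4]
  · rw [hF.conn_eq_sum hx 1 1, Fin.sum_univ_four, r3, r4]
  · rw [hF.conn_eq_sum hx 0 1, Fin.sum_univ_four, e7, e8]
  · rw [hF.conn_eq_sum hx 0 3]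
    simp [hF.conn_zero_three hP hx]
  · rw [hF.conn_eq_sum hx 3 0]
    simp [hF.conn_three_zero hP hx]

/-- The transition matrix between two normalized frames. -/
theorem transition_eq (hF : IsNormalizedOn g K V F c d) (hF' : IsNormalizedOn g K V F' c d)
    (hP : IsParaKaehlerEinstein g K) (hc : c ≠ 0) (hd : d ≠ 0) {x : M} (hx : x ∈ V) :
    ∃ s : ℝ, (s = 1 ∨ s = -1) ∧ F.coframe 0 x (F'.frame 0 x) = s ∧
      ∀ a, F'.coframe a x = ![s, 1, s, 1] a • F.coframe a x := by
  have h := fun y hy => (hF.isPrincipalOn hc).change (hF'.isPrincipalOn hc) hP (x := y) hy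
    (fun _ _ => rfl)
  have hm : ∀ y ∈ V, F.coframe 3 y (F'.frame 3 y) = 1 ∧ F.coframe 1 y (F'.frame 1 y) = 1 ∧
      F.coframe 0 y (F'.frame 0 y) ^ 2 = 1 := by
    intro y hy
    obtain ⟨-, -, h1, h2, -, h3, h4, -⟩ := h y hy
    rw [hF.Ψ₄_eq y hy, hF'.Ψ₄_eq y hy] at h3
    rw [hF.J₂_eq y hy, hF'.J₂_eq y hy] at h4
    have m3 : F.coframe 3 y (F'.frame 3 y) = 1 := mul_right_cancel₀ hd (by linarith)
    have m1 : F.coframe 1 y (F'.frame 1 y) = 1 := by rw [m3] at h2; linarith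
    refine ⟨m3, m1, ?_⟩
    rw [m1, mul_one] at h3
    have : F.coframe 2 y (F'.frame 2 y) ^ 2 = 1 := mul_right_cancel₀ hc (by linarith)
    have h5 : (F.coframe 2 y (F'.frame 2 y) * F.coframe 0 y (F'.frame 0 y)) ^ 2 = 1 := by
      rw [h1, one_pow]
    rwa [mul_pow, this, one_mul] at h5
  have hD : ∀ v, dirDeriv (fun y => F.coframe 0 y (F'.frame 0 y)) x v = 0 := by
    intro v
    have hs := hF.smooth_coframe hP.smoothMetric 0 (hF'.smooth 0)
    have e := dirDeriv_eq_zero hF.isOpen hx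
      (fun y hy => by rw [← sq]; exact (hm y hy).2.2) v
        (f := fun y => F.coframe 0 y (F'.frame 0 y) * F.coframe 0 y (F'.frame 0 y))
    rw [dirDeriv_mul hs hs hF.isOpen hx] at e
    have h0 : F.coframe 0 x (F'.frame 0 x) ≠ 0 := fun h0 => by
      have := (hm x hx).2.2
      rw [h0] at this
      norm_num at this
    have : F.coframe 0 x (F'.frame 0 x)
      * dirDeriv (fun y => F.coframe 0 y (F'.frame 0 y)) x v = 0 := by linarith
    exact (mul_eq_zero.1 this).resolve_left h0
  obtain ⟨h10, h23, h1, -, h01, -, -, h4⟩ := h x hx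
  obtain ⟨m3, m1, m0⟩ := hm x hx
  rw [hD, hF.J₄_eq x hx, hF'.J₄_eq x hx, hF.J₂_eq x hx, (hF.isPrincipalOn hc).conn_zero_zero_three hP
    hc hd hF.Ψ₄_eq hF.J₂_eq hx] at h4
  have m32 : F.coframe 3 x (F'.frame 2 x) = 0 := by
    have : F.coframe 3 x (F'.frame 2 x) * (5 / 2 * d) = 0 := by linarith
    exact (mul_eq_zero.1 this).resolve_right (by positivity)
  have m2 : F.coframe 2 x (F'.frame 2 x) = F.coframe 0 x (F'.frame 0 x) := by
    linear_combination F.coframe 0 x (F'.frame 0 x) * h1 - F.coframe 2 x (F'.frame 2 x) * m0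
  have m01 : F.coframe 0 x (F'.frame 1 x) = 0 := by
    rw [m32, m2] at h01
    linear_combination F.coframe 0 x (F'.frame 0 x) * h01 - F.coframe 0 x (F'.frame 1 x) * m0
  refine ⟨F.coframe 0 x (F'.frame 0 x), sq_eq_sq_iff_eq_or_eq_neg.1 (m0.trans (one_pow 2).symm), rfl, fun a => ?_⟩
  have hb : ∀ a b, sgn a ≠ sgn b → F.coframe a x (F'.frame b x) = 0 := fun a b hab =>
    hF.coframe_eq_zero hx (hF'.K_frame hx b) hab
  have b02 := hb 0 2 (by simp [sgn]; norm_num)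
  have b03 := hb 0 3 (by simp [sgn]; norm_num)
  have b12 := hb 1 2 (by simp [sgn]; norm_num)
  have b13 := hb 1 3 (by simp [sgn]; norm_num)
  have b20 := hb 2 0 (by simp [sgn]; norm_num)
  have b21 := hb 2 1 (by simp [sgn]; norm_num)
  have b30 := hb 3 0 (by simp [sgn]; norm_num)
  have b31 := hb 3 1 (by simp [sgn]; norm_num)
  ext v
  rw [hF'.coframe_eq hx, hF.metric_apply hx, Fin.sum_univ_four]
  match a with
  | 0 => simp [m2, m32, b02, b12]
  | 1 => simp [m3, h23, b03, b13]
  | 2 => simp [h10, b20, b30]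
  | 3 => simp [m1, m01, b21, b31]

end IsNormalizedOn

theorem bracket_const_smul (hF : IsNullFrameOn g V F) {x : M} (hx : x ∈ V) (r s : ℝ) (a b : Fin 4) :
    bracket (fun y => r • F.frame a y) (fun y => s • F.frame b y) x
      = (r * s) • bracket (F.frame a) (F.frame b) x := by
  rw [bracket_smul_right _ hF.isOpen hx (SmoothFun.const s) (hF.smooth b), bracket_swap,
    bracket_smul_right _ hF.isOpen hx (SmoothFun.const r) (hF.smooth a), bracket_swap (F.frame b),
    dirDeriv_const, dirDeriv_const]
  simp [smul_smul, mul_comm]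

theorem IsAdaptedOn.reflect (hF : IsAdaptedOn g K V F) : IsAdaptedOn g K V F.reflect := by
  have hε : ∀ a : Fin 4, (![-1, 1, -1, 1] a * ![-1, 1, -1, 1] a : ℝ) = 1 := by
    intro a; fin_cases a <;> simp
  have hεb : ∀ a : Fin 4, (![-1, 1, -1, 1] (bar a) : ℝ) = ![-1, 1, -1, 1] a := by
    intro a; fin_cases a <;> rfl
  have hd : ∀ x ∈ V, ∀ a b, F.reflect.coframe a x (F.reflect.frame b x) = if a = b then 1 else 0 := by
    intro x hx a b
    change (![-1, 1, -1, 1] a • F.coframe a x) ((![-1, 1, -1, 1] b : ℝ) • F.frame b x) = _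
    rw [LinearMap.smul_apply, map_smul, hF.dual x hx]
    split_ifs with h
    · rw [h, smul_eq_mul, smul_eq_mul, mul_one, hε]
    · simp
  refine ⟨⟨hF.isOpen, fun a => SmoothVField.const_smul _ (hF.smooth a), hd, fun x hx => ?_,
    fun x hx a c d => ?_, fun x hx a b => ?_⟩, fun x hx => ?_⟩
  · ext v w
    rw [hF.metric_apply hx, MovingFrame.metric]
    simp only [η_apply, LinearMap.sum_apply, ite_smul, one_smul, zero_smul, Finset.sum_ite_eq',
      Finset.mem_univ, if_true, LinearMap.BilinForm.linMulLin_apply]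
    refine Finset.sum_congr rfl fun a _ => ?_
    rw [reflect_coframe, reflect_coframe, hεb, LinearMap.smul_apply, LinearMap.smul_apply,
      smul_eq_mul, smul_eq_mul]
    linear_combination -(F.coframe a x v * F.coframe (bar a) x w) * hε a
  · have e1 : ∀ b, ∀ v, dirDeriv (fun y => F.reflect.coframe a y (F.reflect.frame b y)) x v = 0 :=
      fun b v => dirDeriv_eq_zero hF.isOpen hx (fun y hy => hd y hy a b) v
    have hw : ∀ b, wedge (F.reflect.conn a b) (F.reflect.coframe b) (F.reflect.frame c)
        (F.reflect.frame d) x = ![-1, 1, -1, 1] a * (![-1, 1, -1, 1] c * ![-1, 1, -1, 1] d) *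
          wedge (F.conn a b) (F.coframe b) (F.frame c) (F.frame d) x := by
      intro b
      simp only [wedge, MovingFrame.reflect, LinearMap.smul_apply, map_smul, smul_eq_mul]
      generalize hu : (![-1, 1, -1, 1] b : ℝ) = u
      have := hε b
      rw [hu] at this
      linear_combination ![-1, 1, -1, 1] a * (![-1, 1, -1, 1] c * ![-1, 1, -1, 1] d) *
        (F.conn a b x (F.frame c x) * F.coframe b x (F.frame d x)
          - F.conn a b x (F.frame d x) * F.coframe b x (F.frame c x)) * this
    have ht := hF.torsion_free x hx a c d
    have e2 : ∀ b, ∀ v, dirDeriv (fun y => F.coframe a y (F.frame b y)) x v = 0 :=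
      fun b v => dirDeriv_eq_zero hF.isOpen hx (fun y hy => hF.dual y hy a b) v
    simp only [dOne, e2] at ht
    simp only [dOne, e1, hw, ← Finset.mul_sum]
    have hb : F.reflect.coframe a x (bracket (F.reflect.frame c) (F.reflect.frame d) x)
        = ![-1, 1, -1, 1] a * (![-1, 1, -1, 1] c * ![-1, 1, -1, 1] d) *
          F.coframe a x (bracket (F.frame c) (F.frame d) x) := by
      have := bracket_const_smul hF.toIsNullFrameOn hx (![-1, 1, -1, 1] c) (![-1, 1, -1, 1] d) c d
      rw [reflect_coframe, LinearMap.smul_apply, smul_eq_mul]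
      rw [show bracket (F.reflect.frame c) (F.reflect.frame d) x = _ from this, map_smul, smul_eq_mul]
      ring
    rw [hb]
    linear_combination ![-1, 1, -1, 1] a * (![-1, 1, -1, 1] c * ![-1, 1, -1, 1] d) * ht
  · have h := hF.conn_bar hx a b
    simp only [η_apply, Finset.sum_add_distrib, ite_smul, one_smul, zero_smul, Finset.sum_ite_eq',
      Finset.mem_univ, if_true, MovingFrame.reflect, hεb]
    rw [mul_comm (![-1, 1, -1, 1] b : ℝ), ← smul_add, h, smul_zero]
  · rw [hF.paracomplex_eq x hx]
    ext1 v
    rw [paracomplex_apply, paracomplex_apply]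
    refine Finset.sum_congr rfl fun a _ => ?_
    rw [reflect_coframe, LinearMap.smul_apply, smul_eq_mul]
    change _ = _ • ((![-1, 1, -1, 1] a : ℝ) • F.frame a x)
    rw [smul_smul]
    congr 1
    linear_combination -(sgn a * F.coframe a x v) * hε a

theorem IsNormalizedOn.reflect {c d : ℝ} (hF : IsNormalizedOn g K V F c d)
    (hP : IsParaKaehlerEinstein g K) (hc : c ≠ 0) : IsNormalizedOn g K V F.reflect c d := by
  have hR := hF.toIsAdaptedOn.reflect
  have hm : ∀ x ∈ V, ∀ a b, F.coframe a x (F.reflect.frame b x)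
      = Matrix.diagonal ![-1, 1, -1, 1] a b := by
    intro x hx a b
    change F.coframe a x ((![-1, 1, -1, 1] b : ℝ) • F.frame b x) = _
    rw [map_smul, hF.dual x hx, Matrix.diagonal_apply]
    split_ifs with h
    · rw [h, smul_eq_mul, mul_one]
    · simp
  have hp := hF.isPrincipalOn hc
  have key : ∀ x ∈ V, ∀ a b, F.reflect.quartic x a b = F.Ψ₄ x * b ^ 4 := by
    intro x hx a b
    rw [hF.quartic_change hR hP hx (hm x hx), F.quartic_of_coefficients (hp.Ψ_eq x hx)]
    simp
  have e := fun x hx => F.reflect.coefficients_of_quartic (key x hx)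
  have hp' : IsPrincipalOn g K V F.reflect :=
    ⟨hR, fun x hx => ⟨(e x hx).1, (e x hx).2.1, (e x hx).2.2.1, (e x hx).2.2.2.1⟩,
      fun x hx => by rw [(e x hx).2.2.2.2]; exact hp.Ψ₄_ne x hx⟩
  refine ⟨hR, fun x hx => (e x hx).1, fun x hx => (e x hx).2.1, fun x hx => (e x hx).2.2.1,
    fun x hx => (e x hx).2.2.2.1, fun x hx => by rw [(e x hx).2.2.2.2, hF.Ψ₄_eq x hx],
    fun x hx => ?_, fun x hx => ?_⟩
  · rw [(hp.change hp' hP hx (hm x hx)).2.2.2.2.2.2.1, hF.J₂_eq x hx]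
    simp
  · rw [(hp.change hp' hP hx (hm x hx)).2.2.2.2.2.2.2, hF.J₄_eq x hx,
      dirDeriv_eq_zero hF.isOpen hx (fun y hy => hm y hy 0 0)]
    simp

end PKE

namespace PKE

section LinearAlgebra

variable {E : Type*} [AddCommGroup E] [Module ℝ E] {B : LinearMap.BilinForm ℝ E} {K : Module.End ℝ E}

theorem bilin_eigen (hc : ∀ v w, B (K v) (K w) = -B v w) {r : ℝ} (hr : r * r = 1) {v w : E}
    (hv : K v = r • v) (hw : K w = r • w) : B v w = 0 := by
  have h := hc v w
  rw [hv, hw, map_smul, map_smul, LinearMap.smul_apply, smul_smul, hr, one_smul] at h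
  linarith

/-- The projection to an eigenspace of an involution. -/
theorem eigen_proj (h2 : K * K = 1) {r : ℝ} (hr : r * r = 1) (v : E) :
    K ((1 / 2 : ℝ) • (v + r • K v)) = r • ((1 / 2 : ℝ) • (v + r • K v)) := by
  have hK : K (K v) = v := congrArg (fun L : Module.End ℝ E => L v) h2
  rw [map_smul, map_add, map_smul, hK, smul_comm r (1 / 2 : ℝ), smul_add r, smul_smul r r, hr,
    one_smul, add_comm]

/-- A para-Hermitian vector space of dimension four has an adapted null basis. -/
theorem exists_null_basis (hs : ∀ v w, B v w = B w v) (hn : B.Nondegenerate) (h2 : K * K = 1)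
    (hc : ∀ v w, B (K v) (K w) = -B v w) (hE : Module.finrank ℝ E = 4) :
    ∃ e : Fin 4 → E, (∀ a b, B (e a) (e b) = if b = bar a then 1 else 0) ∧
      ∀ a, K (e a) = sgn a • e a := by
  have hK : ∀ v, K (K v) = v := fun v => congrArg (fun L : Module.End ℝ E => L v) h2
  have hpos : ∀ {v w}, K v = v → K w = w → B v w = 0 := fun hv hw =>
    bilin_eigen hc (r := 1) (by norm_num) (by rw [hv, one_smul]) (by rw [hw, one_smul])
  have hneg : ∀ {v w}, K v = -v → K w = -w → B v w = 0 := fun hv hw =>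
    bilin_eigen hc (r := -1) (by norm_num) (by rw [hv, neg_one_smul]) (by rw [hw, neg_one_smul])
  have hdec : ∀ v, ∃ p m, K p = p ∧ K m = -m ∧ v = p + m := by
    intro v
    refine ⟨(1 / 2 : ℝ) • (v + K v), (1 / 2 : ℝ) • (v - K v), ?_, ?_, ?_⟩
    · rw [map_smul, map_add, hK, add_comm]
    · rw [map_smul, map_sub, hK, ← smul_neg, neg_sub]
    · module
  have h0 : ∀ v, (∀ w, B v w = 0) → v = 0 := hn.1
  have hsmall : ∀ v w : E, ¬ (∀ u, ∃ r s : ℝ, u = r • v + s • w) := by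
    intro v w h
    have : Submodule.span ℝ {v, w} = ⊤ := by
      rw [eq_top_iff]
      rintro u -
      obtain ⟨r, s, rfl⟩ := h u
      exact Submodule.mem_span_pair.2 ⟨r, s, rfl⟩
    classical
    have h1 := finrank_span_finset_le_card (R := ℝ) ({v, w} : Finset E)
    rw [Finset.coe_pair, Set.finrank, this, finrank_top, hE] at h1
    exact absurd (h1.trans Finset.card_le_two) (by norm_num)
  have hpair : ∀ v, K v = v → v ≠ 0 → ∃ w, K w = -w ∧ B v w = 1 := by
    intro v hv hv0
    obtain ⟨u, hu⟩ : ∃ u, B v u ≠ 0 := by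
      by_contra! h
      exact hv0 (h0 v h)
    obtain ⟨p, m, hp, hm, rfl⟩ := hdec u
    rw [map_add, hpos hv hp, zero_add] at hu
    refine ⟨(B v m)⁻¹ • m, by rw [map_smul, hm, smul_neg], ?_⟩
    rw [map_smul, smul_eq_mul, inv_mul_cancel₀ hu]
  obtain ⟨v₁, hv₁, hv₁0⟩ : ∃ v, K v = v ∧ v ≠ 0 := by
    by_contra! h
    have h1 : ∀ v, K v = -v := by
      intro v
      obtain ⟨p, m, hp, hm, rfl⟩ := hdec v
      rw [h p hp, zero_add, hm]
    exact hsmall 0 0 fun u => ⟨0, 0, by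
      rw [h0 u fun w => hneg (h1 u) (h1 w)]; simp⟩
  obtain ⟨w₁, hw₁, h11⟩ := hpair v₁ hv₁ hv₁0
  obtain ⟨v₂, hv₂, hv₂0, h21⟩ : ∃ v, K v = v ∧ v ≠ 0 ∧ B v w₁ = 0 := by
    by_contra! h
    have hp : ∀ p, K p = p → p = B p w₁ • v₁ := by
      intro p hp
      by_contra hne
      refine h (p - B p w₁ • v₁) (by rw [map_sub, map_smul, hp, hv₁]) (sub_ne_zero.2 hne) ?_
      rw [map_sub, map_smul, LinearMap.sub_apply, LinearMap.smul_apply, h11, smul_eq_mul]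
      ring
    have hm : ∀ m, K m = -m → m = B v₁ m • w₁ := by
      intro m hm
      rw [← sub_eq_zero]
      refine h0 _ fun u => ?_
      obtain ⟨p, m', hp', hm', rfl⟩ := hdec u
      have : K (m - B v₁ m • w₁) = -(m - B v₁ m • w₁) := by
        rw [map_sub, map_smul, hm, hw₁]; module
      rw [map_add, hneg this hm', add_zero, hp p hp', map_smul, hs _ v₁, map_sub, map_smul, h11]
      simp
    refine hsmall v₁ w₁ fun u => ?_
    obtain ⟨p, m, hp', hm', rfl⟩ := hdec u
    exact ⟨_, _, by rw [← hp p hp', ← hm m hm']⟩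
  obtain ⟨u, hu, h2u⟩ := hpair v₂ hv₂ hv₂0
  have hw₂ : K (u - B v₁ u • w₁) = -(u - B v₁ u • w₁) := by
    rw [map_sub, map_smul, hu, hw₁]; module
  have h12 : B v₁ (u - B v₁ u • w₁) = 0 := by rw [map_sub, map_smul, h11]; simp
  have h22 : B v₂ (u - B v₁ u • w₁) = 1 := by rw [map_sub, map_smul, h21, h2u]; simp
  generalize u - B v₁ u • w₁ = w₂ at hw₂ h12 h22
  refine ⟨![v₁, v₂, w₁, w₂], fun a b => ?_, fun a => ?_⟩
  · have h11' := (hs w₁ v₁).trans h11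
    have h12' := (hs w₂ v₁).trans h12
    have h21' := (hs w₁ v₂).trans h21
    have h22' := (hs w₂ v₂).trans h22
    fin_cases a <;> fin_cases b <;> simp [hpos, hneg, hv₁, hv₂, hw₁, hw₂, h11, h12, h21, h22, h11',
      h12', h21', h22']
  · fin_cases a <;> simp [sgn, hv₁, hv₂, hw₁, hw₂]

/-- Normalization of the Gram matrix of an eigenbasis of a para-complex structure. -/
theorem gram_normalize (hs : ∀ v w, B v w = B w v) {y : Fin 4 → E}
    (hz : ∀ a b, sgn a = sgn b → B (y a) (y b) = 0) {Δ : ℝ} (hΔ : Δ ≠ 0)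
    (hΔe : B (y 0) (y 2) * B (y 1) (y 3) - B (y 0) (y 3) * B (y 1) (y 2) = Δ) (a b : Fin 4) :
    B ((![y 0, y 1, (B (y 1) (y 3) / Δ) • y 2 + (-B (y 1) (y 2) / Δ) • y 3,
        (-B (y 0) (y 3) / Δ) • y 2 + (B (y 0) (y 2) / Δ) • y 3] : Fin 4 → E) a)
      ((![y 0, y 1, (B (y 1) (y 3) / Δ) • y 2 + (-B (y 1) (y 2) / Δ) • y 3,
        (-B (y 0) (y 3) / Δ) • y 2 + (B (y 0) (y 2) / Δ) • y 3] : Fin 4 → E) b)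
      = if b = bar a then 1 else 0 := by
  have z : ∀ {a b}, sgn a = sgn b → B (y a) (y b) = 0 := fun h => hz _ _ h
  have z00 := @z 0 0 rfl
  have z01 := @z 0 1 rfl
  have z10 := @z 1 0 rfl
  have z11 := @z 1 1 rfl
  have z22 := @z 2 2 rfl
  have z23 := @z 2 3 rfl
  have z32 := @z 3 2 rfl
  have z33 := @z 3 3 rfl
  have e1 : B (y 1) (y 3) / Δ * B (y 0) (y 2) + -B (y 1) (y 2) / Δ * B (y 0) (y 3) = 1 := by
    field_simp; linarith
  have e2 : B (y 1) (y 3) / Δ * B (y 1) (y 2) + -B (y 1) (y 2) / Δ * B (y 1) (y 3) = 0 := by ring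
  have e3 : -B (y 0) (y 3) / Δ * B (y 0) (y 2) + B (y 0) (y 2) / Δ * B (y 0) (y 3) = 0 := by ring
  have e4 : -B (y 0) (y 3) / Δ * B (y 1) (y 2) + B (y 0) (y 2) / Δ * B (y 1) (y 3) = 1 := by
    field_simp; linarith
  have s1 := hs (y 2) (y 0)
  have s2 := hs (y 2) (y 1)
  have s3 := hs (y 3) (y 0)
  have s4 := hs (y 3) (y 1)
  fin_cases a <;> fin_cases b <;>
    simp [z00, z01, z10, z11, z22, z23, z32, z33, s1, s2, s3, s4] <;> linarith

end LinearAlgebra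

variable {M : Type*} [TopologicalSpace M] [ChartedSpace E4 M] [IsManifold (𝓡 4) ∞ M]
  {g : BilinField M} {K : EndField M}

theorem exists_smooth_extension (x : M) (v : TangentSpace (𝓡 4) x) :
    ∃ (V : Set M) (X : VField M), IsOpen V ∧ x ∈ V ∧ SmoothVField V X ∧ X x = v := by
  obtain ⟨s, hs, h⟩ := FiberBundle.exists_contMDiffOn_extend (k := ∞) (𝓡 4) E4 v
  obtain ⟨V, hVs, hV, hx⟩ := mem_nhds_iff.1 hs
  exact ⟨V, _, hV, hx, ContMDiffOn.mono h hVs, FiberBundle.extend_apply_self E4 v⟩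

/-- Adapted frames exist locally. -/
theorem exists_isAdaptedOn (hP : IsParaKaehlerEinstein g K) (x : M) :
    ∃ (V : Set M) (F : MovingFrame M), x ∈ V ∧ IsAdaptedOn g K V F := by
  obtain ⟨e, heG, heK⟩ := exists_null_basis (hP.symm x) (hP.nondegenerate x) (hP.sq_eq_one x)
    (hP.compatible x) (finrank_tangentSpace x)
  choose W X hW hxW hX hXe using fun a => exists_smooth_extension x (e a)
  obtain ⟨V, hV, hxV, hVW⟩ : ∃ V : Set M, IsOpen V ∧ x ∈ V ∧ ∀ a, V ⊆ W a :=
    ⟨⋂ a, W a, isOpen_iInter_of_finite hW, Set.mem_iInter.2 hxW, Set.iInter_subset W⟩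
  replace hX := fun a => (hX a).mono (hVW a)
  obtain ⟨Y, hY, hYe, hYK⟩ : ∃ Y : Fin 4 → VField M, (∀ a, SmoothVField V (Y a)) ∧
      (∀ a, Y a x = e a) ∧ ∀ a y, K y (Y a y) = sgn a • Y a y := by
    refine ⟨fun a y => (1 / 2 : ℝ) • (X a y + sgn a • K y (X a y)), fun a => ?_, fun a => ?_,
      fun a y => eigen_proj (hP.sq_eq_one y) (sgn_mul_self a) _⟩
    · exact SmoothVField.const_smul _ (SmoothVField.add (hX a)
        (SmoothVField.const_smul _ (hP.smooth_endo V _ hV (hX a))))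
    · change (1 / 2 : ℝ) • (X a x + sgn a • K x (X a x)) = e a
      rw [hXe, heK, smul_smul, sgn_mul_self]
      module
  have hG : ∀ a b, SmoothFun V fun y => g y (Y a y) (Y b y) := fun a b =>
    hP.smooth_metric V _ _ hV (hY a) (hY b)
  have hD := ((hG 0 2).mul (hG 1 3)).sub ((hG 0 3).mul (hG 1 2))
  let U : Set M := {y ∈ V | g y (Y 0 y) (Y 2 y) * g y (Y 1 y) (Y 3 y)
    - g y (Y 0 y) (Y 3 y) * g y (Y 1 y) (Y 2 y) ≠ 0}
  have hU : IsOpen U := hD.continuousOn.isOpen_inter_preimage hV isOpen_ne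
  have hUV : U ⊆ V := fun y hy => hy.1
  have hxU : x ∈ U := ⟨hxV, by simp [hYe, heG]⟩
  have hz : ∀ a b, sgn a = sgn b → ∀ y, g y (Y a y) (Y b y) = 0 := fun a b hab y =>
    bilin_eigen (hP.compatible y) (sgn_mul_self a) (hYK a y) (by rw [hYK, hab])
  replace hG := fun a b => (hG a b).mono hUV
  replace hD := hD.mono hUV
  have c : ∀ {u v : M → ℝ} (a b : Fin 4), SmoothFun U u → SmoothFun U v →
    SmoothVField U (fun y => u y • Y a y + v y • Y b y) := fun a b hu hv =>
      SmoothVField.add (SmoothVField.smul hu ((hY a).mono hUV))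
        (SmoothVField.smul hv ((hY b).mono hUV))
  let Δ : M → ℝ := fun y => g y (Y 0 y) (Y 2 y) * g y (Y 1 y) (Y 3 y)
    - g y (Y 0 y) (Y 3 y) * g y (Y 1 y) (Y 2 y)
  refine ⟨U, MovingFrame.ofFrame g fun a y => (![Y 0 y, Y 1 y,
    (g y (Y 1 y) (Y 3 y) / Δ y) • Y 2 y + (-g y (Y 1 y) (Y 2 y) / Δ y) • Y 3 y,
    (-g y (Y 0 y) (Y 3 y) / Δ y) • Y 2 y + (g y (Y 0 y) (Y 2 y) / Δ y) • Y 3 y] :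
      Fin 4 → TangentSpace (𝓡 4) y) a, hxU, isAdaptedOn_ofFrame hU (fun a => ?_)
    (fun y hy => gram_normalize (hP.symm y) (y := fun a => Y a y) (fun a b hab => hz a b hab y) hy.2
      rfl) (fun y hy a => ?_)⟩
  · match a with
    | 0 => exact (hY 0).mono hUV
    | 1 => exact (hY 1).mono hUV
    | 2 => exact c 2 3 ((hG 1 3).div hD fun y hy => hy.2) ((hG 1 2).neg.div hD fun y hy => hy.2)
    | 3 => exact c 2 3 ((hG 0 3).neg.div hD fun y hy => hy.2) ((hG 0 2).div hD fun y hy => hy.2)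
  · match a with
    | 0 => exact hYK 0 y
    | 1 => exact hYK 1 y
    | 2 | 3 =>
      have h2 := hYK 2 y
      have h3 := hYK 3 y
      change K y (_ • Y 2 y + _ • Y 3 y) = (-1 : ℝ) • (_ • Y 2 y + _ • Y 3 y)
      rw [map_add, map_smul, map_smul, h2, h3]
      change _ • (-1 : ℝ) • _ + _ • (-1 : ℝ) • _ = _
      module

end PKE

namespace PKE

variable {M : Type*} [TopologicalSpace M] [ChartedSpace E4 M] [IsManifold (𝓡 4) ∞ M]
  {g : BilinField M} {K : EndField M} {F F' : MovingFrame M} {V : Set M}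

theorem exists_isPrincipalOn (hP : IsParaKaehlerEinstein g K) (hN : HasPetrovTypeN g K) (x : M) :
    ∃ (V : Set M) (F : MovingFrame M), x ∈ V ∧ IsPrincipalOn g K V F := by
  obtain ⟨V, F, hx, hF⟩ := exists_isAdaptedOn hP x
  obtain ⟨F, hF, h4⟩ := exists_Ψ₄_ne_zero hP hF hx (hN V F hF x hx)
  have s4 : SmoothFun V F.Ψ₄ := smoothRing.smoothFun _ (hF.Ψ₄_eq hP.smoothMetric hP.einstein)
  have hW := s4.continuousOn.isOpen_inter_preimage hF.isOpen (isOpen_ne (x := (0 : ℝ)))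
  have hF' := hF.mono hW Set.inter_subset_left
  obtain ⟨F', hF', -⟩ := exists_principal hP hF' (hN _ F hF') fun y hy => hy.2
  exact ⟨V ∩ F.Ψ₄ ⁻¹' {y | y ≠ 0}, F', ⟨hx, h4⟩, hF'⟩

/-- The domain and the sign on which normalized frames exist. -/
theorem exists_normalized_iff (hP : IsParaKaehlerEinstein g K) (hN : HasPetrovTypeN g K)
    (hJ : J₂NonVanishing g K) (x : M) :
    ∃ U : Set M, IsOpen U ∧ x ∈ U ∧ ∃ σ : ℝ, (σ = 1 ∨ σ = -1) ∧ ∀ c d : ℝ, c ≠ 0 → d ≠ 0 →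
      ((∃ F : MovingFrame M, IsNormalizedOn g K U F c d) ↔ 0 < σ * c) := by
  obtain ⟨V, F, hx, hF⟩ := exists_isPrincipalOn hP hN x
  obtain ⟨σ, hσ, hσx⟩ : ∃ σ : ℝ, (σ = 1 ∨ σ = -1) ∧ 0 < σ * F.Ψ₄ x := by
    rcases lt_or_gt_of_ne (hF.Ψ₄_ne x hx) with h | h
    · exact ⟨-1, Or.inr rfl, by linarith⟩
    · exact ⟨1, Or.inl rfl, by linarith⟩
  have hU := ((SmoothFun.const σ).mul (hF.smooth_Ψ₄ hP)).continuousOn.isOpen_inter_preimage hF.isOpen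
    (isOpen_Ioi (a := (0 : ℝ)))
  replace hF := hF.mono hU Set.inter_subset_left
  refine ⟨_, hU, ⟨hx, hσx⟩, σ, hσ, fun c d hc hd => ⟨?_, fun h => ?_⟩⟩
  · rintro ⟨F', hF'⟩
    have h := (hF.change (hF'.isPrincipalOn hc) hP ⟨hx, hσx⟩ fun _ _ => rfl).2.2.2.2.2.1
    rw [hF'.Ψ₄_eq x ⟨hx, hσx⟩] at h
    have h0 : σ * c ≠ 0 := mul_ne_zero (by rcases hσ with rfl | rfl <;> norm_num) hc
    refine lt_of_le_of_ne ?_ h0.symm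
    rw [h, mul_left_comm]
    exact mul_nonneg (sq_nonneg _) hσx.le
  · refine hF.exists_normalized hP (hJ _ F hF.toIsAdaptedOn hF.Ψ_eq) hd (fun y hy => ?_) hc
    have h1 : 0 < σ * F.Ψ₄ y := hy.2
    have h2 : F.Ψ₄ y / c = (σ * F.Ψ₄ y) / (σ * c) := by
      rw [mul_div_mul_left]
      rcases hσ with rfl | rfl <;> norm_num
    rw [h2]
    exact div_pos h1 h

/-- Uniqueness of the normalized frames up to reflection. -/
theorem IsNormalizedOn.eq_or_eq_reflect {c d : ℝ} (hF : IsNormalizedOn g K V F c d)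
    (hF' : IsNormalizedOn g K V F' c d) (hP : IsParaKaehlerEinstein g K) (hc : c ≠ 0) (hd : d ≠ 0) :
    ∃ s : M → ℝ, ContinuousOn s V ∧ ∀ x ∈ V,
      (s x = 1 ∧ ∀ a, F'.coframe a x = F.coframe a x) ∨
      (s x = -1 ∧ ∀ a, F'.coframe a x = F.reflect.coframe a x) := by
  refine ⟨fun x => F.coframe 0 x (F'.frame 0 x),
    (hF.smooth_coframe hP.smoothMetric 0 (hF'.smooth 0)).continuousOn, fun x hx => ?_⟩
  obtain ⟨s, hs, h0, h⟩ := hF.transition_eq hF' hP hc hd hx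
  rcases hs with rfl | rfl
  · refine Or.inl ⟨h0, fun a => ?_⟩
    rw [h]
    fin_cases a <;> simp
  · exact Or.inr ⟨h0, h⟩

theorem IsNormalizedOn.exists_reducedConnection {c d : ℝ} (hF : IsNormalizedOn g K V F c d)
    (hP : IsParaKaehlerEinstein g K) (hc : c ≠ 0) (hd : d ≠ 0) :
    ∃ J₁ J₃ J₅ J₆ J₇ J₈ : M → ℝ, (∀ J ∈ [J₁, J₃, J₅, J₆, J₇, J₈], SmoothFun V J) ∧
      F.ReducedConnection V J₁ (fun _ => d) J₃ (fun _ => 0) J₅ J₆ J₇ J₈ := by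
  refine ⟨_, _, _, _, _, _, ?_, hF.reducedConnection hP hc hd⟩
  have h := hF.smooth_conn hP.smoothMetric
  simp only [List.mem_cons, List.not_mem_nil, or_false, forall_eq_or_imp, forall_eq]
  exact ⟨h _ _ _, h _ _ _, h _ _ _, h _ _ _, h _ _ _, h _ _ _⟩

end PKE

namespace PKE

namespace FrameAlg

variable {A : Type*} [CommRing A] [Algebra ℝ A] {C C' : FrameAlg A} {h k : Matrix (Fin 4) (Fin 4) A}

theorem Change.Ric_eq (H : Change C C' h k) (a b : Fin 4) :
    C'.Ric a b = ∑ i, ∑ j, h i a * h j b * C.Ric i j := by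
  have hk : ∀ i m, ∑ c, h m c * k c i = if m = i then 1 else 0 := fun i m => by
    rw [← Matrix.mul_apply, H.mul_inv, Matrix.one_apply]
  have e : ∀ c, C'.R c a c b = ∑ i, ∑ j, ∑ m, ∑ n, (h m c * k c i) * (h j a * h n b * C.R i j m n) := by
    intro c
    rw [H.R_eq]
    exact Finset.sum_congr rfl fun i _ => Finset.sum_congr rfl fun j _ => Finset.sum_congr rfl
      fun m _ => Finset.sum_congr rfl fun n _ => by ring
  have e2 : ∀ i j, ∑ m, ∑ n, (if m = i then 1 else 0) * (h j a * h n b * C.R i j m n)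
      = ∑ n, h j a * h n b * C.R i j i n := by
    intro i j
    simp only [← Finset.mul_sum]
    simp only [ite_mul, one_mul, zero_mul, Finset.sum_ite_eq', Finset.mem_univ, if_true]
  simp only [Ric, e, sum_four]
  rw [Finset.sum_comm]
  simp only [← Finset.sum_mul, hk]
  simp only [Fintype.sum_prod_type, e2, Finset.mul_sum]
  rw [Finset.sum_comm]
  exact Finset.sum_congr rfl fun _ _ => Finset.sum_comm

end FrameAlg

variable {M : Type*} [TopologicalSpace M] [ChartedSpace E4 M] [IsManifold (𝓡 4) ∞ M]
  {g : BilinField M} {F : MovingFrame M} {V : Set M}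

theorem isEinstein_of_frame (hg : SmoothMetric g) (hF : IsNullFrameOn g Set.univ F)
    (hR : ∀ x a b, F.ricci a b x = F.scalar x / 4 * η a b) : IsEinstein g := by
  intro V F' hF' x hx a b
  have hFV := hF.mono hF'.isOpen (Set.subset_univ V)
  have key : ∀ a b, F'.ricci a b x = F.scalar x / 4 * η a b := by
    intro a b
    have h := congrArg (smoothRing.ev ⟨x, hx⟩) ((change_transition hFV hF' hg).Ric_eq a b)
    simp only [map_sum, map_mul, smoothRing.ev_apply, transition_apply, ← hF'.ricci_eq hg,
      ← hFV.ricci_eq hg, hR, η_apply] at h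
    have e := hFV.metric_apply hx (F'.frame a x) (F'.frame b x)
    rw [hF'.metric_frame_left hx, hF'.dual x hx] at e
    rw [h, η_apply, if_congr (eq_comm (a := b)) rfl rfl, e, Finset.mul_sum]
    simp only [mul_ite, mul_one, mul_zero, Finset.sum_ite_eq', Finset.mem_univ, if_true]
    exact Finset.sum_congr rfl fun _ _ => by ring
  have hs : F'.scalar x = F.scalar x := by
    rw [scalar_eq]
    simp only [key, η_apply, if_true]
    rw [Fin.sum_univ_four]
    ring
  rw [key, hs]

theorem IsNullFrameOn.smoothMetric (hF : IsNullFrameOn F.metric Set.univ F)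
    (hs : ∀ (V : Set M) (X : VField M), IsOpen V → SmoothVField V X → ∀ a,
      SmoothFun V fun x => F.coframe a x (X x)) : SmoothMetric F.metric := fun V X Y hV hX hY =>
  (SmoothFun.sum Finset.univ fun a _ => (hs V X hV hX a).mul (hs V Y hV hY (bar a))).congr
    fun _ _ => hF.metric_apply trivial _ _

/-- A parallel para-complex structure is para-Kähler. -/
theorem isParaKaehlerEinstein_of_frame (hF : IsNullFrameOn F.metric Set.univ F)
    (hs : ∀ (V : Set M) (X : VField M), IsOpen V → SmoothVField V X → ∀ a,
      SmoothFun V fun x => F.coframe a x (X x))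
    (hB : ∀ x, F.conn 0 3 x = 0 ∧ F.conn 3 0 x = 0)
    (hR : ∀ x a b, F.ricci a b x = F.scalar x / 4 * η a b) :
    IsParaKaehlerEinstein F.metric F.paracomplex := by
  have hd : ∀ x a b, F.coframe a x (F.frame b x) = if a = b then 1 else 0 := fun x =>
    hF.dual x trivial
  have hK : ∀ a x v, F.coframe a x (F.paracomplex x v) = sgn a * F.coframe a x v := fun a x v =>
    coframe_paracomplex (hd x) a v
  have hext : ∀ x (v w : TangentSpace (𝓡 4) x), (∀ a, F.coframe a x v = F.coframe a x w) → v = w := by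
    intro x v w h
    rw [← hF.sum_coframe trivial v, ← hF.sum_coframe trivial w]
    exact Finset.sum_congr rfl fun a _ => by rw [h]
  have hg := hF.smoothMetric hs
  have hdθ : ∀ {V : Set M} {X Y : VField M}, IsOpen V → SmoothVField V X → SmoothVField V Y →
      ∀ x ∈ V, ∀ a, dOne (F.coframe a) X Y x
        = -∑ b, wedge (F.conn a b) (F.coframe b) X Y x := fun hV hX hY x hx a =>
    (hF.mono hV (Set.subset_univ _)).dOne_coframe hg hx a hX hY
  have h03 : ∀ x, F.conn 0 3 x = 0 := fun x => (hB x).1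
  have h30 : ∀ x, F.conn 3 0 x = 0 := fun x => (hB x).2
  have hcb : ∀ a b x, F.conn (bar a) b x = -F.conn (bar b) a x := fun a b x =>
    eq_neg_of_add_eq_zero_left (hF.conn_bar trivial a b)
  have h12 : ∀ x, F.conn 1 2 x = 0 := fun x => by
    have := hcb 3 2 x
    simpa [h03] using this
  have h21 : ∀ x, F.conn 2 1 x = 0 := fun x => by
    have := hcb 0 1 x
    simpa [h30] using this
  have hz : ∀ {x : M} {L : Module.Dual ℝ (TangentSpace (𝓡 4) x)}, L = -L → L = 0 := by
    intro x L h
    ext v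
    have := congrArg (fun L : Module.Dual ℝ (TangentSpace (𝓡 4) x) => L v) h
    simp only [LinearMap.neg_apply] at this
    rw [LinearMap.zero_apply]
    linarith
  have h02 : ∀ x, F.conn 0 2 x = 0 := fun x => hz (hcb 2 2 x)
  have h13 : ∀ x, F.conn 1 3 x = 0 := fun x => hz (hcb 3 3 x)
  have h20 : ∀ x, F.conn 2 0 x = 0 := fun x => hz (hcb 0 0 x)
  have h31 : ∀ x, F.conn 3 1 x = 0 := fun x => hz (hcb 1 1 x)
  have hint : ∀ {V : Set M} {X Y : VField M} {r : ℝ}, IsOpen V → SmoothVField V X →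
      SmoothVField V Y → (∀ x ∈ V, F.paracomplex x (X x) = r • X x) →
      (∀ x ∈ V, F.paracomplex x (Y x) = r • Y x) → ∀ x ∈ V,
      F.paracomplex x (bracket X Y x) = r • bracket X Y x := by
    intro V X Y r hV hX hY hXr hYr x hx
    have hz : ∀ {Z : VField M}, (∀ x ∈ V, F.paracomplex x (Z x) = r • Z x) → ∀ a, sgn a ≠ r →
        ∀ y ∈ V, F.coframe a y (Z y) = 0 := by
      intro Z hZ a ha y hy
      have := hK a y (Z y)
      rw [hZ y hy, map_smul, smul_eq_mul] at this
      have : (sgn a - r) * F.coframe a y (Z y) = 0 := by linarith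
      exact (mul_eq_zero.1 this).resolve_left (sub_ne_zero.2 ha)
    have hconn : ∀ a b, sgn a ≠ sgn b → F.conn a b x = 0 := by
      intro a b
      fin_cases a <;> fin_cases b <;> simp [sgn, h02, h03, h12, h13, h20, h30, h21, h31]
    refine hext x _ _ fun a => ?_
    rw [hK, map_smul, smul_eq_mul]
    by_cases ha : sgn a = r
    · rw [ha]
    · have h := hdθ hV hX hY x hx a
      have e1 := dirDeriv_eq_zero hV hx (hz hXr a ha) (Y x)
      have e2 := dirDeriv_eq_zero hV hx (hz hYr a ha) (X x)
      have e3 : ∑ b, wedge (F.conn a b) (F.coframe b) X Y x = 0 := by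
        refine Finset.sum_eq_zero fun b _ => ?_
        by_cases hb : sgn a = sgn b
        · rw [wedge, hz hXr b (hb ▸ ha) x hx, hz hYr b (hb ▸ ha) x hx]
          ring
        · rw [wedge, hconn a b hb]
          simp
      rw [dOne, e1, e2, e3] at h
      have h0 : F.coframe a x (bracket X Y x) = 0 := by linarith
      rw [h0, mul_zero, mul_zero]
  refine ⟨fun x v w => ?_, fun x => ?_, hg, fun V X hV hX => ?_, fun x => ?_, fun x v w => ?_, ?_, ?_,
    ?_, isEinstein_of_frame hg hF hR⟩
  · rw [hF.metric_apply trivial, hF.metric_apply trivial, ← sum_bar]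
    exact Finset.sum_congr rfl fun a _ => by rw [bar_bar, mul_comm]
  · refine ⟨fun v h => ?_, fun v h => ?_⟩
    · refine hext x _ _ fun a => ?_
      rw [map_zero, ← bar_bar a, ← hF.metric_frame_right trivial]
      exact h _
    · refine hext x _ _ fun a => ?_
      rw [map_zero, ← bar_bar a, ← hF.metric_frame_left trivial]
      exact h _
  · exact (SmoothVField.sum Finset.univ fun a _ => SmoothVField.smul
      ((SmoothFun.const (sgn a)).mul (hs V X hV hX a)) ((hF.smooth a).mono (Set.subset_univ V))).congr
      fun x _ => paracomplex_apply F x (X x)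
  · ext1 v
    refine hext x _ _ fun a => ?_
    rw [Module.End.mul_apply, hK, hK, ← mul_assoc, sgn_mul_self, one_mul, Module.End.one_apply]
  · rw [hF.metric_apply trivial, hF.metric_apply trivial, ← Finset.sum_neg_distrib]
    refine Finset.sum_congr rfl fun a _ => ?_
    rw [hK, hK, sgn_bar]
    linear_combination -(F.coframe a x v * F.coframe (bar a) x w) * sgn_mul_self a
  · intro V X Y hV hX hY hX1 hY1 x hx
    have := hint (r := 1) hV hX hY (fun y hy => by rw [hX1 y hy, one_smul])
      (fun y hy => by rw [hY1 y hy, one_smul]) x hx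
    rwa [one_smul] at this
  · intro V X Y hV hX hY hX1 hY1 x hx
    have := hint (r := -1) hV hX hY (fun y hy => by rw [hX1 y hy, neg_one_smul])
      (fun y hy => by rw [hY1 y hy, neg_one_smul]) x hx
    rwa [neg_one_smul] at this
  · intro V X Y Z hV hX hY hZ x hx
    have h22 : F.conn 2 2 x = -F.conn 0 0 x := hcb 0 2 x
    have h23 : F.conn 2 3 x = -F.conn 1 0 x := hcb 0 3 x
    have h32 : F.conn 3 2 x = -F.conn 0 1 x := hcb 1 2 x
    have h33 : F.conn 3 3 x = -F.conn 1 1 x := hcb 1 3 x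
    have hρ : ∀ y v w, (F.metric y).comp (F.paracomplex y) LinearMap.id v w
        = F.coframe 0 y v * F.coframe 2 y w + F.coframe 1 y v * F.coframe 3 y w
          - F.coframe 2 y v * F.coframe 0 y w - F.coframe 3 y v * F.coframe 1 y w := by
      intro y v w
      rw [LinearMap.BilinForm.comp_apply, LinearMap.id_apply, hF.metric_apply trivial]
      simp [hK, Fin.sum_univ_four, sgn]
      ring
    have hD : ∀ {X Y : VField M}, SmoothVField V X → SmoothVField V Y → ∀ v,
        dirDeriv (fun y => (F.metric y).comp (F.paracomplex y) LinearMap.id (X y) (Y y)) x v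
        = F.coframe 0 x (X x) * dirDeriv (fun y => F.coframe 2 y (Y y)) x v
          + F.coframe 2 x (Y x) * dirDeriv (fun y => F.coframe 0 y (X y)) x v
          + (F.coframe 1 x (X x) * dirDeriv (fun y => F.coframe 3 y (Y y)) x v
          + F.coframe 3 x (Y x) * dirDeriv (fun y => F.coframe 1 y (X y)) x v)
          - (F.coframe 2 x (X x) * dirDeriv (fun y => F.coframe 0 y (Y y)) x v
          + F.coframe 0 x (Y x) * dirDeriv (fun y => F.coframe 2 y (X y)) x v)
          - (F.coframe 3 x (X x) * dirDeriv (fun y => F.coframe 1 y (Y y)) x v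
          + F.coframe 1 x (Y x) * dirDeriv (fun y => F.coframe 3 y (X y)) x v) := by
      intro X Y hX hY v
      have sX := fun a => hs V X hV hX a
      have sY := fun a => hs V Y hV hY a
      simp only [hρ]
      rw [dirDeriv_sub ((((sX 0).mul (sY 2)).add ((sX 1).mul (sY 3))).sub ((sX 2).mul (sY 0)))
          ((sX 3).mul (sY 1)) hV hx,
        dirDeriv_sub (((sX 0).mul (sY 2)).add ((sX 1).mul (sY 3))) ((sX 2).mul (sY 0)) hV hx,
        dirDeriv_add ((sX 0).mul (sY 2)) ((sX 1).mul (sY 3)) hV hx,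
        dirDeriv_mul (sX 0) (sY 2) hV hx, dirDeriv_mul (sX 1) (sY 3) hV hx,
        dirDeriv_mul (sX 2) (sY 0) hV hx, dirDeriv_mul (sX 3) (sY 1) hV hx]
    have hθ : ∀ {X Y : VField M}, SmoothVField V X → SmoothVField V Y → _ := fun hX hY =>
      hdθ hV hX hY x hx
    have xy := hθ hX hY
    have yz := hθ hY hZ
    have zx := hθ hZ hX
    simp only [dOne, wedge, Fin.sum_univ_four] at xy yz zx
    have xy0 := xy 0
    have xy1 := xy 1
    have xy2 := xy 2
    have xy3 := xy 3
    have yz0 := yz 0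
    have yz1 := yz 1
    have yz2 := yz 2
    have yz3 := yz 3
    have zx0 := zx 0
    have zx1 := zx 1
    have zx2 := zx 2
    have zx3 := zx 3
    simp only [h02, h03, h12, h13, h20, h30, h21, h31, h22, h23, h32, h33, LinearMap.zero_apply,
      LinearMap.neg_apply] at xy0 xy1 xy2 xy3 yz0 yz1 yz2 yz3 zx0 zx1 zx2 zx3
    rw [dTwo, hD hY hZ, hD hZ hX, hD hX hY, hρ, hρ, hρ]
    linear_combination F.coframe 2 x (Z x) * xy0 + F.coframe 3 x (Z x) * xy1
      - F.coframe 0 x (Z x) * xy2 - F.coframe 1 x (Z x) * xy3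
      + F.coframe 2 x (X x) * yz0 + F.coframe 3 x (X x) * yz1
      - F.coframe 0 x (X x) * yz2 - F.coframe 1 x (X x) * yz3
      + F.coframe 2 x (Y x) * zx0 + F.coframe 3 x (Y x) * zx1
      - F.coframe 0 x (Y x) * zx2 - F.coframe 1 x (Y x) * zx3

end PKE

namespace PKE

namespace FrameAlg

variable {A : Type*} [CommRing A] [Algebra ℝ A]

/-- The connection coefficients of the explicit coframe. -/
structure IsExample (C : FrameAlg A) (u j : A) : Prop extends Block C where
  D_u : ∀ a, C.D a u = 0
  D0_j : C.D 0 j = 0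
  D1_j : C.D 1 j = -1 + 2 * u * j
  D3_j : C.D 3 j = 4 * j
  Γ000 : C.Γ 0 0 0 = 0
  Γ001 : C.Γ 0 0 1 = -u
  Γ002 : C.Γ 0 0 2 = 0
  Γ003 : C.Γ 0 0 3 = -6
  Γ010 : C.Γ 0 1 0 = 2 * u
  Γ011 : C.Γ 0 1 1 = 0
  Γ012 : C.Γ 0 1 2 = j
  Γ013 : C.Γ 0 1 3 = 0
  Γ100 : C.Γ 1 0 0 = 0
  Γ101 : C.Γ 1 0 1 = 0
  Γ102 : C.Γ 1 0 2 = -4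
  Γ103 : C.Γ 1 0 3 = 0
  Γ110 : C.Γ 1 1 0 = 0
  Γ111 : C.Γ 1 1 1 = 2 * u
  Γ112 : C.Γ 1 1 2 = 0
  Γ113 : C.Γ 1 1 3 = -4

namespace IsExample

variable {C : FrameAlg A} {u j : A}

theorem Ric_eq (H : IsExample C u j) (a b : Fin 4) :
    C.Ric a b = if b = bar a then -24 * u else 0 := by
  have hD : ∀ a, C.D a (2 * u) = 0 := fun a => by rw [two_mul, map_add, H.D_u, add_zero]
  have hn : ∀ (a : Fin 4) (n : ℕ) [n.AtLeastTwo], C.D a (OfNat.ofNat n : A) = 0 := fun a n _ =>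
    Derivation.map_natCast (C.D a) n
  fin_cases a <;> fin_cases b <;>
  · simp [Ric, R, str, Fin.sum_univ_four, C.Γ02, H.Γ03, H.Γ12, C.Γ13, C.Γ20, H.Γ21, H.Γ30, C.Γ31,
      C.Γ22, C.Γ23, C.Γ32, C.Γ33, H.Γ000, H.Γ001, H.Γ002, H.Γ003, H.Γ010, H.Γ011, H.Γ012, H.Γ013,
      H.Γ100, H.Γ101, H.Γ102, H.Γ103, H.Γ110, H.Γ111, H.Γ112, H.Γ113, H.D0_j, H.D3_j, H.D_u,
      hD, hn, -mul_eq_mul_left_iff, -mul_eq_mul_right_iff, -mul_eq_zero]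
    try ring

theorem Rl_eq (H : IsExample C u j) :
    C.Rl 0 3 0 3 = 0 ∧ C.Rl 1 3 0 3 = 0 ∧ C.Rl 0 3 1 2 = 8 * u ∧ C.Rl 0 2 1 2 = 0
      ∧ C.Rl 1 2 1 2 = 1 := by
  have hn : ∀ (a : Fin 4) (n : ℕ) [n.AtLeastTwo], C.D a (OfNat.ofNat n : A) = 0 := fun a n _ =>
    Derivation.map_natCast (C.D a) n
  refine ⟨?_, ?_, ?_, ?_, ?_⟩ <;>
  · simp [Rl, R, str, Fin.sum_univ_four, C.Γ02, H.Γ03, H.Γ12, C.Γ13, C.Γ20, H.Γ21, H.Γ30, C.Γ31,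
      C.Γ22, C.Γ23, C.Γ32, C.Γ33, H.Γ000, H.Γ001, H.Γ002, H.Γ003, H.Γ010, H.Γ011, H.Γ012, H.Γ013,
      H.Γ100, H.Γ101, H.Γ102, H.Γ103, H.Γ110, H.Γ111, H.Γ112, H.Γ113, H.D1_j, H.D_u, hn, -mul_eq_mul_left_iff, -mul_eq_mul_right_iff, -mul_eq_zero]
    try ring

end IsExample

end FrameAlg

end PKE

namespace PKE

section Euclidean

variable {V : Set E4} {X Y : VField E4} {y : E4}

theorem smoothVField_iff : SmoothVField V X ↔ ∀ i, SmoothFun V fun y => dy i y (X y) := by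
  have h1 : ∀ X : E4 → E4, SmoothVField V X ↔ ContDiffOn ℝ ∞ X V := fun X =>
    contMDiffOn_vectorSpace_iff_contDiffOn
  have h2 : ∀ (X : E4 → E4) (i), SmoothFun V (fun y => dy i y (X y)) ↔
      ContDiffOn ℝ ∞ (fun y => X y i) V := fun X i => contMDiffOn_iff_contDiffOn
  exact (h1 X).trans (contDiffOn_euclidean.trans (forall_congr' fun i => (h2 X i).symm))

theorem smoothFun_coordinate {φ : ℝ → ℝ} (hφ : ContDiff ℝ ∞ φ) (i : Fin 4) :
    SmoothFun V fun y : E4 => φ (y i) :=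
  SmoothFun.comp_real (f := fun y : E4 => y i)
    (contMDiffOn_iff_contDiffOn.2 (EuclideanSpace.proj (𝕜 := ℝ) i).contDiff.contDiffOn)
    fun _ _ => hφ.contDiffAt

theorem dirDeriv_of_hasFDerivAt {f : E4 → ℝ} {f' : E4 →L[ℝ] ℝ} (h : HasFDerivAt f f' y) (v : E4) :
    dirDeriv f y v = f' v := by
  have h1 : mfderiv (𝓡 4) 𝓘(ℝ, ℝ) f y = fderiv ℝ f y := mfderiv_eq_fderiv
  exact congrArg (fun L : E4 →L[ℝ] ℝ => L v) (h1.trans h.fderiv)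

theorem dirDeriv_coordinate {φ : ℝ → ℝ} (hφ : ContDiff ℝ ∞ φ) (i : Fin 4)
    (v : TangentSpace (𝓡 4) y) : dirDeriv (fun y : E4 => φ (y i)) y v = deriv φ (y i) * dy i y v := by
  have h1 : HasDerivAt φ (deriv φ (y i)) (y i) := (hφ.differentiable (by simp) _).hasDerivAt
  have h2 : HasFDerivAt (fun y : E4 => y i) (EuclideanSpace.proj (𝕜 := ℝ) i) y :=
    (EuclideanSpace.proj (𝕜 := ℝ) i).hasFDerivAt
  exact dirDeriv_of_hasFDerivAt (h1.comp_hasFDerivAt y h2) v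

theorem dy_bracket (hV : IsOpen V) (hy : y ∈ V) (hX : SmoothVField V X) (hY : SmoothVField V Y)
    (i : Fin 4) : dy i y (bracket X Y y)
      = dirDeriv (fun y => dy i y (Y y)) y (X y) - dirDeriv (fun y => dy i y (X y)) y (Y y) := by
  have hd : ∀ X : E4 → E4, SmoothVField V X → ∀ v : E4,
      dirDeriv (fun y => dy i y (X y)) y v = dy i y (fderiv ℝ X y v) := by
    intro X hX v
    have h1 : ContDiffOn ℝ ∞ X V := contMDiffOn_vectorSpace_iff_contDiffOn.1 hX
    have h2 : HasFDerivAt X (fderiv ℝ X y) y :=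
      ((h1.contDiffAt (hV.mem_nhds hy)).differentiableAt (by simp)).hasFDerivAt
    exact dirDeriv_of_hasFDerivAt ((EuclideanSpace.proj (𝕜 := ℝ) i).hasFDerivAt.comp y h2) v
  have hb : ∀ X Y : E4 → E4, bracket X Y y = VectorField.lieBracket ℝ X Y y := fun X Y =>
    (congrFun VectorField.mlieBracketWithin_univ.symm y).trans
      ((congrFun VectorField.mlieBracketWithin_eq_lieBracketWithin y).trans
        (congrFun VectorField.lieBracketWithin_univ y))
  exact (congrArg (dy i y) (hb X Y)).trans ((map_sub (dy i y) _ _).trans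
    (congrArg₂ (· - ·) (hd Y hY (X y)).symm (hd X hX (Y y)).symm))

/-- The exterior derivative of a one-form in coordinates. -/
theorem dOne_sum_dy {f : Fin 4 → E4 → ℝ} (hf : ∀ i, SmoothFun V (f i)) (hV : IsOpen V) (hy : y ∈ V)
    (hX : SmoothVField V X) (hY : SmoothVField V Y) :
    dOne (fun y => ∑ i, f i y • dy i y) X Y y
      = ∑ i, (dirDeriv (f i) y (X y) * dy i y (Y y) - dirDeriv (f i) y (Y y) * dy i y (X y)) := by
  have hs : ∀ {X : VField E4}, SmoothVField V X → ∀ v : TangentSpace (𝓡 4) y,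
      dirDeriv (fun y => (∑ i, f i y • dy i y : Module.Dual ℝ (TangentSpace (𝓡 4) y)) (X y)) y v
      = ∑ i, (f i y * dirDeriv (fun y => dy i y (X y)) y v + dy i y (X y) * dirDeriv (f i) y v) := by
    intro X hX v
    have hXi := smoothVField_iff.1 hX
    simp only [LinearMap.sum_apply, LinearMap.smul_apply, smul_eq_mul]
    rw [dirDeriv_sum _ (fun i _ => (hf i).mul (hXi i)) hV hy]
    exact Finset.sum_congr rfl fun i _ => dirDeriv_mul (hf i) (hXi i) hV hy v
  rw [dOne, hs hX, hs hY]
  simp only [LinearMap.sum_apply, LinearMap.smul_apply, smul_eq_mul, dy_bracket hV hy hX hY]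
  rw [← Finset.sum_sub_distrib, ← Finset.sum_sub_distrib]
  exact Finset.sum_congr rfl fun i _ => by ring

end Euclidean

section Example

variable (k : ℝ) (F₁ F₂ : ℝ → ℝ)

/-- The coefficients of the explicit coframe. -/
def exampleCoeff : Fin 4 → Fin 4 → E4 → ℝ :=
  ![![fun y => 2 * Real.exp (-3 * y 3),
      fun y => 2 * Real.exp (-3 * y 3) * (-16 * y 2 ^ 2 + F₁ (y 1) + y 2 * F₂ (y 1)),
      fun _ => 0, fun _ => 0],
    ![fun _ => 0, fun y => -8 * Real.exp (-2 * y 3) * y 0, fun y => 8 * Real.exp (-2 * y 3),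
      fun _ => 0],
    ![fun _ => 0, fun y => Real.exp (y 3), fun _ => 0, fun _ => 0],
    ![fun _ => 0, fun y => k / 2 * Real.exp (-2 * y 3) * y 0, fun y => -k / 2 * Real.exp (-2 * y 3),
      fun _ => -1 / 2]]

/-- The vector fields dual to the explicit coframe. -/
def exampleVField : Fin 4 → VField E4 := fun b y =>
  (![!₂[1 / 2 * Real.exp (3 * y 3), 0, 0, 0],
    !₂[0, 0, 1 / 8 * Real.exp (2 * y 3), -k / 8],
    !₂[-Real.exp (-y 3) * (-16 * y 2 ^ 2 + F₁ (y 1) + y 2 * F₂ (y 1)), Real.exp (-y 3),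
      Real.exp (-y 3) * y 0, 0],
    !₂[0, 0, 0, -2]] : Fin 4 → E4) b

/-- The coefficient `J₈` of the explicit coframe. -/
def exampleJ₈ (y : E4) : ℝ := 1 / 4 * Real.exp (-2 * y 3) * (F₂ (y 1) - 32 * y 2)

/-- The explicit coframe with its Levi-Civita connection forms. -/
def exampleMovingFrame : MovingFrame E4 where
  coframe := exampleCoframe k F₁ F₂
  frame := exampleVField k F₁ F₂
  conn a b y :=
    let θ := fun c => exampleCoframe k F₁ F₂ c y
    let Γ₁₁ := -(k / 8) • θ 1 - (6 : ℝ) • θ 3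
    let Γ₁₂ := (k / 4) • θ 0 + exampleJ₈ F₂ y • θ 2
    let Γ₂₁ := -(4 : ℝ) • θ 2
    let Γ₂₂ := (k / 4) • θ 1 - (4 : ℝ) • θ 3
    (![![Γ₁₁, Γ₁₂, 0, 0], ![Γ₂₁, Γ₂₂, 0, 0], ![0, 0, -Γ₁₁, -Γ₂₁], ![0, 0, -Γ₁₂, -Γ₂₂]] :
      Fin 4 → Fin 4 → Module.Dual ℝ (TangentSpace (𝓡 4) y)) a b

theorem exampleCoframe_eq (a : Fin 4) (y : E4) :
    exampleCoframe k F₁ F₂ a y = ∑ i, exampleCoeff k F₁ F₂ a i y • dy i y := by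
  rw [Fin.sum_univ_four]
  match a with
  | 0 =>
    change (2 * Real.exp (-3 * y 3)) •
      (dy 0 y + (-16 * y 2 ^ 2 + F₁ (y 1) + y 2 * F₂ (y 1)) • dy 1 y) = (2 * Real.exp (-3 * y 3)) • dy 0 y
        + (2 * Real.exp (-3 * y 3) * (-16 * y 2 ^ 2 + F₁ (y 1) + y 2 * F₂ (y 1))) • dy 1 y
        + (0 : ℝ) • dy 2 y + (0 : ℝ) • dy 3 y
    module
  | 1 =>
    change (8 * Real.exp (-2 * y 3)) • (dy 2 y - y 0 • dy 1 y) = (0 : ℝ) • dy 0 y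
      + (-8 * Real.exp (-2 * y 3) * y 0) • dy 1 y + (8 * Real.exp (-2 * y 3)) • dy 2 y
      + (0 : ℝ) • dy 3 y
    module
  | 2 =>
    change Real.exp (y 3) • dy 1 y = (0 : ℝ) • dy 0 y + Real.exp (y 3) • dy 1 y + (0 : ℝ) • dy 2 y
      + (0 : ℝ) • dy 3 y
    module
  | 3 =>
    change (-1 / 2 : ℝ) • dy 3 y - (1 / 2 * k * Real.exp (-2 * y 3)) • (dy 2 y - y 0 • dy 1 y)
      = (0 : ℝ) • dy 0 y + (k / 2 * Real.exp (-2 * y 3) * y 0) • dy 1 y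
      + (-k / 2 * Real.exp (-2 * y 3)) • dy 2 y + (-1 / 2 : ℝ) • dy 3 y
    module

theorem exampleCoframe_apply (a : Fin 4) (y : E4) (v : TangentSpace (𝓡 4) y) :
    exampleCoframe k F₁ F₂ a y v = ∑ i, exampleCoeff k F₁ F₂ a i y * dy i y v := by
  rw [exampleCoframe_eq, LinearMap.sum_apply]
  rfl

theorem dy_exampleVField (i b : Fin 4) (y : E4) : dy i y (exampleVField k F₁ F₂ b y)
    = ![![1 / 2 * Real.exp (3 * y 3), 0, 0, 0],
      ![0, 0, 1 / 8 * Real.exp (2 * y 3), -k / 8],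
      ![-Real.exp (-y 3) * (-16 * y 2 ^ 2 + F₁ (y 1) + y 2 * F₂ (y 1)), Real.exp (-y 3),
        Real.exp (-y 3) * y 0, 0],
      ![0, 0, 0, -2]] b i := by
  fin_cases b <;> fin_cases i <;> rfl

end Example

end PKE

namespace PKE

section Calculus

variable {V : Set E4} {y : E4}

theorem smoothFun_proj (i : Fin 4) : SmoothFun V fun y : E4 => y i :=
  smoothFun_coordinate contDiff_id i

theorem dirDeriv_proj (i : Fin 4) (v : TangentSpace (𝓡 4) y) :
    dirDeriv (fun y : E4 => y i) y v = dy i y v := by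
  have h := dirDeriv_coordinate (φ := id) contDiff_id i v
  rwa [deriv_id, one_mul] at h

theorem contDiff_const_mul_exp (a c : ℝ) : ContDiff ℝ ∞ fun t => a * Real.exp (c * t) := by
  fun_prop

theorem smoothFun_exp (a c : ℝ) : SmoothFun V fun y : E4 => a * Real.exp (c * y 3) :=
  smoothFun_coordinate (contDiff_const_mul_exp a c) 3

theorem dirDeriv_exp (a c : ℝ) (v : TangentSpace (𝓡 4) y) :
    dirDeriv (fun y : E4 => a * Real.exp (c * y 3)) y v
      = a * c * Real.exp (c * y 3) * dy 3 y v := by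
  have h : deriv (fun t => a * Real.exp (c * t)) (y 3) = _ :=
    (((hasDerivAt_id (y 3)).const_mul c).exp.const_mul a).deriv
  rw [dirDeriv_coordinate (contDiff_const_mul_exp a c), h, id]
  ring

end Calculus

section Example

variable (k : ℝ) {F₁ F₂ : ℝ → ℝ} {V : Set E4} {y : E4}

theorem smoothFun_potential (h₁ : ContDiff ℝ ∞ F₁) (h₂ : ContDiff ℝ ∞ F₂) :
    SmoothFun V fun y : E4 => -16 * y 2 ^ 2 + F₁ (y 1) + y 2 * F₂ (y 1) :=
  ((smoothFun_coordinate (φ := fun z => -16 * z ^ 2) (by fun_prop) 2).add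
    (smoothFun_coordinate h₁ 1)).add ((smoothFun_proj 2).mul (smoothFun_coordinate h₂ 1))

theorem dirDeriv_potential (h₁ : ContDiff ℝ ∞ F₁) (h₂ : ContDiff ℝ ∞ F₂) (v : TangentSpace (𝓡 4) y) :
    dirDeriv (fun y : E4 => -16 * y 2 ^ 2 + F₁ (y 1) + y 2 * F₂ (y 1)) y v
      = (F₂ (y 1) - 32 * y 2) * dy 2 y v
        + (deriv F₁ (y 1) + y 2 * deriv F₂ (y 1)) * dy 1 y v := by
  have hz : ContDiff ℝ ∞ fun z : ℝ => -16 * z ^ 2 := by fun_prop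
  have s1 := smoothFun_coordinate (V := Set.univ) hz 2
  have s2 := smoothFun_coordinate (V := Set.univ) h₁ 1
  have s3 := smoothFun_coordinate (V := Set.univ) h₂ 1
  have s4 := smoothFun_proj (V := Set.univ) 2
  have hx : y ∈ (Set.univ : Set E4) := trivial
  rw [dirDeriv_add (s1.add s2) (s4.mul s3) isOpen_univ hx, dirDeriv_add s1 s2 isOpen_univ hx,
    dirDeriv_mul s4 s3 isOpen_univ hx, dirDeriv_coordinate hz, dirDeriv_coordinate h₁,
    dirDeriv_coordinate h₂, dirDeriv_proj]
  have : deriv (fun z : ℝ => -16 * z ^ 2) (y 2) = -32 * y 2 := by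
    rw [(((hasDerivAt_pow 2 (y 2))).const_mul (-16)).deriv]
    ring
  rw [this]
  ring

theorem smooth_exampleCoeff (h₁ : ContDiff ℝ ∞ F₁) (h₂ : ContDiff ℝ ∞ F₂) (a i : Fin 4) :
    SmoothFun V (exampleCoeff k F₁ F₂ a i) := by
  have h0 : SmoothFun V (fun _ : E4 => (0 : ℝ)) := SmoothFun.const 0
  fin_cases a <;> fin_cases i
  exacts [smoothFun_exp _ _, (smoothFun_exp _ _).mul (smoothFun_potential h₁ h₂), h0, h0, h0,
    (smoothFun_exp _ _).mul (smoothFun_proj 0), smoothFun_exp _ _, h0, h0,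
    smoothFun_coordinate Real.contDiff_exp 3, h0, h0, h0, (smoothFun_exp _ _).mul (smoothFun_proj 0),
    smoothFun_exp _ _, SmoothFun.const _]

theorem smooth_exampleCoframe (h₁ : ContDiff ℝ ∞ F₁) (h₂ : ContDiff ℝ ∞ F₂) {X : VField E4}
    (hX : SmoothVField V X) (a : Fin 4) : SmoothFun V fun y => exampleCoframe k F₁ F₂ a y (X y) :=
  (SmoothFun.sum Finset.univ fun i _ => (smooth_exampleCoeff k h₁ h₂ a i).mul
    (smoothVField_iff.1 hX i)).congr fun y _ => exampleCoframe_apply k F₁ F₂ a y (X y)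

theorem smooth_exampleVField (h₁ : ContDiff ℝ ∞ F₁) (h₂ : ContDiff ℝ ∞ F₂) (b : Fin 4) :
    SmoothVField V (exampleVField k F₁ F₂ b) := by
  refine smoothVField_iff.2 fun i => ?_
  simp only [dy_exampleVField]
  have h0 : SmoothFun V (fun _ : E4 => (0 : ℝ)) := SmoothFun.const 0
  have he : SmoothFun V fun y : E4 => Real.exp (-y 3) :=
    smoothFun_coordinate (φ := fun t => Real.exp (-t)) (by fun_prop) 3
  fin_cases b <;> fin_cases i
  exacts [smoothFun_exp _ _, h0, h0, h0, h0, h0, smoothFun_exp _ _, SmoothFun.const _,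
    he.neg.mul (smoothFun_potential h₁ h₂), he, he.mul (smoothFun_proj 0), h0, h0, h0, h0,
    SmoothFun.const _]

theorem exampleCoframe_exampleVField (F₁ F₂ : ℝ → ℝ) (y : E4) (a b : Fin 4) :
    exampleCoframe k F₁ F₂ a y (exampleVField k F₁ F₂ b y) = if a = b then 1 else 0 := by
  have hp : Real.exp (y 3) ≠ 0 := Real.exp_ne_zero _
  have e1 : Real.exp (3 * y 3) = Real.exp (y 3) ^ 3 := by rw [← Real.exp_nat_mul]; norm_num
  have e2 : Real.exp (2 * y 3) = Real.exp (y 3) ^ 2 := by rw [← Real.exp_nat_mul]; norm_num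
  have e3 : Real.exp (-(3 * y 3)) = (Real.exp (y 3) ^ 3)⁻¹ := by rw [← e1, ← Real.exp_neg]
  have e4 : Real.exp (-(2 * y 3)) = (Real.exp (y 3) ^ 2)⁻¹ := by rw [← e2, ← Real.exp_neg]
  have e5 : Real.exp (-y 3) = (Real.exp (y 3))⁻¹ := Real.exp_neg _
  rw [exampleCoframe_apply]
  simp only [dy_exampleVField, Fin.sum_univ_four]
  fin_cases a <;> fin_cases b <;>
    simp [exampleCoeff, e1, e2, e3, e4, e5, -mul_eq_zero] <;> try field_simp
  all_goals try ring

/-- The first structure equation of the explicit coframe. -/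
theorem exampleCoframe_torsion (h₁ : ContDiff ℝ ∞ F₁) (h₂ : ContDiff ℝ ∞ F₂) {X Y : VField E4}
    (hX : SmoothVField Set.univ X) (hY : SmoothVField Set.univ Y) (y : E4) (a : Fin 4) :
    dOne (exampleCoframe k F₁ F₂ a) X Y y
      + ∑ b, wedge ((exampleMovingFrame k F₁ F₂).conn a b) (exampleCoframe k F₁ F₂ b) X Y y = 0 := by
  have hp : Real.exp (y 3) ≠ 0 := Real.exp_ne_zero _
  have e1 : Real.exp (3 * y 3) = Real.exp (y 3) ^ 3 := by rw [← Real.exp_nat_mul]; norm_num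
  have e2 : Real.exp (2 * y 3) = Real.exp (y 3) ^ 2 := by rw [← Real.exp_nat_mul]; norm_num
  have e3 : Real.exp (-(3 * y 3)) = (Real.exp (y 3) ^ 3)⁻¹ := by rw [← e1, ← Real.exp_neg]
  have e4 : Real.exp (-(2 * y 3)) = (Real.exp (y 3) ^ 2)⁻¹ := by rw [← e2, ← Real.exp_neg]
  have hx : y ∈ (Set.univ : Set E4) := trivial
  have hc : exampleCoframe k F₁ F₂ a = fun y => ∑ i, exampleCoeff k F₁ F₂ a i y • dy i y :=
    funext (exampleCoframe_eq k F₁ F₂ a)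
  have D0 : ∀ v : TangentSpace (𝓡 4) y, dirDeriv (fun _ : E4 => (0 : ℝ)) y v = 0 :=
    dirDeriv_const 0
  have D00 : ∀ v, dirDeriv (exampleCoeff k F₁ F₂ 0 0) y v = _ := dirDeriv_exp 2 (-3)
  have D01 : ∀ v, dirDeriv (exampleCoeff k F₁ F₂ 0 1) y v = _ := fun v =>
    (dirDeriv_mul (smoothFun_exp 2 (-3)) (smoothFun_potential h₁ h₂) isOpen_univ hx v).trans
      (congrArg₂ (fun p q => _ * p + _ * q) (dirDeriv_potential h₁ h₂ v) (dirDeriv_exp 2 (-3) v))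
  have D11 : ∀ v, dirDeriv (exampleCoeff k F₁ F₂ 1 1) y v = _ := fun v =>
    (dirDeriv_mul (smoothFun_exp (-8) (-2)) (smoothFun_proj 0) isOpen_univ hx v).trans
      (congrArg₂ (fun p q => _ * p + _ * q) (dirDeriv_proj 0 v) (dirDeriv_exp (-8) (-2) v))
  have D12 : ∀ v, dirDeriv (exampleCoeff k F₁ F₂ 1 2) y v = _ := dirDeriv_exp 8 (-2)
  have D21 : ∀ v, dirDeriv (exampleCoeff k F₁ F₂ 2 1) y v = Real.exp (y 3) * dy 3 y v := fun v => by
    rw [← Real.deriv_exp]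
    exact dirDeriv_coordinate Real.contDiff_exp 3 v
  have D31 : ∀ v, dirDeriv (exampleCoeff k F₁ F₂ 3 1) y v = _ := fun v =>
    (dirDeriv_mul (smoothFun_exp (k / 2) (-2)) (smoothFun_proj 0) isOpen_univ hx v).trans
      (congrArg₂ (fun p q => _ * p + _ * q) (dirDeriv_proj 0 v) (dirDeriv_exp (k / 2) (-2) v))
  have D32 : ∀ v, dirDeriv (exampleCoeff k F₁ F₂ 3 2) y v = _ := dirDeriv_exp (-k / 2) (-2)
  have D33 : ∀ v, dirDeriv (exampleCoeff k F₁ F₂ 3 3) y v = _ := dirDeriv_const (-1 / 2)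
  have Z : ∀ (a i : Fin 4) (v), exampleCoeff k F₁ F₂ a i = (fun _ => 0) →
      dirDeriv (exampleCoeff k F₁ F₂ a i) y v = 0 := fun a i v h => by rw [h, D0]
  rw [hc, dOne_sum_dy (smooth_exampleCoeff k h₁ h₂ a) isOpen_univ hx hX hY]
  generalize hu : X y = u
  generalize hv : Y y = v
  simp only [wedge, exampleMovingFrame, hu, hv]
  match a with
  | 0 =>
    simp only [Fin.sum_univ_four, D00, D01, Z 0 2 _ rfl, Z 0 3 _ rfl]
    simp [exampleCoframe_apply, Fin.sum_univ_four, exampleCoeff, exampleJ₈, e3, e4]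
    field_simp
    ring
  | 1 =>
    simp only [Fin.sum_univ_four, D11, D12, Z 1 0 _ rfl, Z 1 3 _ rfl]
    simp [exampleCoframe_apply, Fin.sum_univ_four, exampleCoeff, exampleJ₈, e3, e4]
    field_simp
    ring
  | 2 =>
    simp only [Fin.sum_univ_four, D21, Z 2 0 _ rfl, Z 2 2 _ rfl, Z 2 3 _ rfl]
    simp [exampleCoframe_apply, Fin.sum_univ_four, exampleCoeff, exampleJ₈, e3, e4]
    field_simp
    ring
  | 3 =>
    simp only [Fin.sum_univ_four, D31, D32, D33, Z 3 0 _ rfl]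
    simp [exampleCoframe_apply, Fin.sum_univ_four, exampleCoeff, exampleJ₈, e3, e4]
    field_simp
    ring

end Example

end PKE

namespace PKE

section General

variable {M : Type*} [TopologicalSpace M] [ChartedSpace E4 M] [IsManifold (𝓡 4) ∞ M]
  {g : BilinField M} {K : EndField M} {F : MovingFrame M}

theorem IsPrincipalOn.hasPetrovTypeN (hF : IsPrincipalOn g K Set.univ F)
    (hP : IsParaKaehlerEinstein g K) : HasPetrovTypeN g K := by
  intro V F' hF' x hx
  have hFV := hF.mono hF'.isOpen (Set.subset_univ V)
  have hq := hFV.quartic_change hF' hP hx (fun _ _ => rfl)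
  obtain ⟨e1, e2, e3, e4⟩ := hFV.dual_relations hF' hP.smoothMetric hx (fun _ _ => rfl)
  generalize hm : (fun a b => F.coframe a x (F'.frame b x)) = m at *
  have hm : ∀ a b, F.coframe a x (F'.frame b x) = m a b := fun a b => by rw [← hm]
  simp only [hm] at hq e1 e2 e3 e4
  have hd : (m 2 2 * m 3 3 - m 2 3 * m 3 2) * (m 0 0 * m 1 1 - m 0 1 * m 1 0) = 1 := by
    linear_combination (m 2 3 * m 0 1 + m 3 3 * m 1 1) * e1 + e4
      - (m 2 3 * m 0 0 + m 3 3 * m 1 0) * e2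
  refine ⟨(m 2 2 * m 3 3 - m 2 3 * m 3 2) ^ 2 * F.Ψ₄ x, m 1 1, -m 1 0,
    mul_ne_zero (pow_ne_zero _ (left_ne_zero_of_mul (by rw [hd]; exact one_ne_zero)))
      (hF.Ψ₄_ne x trivial), fun h => ?_, fun s t => ?_⟩
  · rw [Prod.mk.injEq, neg_eq_zero] at h
    rw [h.1, h.2] at hd
    linarith
  · rw [hq, F.quartic_of_coefficients (hF.Ψ_eq x trivial)]
    ring

theorem IsPrincipalOn.J₂NonVanishing (hF : IsPrincipalOn g K Set.univ F)
    (hP : IsParaKaehlerEinstein g K) (hJ : ∀ x, F.J₂ x ≠ 0) : J₂NonVanishing g K := by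
  intro V F' hF' hΨ x hx
  have hF'P : IsPrincipalOn g K V F' := ⟨hF', hΨ, fun x hx h4 => by
    obtain ⟨c, a, b, hc, hab, hq⟩ := hF.hasPetrovTypeN hP V F' hF' x hx
    have h0 : ∀ s t, a * t - b * s = 0 := fun s t => by
      have h := hq s t
      rw [F'.quartic_of_coefficients (hΨ x hx), h4, zero_mul] at h
      exact pow_eq_zero_iff four_ne_zero |>.1 ((mul_eq_zero.1 h.symm).resolve_left hc)
    have ha := h0 0 1
    have hb := h0 1 0
    exact hab (Prod.ext (by linarith) (by linarith))⟩
  obtain ⟨-, -, -, h1, -, -, h2, -⟩ := (hF.mono hF'.isOpen (Set.subset_univ V)).change hF'P hP hx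
    (fun _ _ => rfl)
  rw [h2]
  exact mul_ne_zero (left_ne_zero_of_mul (by rw [h1]; exact one_ne_zero)) (hJ x)

end General

section Example

variable (k : ℝ) {F₁ F₂ : ℝ → ℝ} {V : Set E4}

theorem smooth_exampleJ₈ (h₂ : ContDiff ℝ ∞ F₂) : SmoothFun V (exampleJ₈ F₂) :=
  (smoothFun_exp _ _).mul ((smoothFun_coordinate h₂ 1).sub ((SmoothFun.const 32).mul (smoothFun_proj 2)))

theorem dirDeriv_exampleJ₈ (h₂ : ContDiff ℝ ∞ F₂) {y : E4} (v : TangentSpace (𝓡 4) y) :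
    dirDeriv (exampleJ₈ F₂) y v = 1 / 4 * Real.exp (-2 * y 3)
      * (deriv F₂ (y 1) * dy 1 y v - 32 * dy 2 y v - 2 * (F₂ (y 1) - 32 * y 2) * dy 3 y v) := by
  have s1 := smoothFun_exp (V := Set.univ) (1 / 4) (-2)
  have s2 := smoothFun_coordinate (V := Set.univ) h₂ 1
  have s3 : SmoothFun Set.univ fun _ : E4 => (32 : ℝ) := SmoothFun.const 32
  have s4 := smoothFun_proj (V := Set.univ) 2
  have hx : y ∈ (Set.univ : Set E4) := trivial
  have h := dirDeriv_mul s1 (s2.sub (s3.mul s4)) isOpen_univ hx v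
  rw [dirDeriv_sub s2 (s3.mul s4) isOpen_univ hx, dirDeriv_mul s3 s4 isOpen_univ hx,
    dirDeriv_coordinate h₂, dirDeriv_proj, dirDeriv_exp, dirDeriv_const] at h
  refine Eq.trans h ?_
  ring

theorem isNullFrameOn_example (h₁ : ContDiff ℝ ∞ F₁) (h₂ : ContDiff ℝ ∞ F₂) :
    IsNullFrameOn (exampleMovingFrame k F₁ F₂).metric Set.univ (exampleMovingFrame k F₁ F₂) where
  isOpen := isOpen_univ
  smooth := smooth_exampleVField k h₁ h₂
  dual y _ := exampleCoframe_exampleVField k F₁ F₂ y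
  metric_eq _ _ := rfl
  torsion_free y _ a c d := exampleCoframe_torsion k h₁ h₂ (smooth_exampleVField k h₁ h₂ c)
    (smooth_exampleVField k h₁ h₂ d) y a
  metricity y _ a b := by
    simp only [η_apply, ite_smul, one_smul, zero_smul, Finset.sum_add_distrib, Finset.sum_ite_eq',
      Finset.mem_univ, if_true]
    fin_cases a <;> fin_cases b <;> simp [bar, exampleMovingFrame]

theorem smoothMetric_example (h₁ : ContDiff ℝ ∞ F₁) (h₂ : ContDiff ℝ ∞ F₂) :
    SmoothMetric (exampleMovingFrame k F₁ F₂).metric :=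
  (isNullFrameOn_example k h₁ h₂).smoothMetric fun _ _ _ hX a => smooth_exampleCoframe k h₁ h₂ hX a

theorem example_conn (F₁ F₂ : ℝ → ℝ) (y : E4) (c : Fin 4) :
    (exampleMovingFrame k F₁ F₂).conn 0 0 y (exampleVField k F₁ F₂ c y) = ![0, -(k / 8), 0, -6] c ∧
    (exampleMovingFrame k F₁ F₂).conn 0 1 y (exampleVField k F₁ F₂ c y)
      = ![k / 4, 0, exampleJ₈ F₂ y, 0] c ∧
    (exampleMovingFrame k F₁ F₂).conn 1 0 y (exampleVField k F₁ F₂ c y) = ![0, 0, -4, 0] c ∧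
    (exampleMovingFrame k F₁ F₂).conn 1 1 y (exampleVField k F₁ F₂ c y) = ![0, k / 4, 0, -4] c := by
  have hd : ∀ a b, exampleCoframe k F₁ F₂ a y (exampleVField k F₁ F₂ b y) = if a = b then 1 else 0 :=
    exampleCoframe_exampleVField k F₁ F₂ y
  fin_cases c <;> simp [exampleMovingFrame, hd]

theorem isExample (h₁ : ContDiff ℝ ∞ F₁) (h₂ : ContDiff ℝ ∞ F₂) :
    ((isNullFrameOn_example k h₁ h₂).alg (smoothMetric_example k h₁ h₂)).IsExample
      (algebraMap ℝ _ (k / 8)) (smoothRing.mk (exampleJ₈ F₂) (smooth_exampleJ₈ h₂)) := by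
  have hΓ := example_conn k F₁ F₂
  have hu : (2 * algebraMap ℝ (smoothRing (Set.univ : Set E4)) (k / 8)) = algebraMap ℝ _ (k / 4) :=
    smoothRing.eq_of fun _ => by
      change 2 * (k / 8) = k / 4
      ring
  have hp : ∀ y : E4, Real.exp (-2 * y 3) * Real.exp (2 * y 3) = 1 := fun y => by
    rw [← Real.exp_add, neg_mul, neg_add_cancel, Real.exp_zero]
  have hD : ∀ a (x : (Set.univ : Set E4)),
      (((isNullFrameOn_example k h₁ h₂).alg (smoothMetric_example k h₁ h₂)).D a
        (smoothRing.mk (exampleJ₈ F₂) (smooth_exampleJ₈ h₂))).1 x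
        = 1 / 4 * Real.exp (-2 * x.1 3) * (deriv F₂ (x.1 1) * dy 1 x.1 (exampleVField k F₁ F₂ a x)
          - 32 * dy 2 x.1 (exampleVField k F₁ F₂ a x)
          - 2 * (F₂ (x.1 1) - 32 * x.1 2) * dy 3 x.1 (exampleVField k F₁ F₂ a x)) := fun a x =>
    ((isNullFrameOn_example k h₁ h₂).alg_D_apply (smoothMetric_example k h₁ h₂) a
      (smooth_exampleJ₈ h₂) (fun _ => rfl) x).trans (dirDeriv_exampleJ₈ h₂ _)
  refine ⟨⟨fun c => smoothRing.eq_of fun x => rfl, fun c => smoothRing.eq_of fun x => rfl⟩,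
    fun a => Derivation.map_algebraMap _ _, smoothRing.eq_of fun x => (hD 0 x).trans ?_,
    smoothRing.eq_of fun x => (hD 1 x).trans ?_, smoothRing.eq_of fun x => (hD 3 x).trans ?_,
    smoothRing.eq_of fun x => (hΓ x 0).1, smoothRing.eq_of fun x => (hΓ x 1).1,
    smoothRing.eq_of fun x => (hΓ x 2).1, smoothRing.eq_of fun x => (hΓ x 3).1,
    hu ▸ smoothRing.eq_of fun x => (hΓ x 0).2.1, smoothRing.eq_of fun x => (hΓ x 1).2.1,
    smoothRing.eq_of fun x => (hΓ x 2).2.1, smoothRing.eq_of fun x => (hΓ x 3).2.1,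
    smoothRing.eq_of fun x => (hΓ x 0).2.2.1, smoothRing.eq_of fun x => (hΓ x 1).2.2.1,
    smoothRing.eq_of fun x => (hΓ x 2).2.2.1, smoothRing.eq_of fun x => (hΓ x 3).2.2.1,
    smoothRing.eq_of fun x => (hΓ x 0).2.2.2, hu ▸ smoothRing.eq_of fun x => (hΓ x 1).2.2.2,
    smoothRing.eq_of fun x => (hΓ x 2).2.2.2, smoothRing.eq_of fun x => (hΓ x 3).2.2.2⟩
  · simp only [dy_exampleVField, Matrix.cons_val]
    rw [smoothRing.zero_apply]
    ring
  · rw [hu]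
    change _ = -1 + k / 4 * (1 / 4 * Real.exp (-2 * x.1 3) * (F₂ (x.1 1) - 32 * x.1 2))
    simp only [dy_exampleVField, Matrix.cons_val]
    linear_combination -hp x
  · change _ = 4 * (1 / 4 * Real.exp (-2 * x.1 3) * (F₂ (x.1 1) - 32 * x.1 2))
    simp only [dy_exampleVField, Matrix.cons_val]
    ring

theorem ricci_example (h₁ : ContDiff ℝ ∞ F₁) (h₂ : ContDiff ℝ ∞ F₂) (y : E4) (a b : Fin 4) :
    (exampleMovingFrame k F₁ F₂).ricci a b y = -3 * k * η a b := by
  rw [(isNullFrameOn_example k h₁ h₂).ricci_eq (smoothMetric_example k h₁ h₂) a b ⟨y, trivial⟩,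
    (isExample k h₁ h₂).Ric_eq, η_apply]
  split_ifs
  · change -24 * (k / 8) = _
    ring
  · rw [smoothRing.zero_apply, mul_zero]

theorem scalar_example (h₁ : ContDiff ℝ ∞ F₁) (h₂ : ContDiff ℝ ∞ F₂) (y : E4) :
    (exampleMovingFrame k F₁ F₂).scalar y = -12 * k := by
  rw [scalar_eq]
  simp only [ricci_example k h₁ h₂, η_apply, if_true, Fin.sum_univ_four]
  ring

theorem isParaKaehlerEinstein_example (h₁ : ContDiff ℝ ∞ F₁) (h₂ : ContDiff ℝ ∞ F₂) :
    IsParaKaehlerEinstein (exampleMovingFrame k F₁ F₂).metric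
      (exampleMovingFrame k F₁ F₂).paracomplex :=
  isParaKaehlerEinstein_of_frame (isNullFrameOn_example k h₁ h₂)
    (fun _ _ _ hX a => smooth_exampleCoframe k h₁ h₂ hX a) (fun _ => ⟨rfl, rfl⟩) fun y a b => by
      rw [ricci_example k h₁ h₂, scalar_example k h₁ h₂]
      ring

theorem Ψ₂'_example (h₁ : ContDiff ℝ ∞ F₁) (h₂ : ContDiff ℝ ∞ F₂) (y : E4) :
    (exampleMovingFrame k F₁ F₂).Ψ₂' y = k := by
  have hF := isNullFrameOn_example k h₁ h₂
  have hg := smoothMetric_example k h₁ h₂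
  have hE := (isParaKaehlerEinstein_example k h₁ h₂).einstein
  rw [hF.Ψ₂'_eq hg hE ⟨y, trivial⟩, hF.κ_apply hg, (isExample k h₁ h₂).Rl01, scalar_example k h₁ h₂,
    smoothRing.zero_apply]
  ring

theorem isNormalizedOn_example (h₁ : ContDiff ℝ ∞ F₁) (h₂ : ContDiff ℝ ∞ F₂) :
    IsNormalizedOn (exampleMovingFrame k F₁ F₂).metric (exampleMovingFrame k F₁ F₂).paracomplex
      Set.univ (exampleMovingFrame k F₁ F₂) 1 (-4) := by
  have hF := isNullFrameOn_example k h₁ h₂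
  have hg := smoothMetric_example k h₁ h₂
  have hE := (isParaKaehlerEinstein_example k h₁ h₂).einstein
  obtain ⟨e0, e1, e2, e3, e4⟩ := (isExample k h₁ h₂).Rl_eq
  refine ⟨⟨hF, fun _ _ => rfl⟩, fun y hy => ?_, fun y hy => ?_, fun y hy => ?_, fun y hy => ?_,
    fun y hy => ?_, fun y _ => (example_conn k F₁ F₂ y 2).2.2.1, fun y _ => (example_conn k F₁ F₂ y 2).1⟩
  · rw [hF.Ψ₀_eq hg hE ⟨y, hy⟩, e0, smoothRing.zero_apply]
  · rw [hF.Ψ₁_eq hg hE ⟨y, hy⟩, e1, smoothRing.zero_apply]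
  · rw [hF.Ψ₂_eq hg hE ⟨y, hy⟩, e2, hF.κ_apply hg, scalar_example k h₁ h₂]
    change -(8 * (k / 8)) - _ = 0
    ring
  · rw [hF.Ψ₃_eq hg hE ⟨y, hy⟩, e3, smoothRing.zero_apply]
  · rw [hF.Ψ₄_eq hg hE ⟨y, hy⟩, e4, smoothRing.one_apply]

theorem reducedConnection_example (h₁ : ContDiff ℝ ∞ F₁) (h₂ : ContDiff ℝ ∞ F₂) :
    (exampleMovingFrame k F₁ F₂).ReducedConnection Set.univ (fun _ => 0) (fun _ => -4)
      (fun _ => -k / 8) (fun _ => 0) (fun _ => k / 4) (fun _ => 0) (fun _ => 0) (exampleJ₈ F₂) := by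
  intro y _
  have e : -(1 / 5 * (2 * (-k / 8) + 3 * (k / 4) + 7 * (k / -4))) = k / 4 := by ring
  simp only [Ψ₂'_example k h₁ h₂, e]
  have h00 : (exampleMovingFrame k F₁ F₂).conn 0 0 y
      = -(k / 8) • exampleCoframe k F₁ F₂ 1 y - (6 : ℝ) • exampleCoframe k F₁ F₂ 3 y := rfl
  have h01 : (exampleMovingFrame k F₁ F₂).conn 0 1 y
      = (k / 4) • exampleCoframe k F₁ F₂ 0 y + exampleJ₈ F₂ y • exampleCoframe k F₁ F₂ 2 y := rfl
  have h10 : (exampleMovingFrame k F₁ F₂).conn 1 0 y = -(4 : ℝ) • exampleCoframe k F₁ F₂ 2 y := rfl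
  have h11 : (exampleMovingFrame k F₁ F₂).conn 1 1 y
      = (k / 4) • exampleCoframe k F₁ F₂ 1 y - (4 : ℝ) • exampleCoframe k F₁ F₂ 3 y := rfl
  rw [h00, h01, h10, h11, show (exampleMovingFrame k F₁ F₂).coframe = exampleCoframe k F₁ F₂ from rfl]
  refine ⟨?_, ?_, ?_, ?_, rfl, rfl⟩
  all_goals module

end Example

end PKE

end

theorem mainTheorem7 :
    (∀ (M : Type*) [TopologicalSpace M] [ChartedSpace PKE.E4 M] [IsManifold (𝓡 4) ∞ M]
      (g : PKE.BilinField M) (K : PKE.EndField M),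
      PKE.IsParaKaehlerEinstein g K → PKE.HasPetrovTypeN g K → PKE.J₂NonVanishing g K →
      (∀ p : M, ∃ U : Set M, IsOpen U ∧ p ∈ U ∧ ∃ σ : ℝ, (σ = 1 ∨ σ = -1) ∧
        ∀ c d : ℝ, c ≠ 0 → d ≠ 0 →
          ((∃ F : PKE.MovingFrame M, PKE.IsNormalizedOn g K U F c d) ↔ 0 < σ * c)) ∧
      (∀ (U : Set M) (c d : ℝ) (F : PKE.MovingFrame M), c ≠ 0 → d ≠ 0 →
        PKE.IsNormalizedOn g K U F c d →
        PKE.IsNormalizedOn g K U F.reflect c d ∧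
        (∀ F' : PKE.MovingFrame M, PKE.IsNormalizedOn g K U F' c d →
          ∃ s : M → ℝ, ContinuousOn s U ∧ ∀ x ∈ U,
            (s x = 1 ∧ ∀ a, F'.coframe a x = F.coframe a x) ∨
            (s x = -1 ∧ ∀ a, F'.coframe a x = F.reflect.coframe a x)) ∧
        ∃ J₁ J₃ J₅ J₆ J₇ J₈ : M → ℝ,
          (∀ J ∈ [J₁, J₃, J₅, J₆, J₇, J₈], PKE.SmoothFun U J) ∧
          F.ReducedConnection U J₁ (fun _ => d) J₃ (fun _ => 0) J₅ J₆ J₇ J₈)) ∧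
    (∀ (k : ℝ) (F₁ F₂ : ℝ → ℝ), ContDiff ℝ ∞ F₁ → ContDiff ℝ ∞ F₂ →
      ∃ F : PKE.MovingFrame PKE.E4, F.coframe = PKE.exampleCoframe k F₁ F₂ ∧
        PKE.IsParaKaehlerEinstein F.metric F.paracomplex ∧
        PKE.HasPetrovTypeN F.metric F.paracomplex ∧
        PKE.J₂NonVanishing F.metric F.paracomplex ∧
        PKE.IsNormalizedOn F.metric F.paracomplex Set.univ F 1 (-4) ∧
        (∀ y, F.Ψ₂' y = k) ∧
        ∃ J₈ : PKE.E4 → ℝ, PKE.SmoothFun Set.univ J₈ ∧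
          F.ReducedConnection Set.univ (fun _ => 0) (fun _ => -4) (fun _ => -k / 8)
            (fun _ => 0) (fun _ => k / 4) (fun _ => 0) (fun _ => 0) J₈) := by
  refine ⟨fun M _ _ _ g K hP hN hJ => ⟨fun p => PKE.exists_normalized_iff hP hN hJ p,
    fun U c d F hc hd hF => ⟨hF.reflect hP hc,
      fun F' hF' => hF.eq_or_eq_reflect hF' hP hc hd, hF.exists_reducedConnection hP hc hd⟩⟩,
    fun k F₁ F₂ h₁ h₂ => ?_⟩
  have hF := PKE.isNormalizedOn_example k h₁ h₂
  have hP := PKE.isParaKaehlerEinstein_example k h₁ h₂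
  have hF' := hF.isPrincipalOn one_ne_zero
  exact ⟨PKE.exampleMovingFrame k F₁ F₂, rfl, hP, hF'.hasPetrovTypeN hP,
    hF'.J₂NonVanishing hP fun x => by rw [hF.J₂_eq x trivial]; norm_num, hF,
    PKE.Ψ₂'_example k h₁ h₂, PKE.exampleJ₈ F₂, PKE.smooth_exampleJ₈ h₂,
    PKE.reducedConnection_example k h₁ h₂⟩
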